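/- Let $c>0$ and let $\lambda\in C^2\bigl((0,\infty),[0,\infty)\bigr)$; the integral $\int_0^t\lambda(s)\,ds$ may be finite or infinite. Consider a particle that starts at the origin of the plane at time $0$ and moves with constant speed $c$, its direction $D(t)$, $t>0$, always being one of $d_k=(\cos(k\pi/2),\sin(k\pi/2))$, $k\in\mathbb{Z}/4$. The direction changes exactly at the events of a non-homogeneous Poisson process on $(0,\infty)$ with rate function $\lambda$ (the events are locally finite in $(0,\infty)$ and may accumulate at $0$ if $\int_0^t\lambda(s)\,ds=\infty$). At each event the particle passes from its direction $d_k$ to $d_{k+1}$ or to $d_{k-1}$, with probability $1/2$ each; for every $a>0$ the turns made after time $a$ are mutually independent, and the sequence of these turns, the event times after $a$, and the evolution up to time $a$ are independent. The law of the initial direction is arbitrary. Let $(X(t),Y(t))=c\int_0^t D(s)\,ds$ be the position at time $t$ (the standard orthogonal planar motion), and for $t>0$ let $p(\cdot,\cdot,t)$ be a density of the absolutely continuous component, in the Lebesgue decomposition with respect to Lebesgue measure on $\mathbb{R}^2$, of the law of $(X(t),Y(t))$. Then on every open set $O\subseteq\mathbb{R}^2\times(0,\infty)$ on which $p=p(x,y,t)$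 is of class $C^4$, it satisfies at every point of $O$ the fourth-order partial differential equation with time-varying coefficients $$\Bigl(\frac{\partial^2}{\partial t^2}+2\lambda\frac{\partial}{\partial t}+\lambda^2+\lambda'\Bigr)\Bigl(\frac{\partial^2}{\partial t^2}+2\lambda\frac{\partial}{\partial t}-c^2\Bigl(\frac{\partial^2}{\partial x^2}+\frac{\partial^2}{\partial y^2}\Bigr)\Bigr)p+c^4\frac{\partial^4p}{\partial x^2\partial y^2}=\lambda'\frac{\partial^2p}{\partial t^2}+(\lambda''+\lambda\lambda')\frac{\partial p}{\partial t},$$ where $\lambda=\lambda(t)$ and the product of the two operators in brackets is their composition (the left one acts on the result of the right one, so that the time derivatives also act on the coefficients). -/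

import Mathlib

open MeasureTheory ProbabilityTheory Set

noncomputable section

namespace OrthogonalMotion

variable {Ω : Type*} [MeasurableSpace Ω]

/-- Number of events in the time interval `(a, b]`; `T ω` is the set of event times. -/
def count (T : Ω → Set ℝ) (a b : ℝ) (ω : Ω) : ℕ := (T ω ∩ Ioc a b).ncard

/-- Non-homogeneous Poisson process on `(0, ∞)` with rate function `lam`. The events are locally
finite in the open half-line only: they may accumulate at time `0`, which is what happens when
the integral of `lam` over `(0, t]` is infinite. -/
structure IsPoissonProcess (P : Measure Ω) (lam : ℝ → ℝ) (T : Ω → Set ℝ) : Prop where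
  locallyFinite : ∀ᵐ ω ∂P, ∀ a b : ℝ, 0 < a → (T ω ∩ Icc a b).Finite
  measurable_count : ∀ a b : ℝ, 0 < a → Measurable (count T a b)
  law_count : ∀ a b : ℝ, 0 < a → a ≤ b →
    P.map (count T a b) = poissonMeasure (∫ s in a..b, lam s).toNNReal
  indep_increments : ∀ t : ℕ → ℝ, 0 < t 0 → Monotone t →
    iIndepFun (fun i => count T (t i) (t (i + 1))) P

/-- The σ-algebra of the events and directions observed during `(0, a]`. -/
def history (T : Ω → Set ℝ) (D : ℝ → Ω → ZMod 4) (a : ℝ) : MeasurableSpace Ω :=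
  (⨆ r ∈ Ioc (0 : ℝ) a, MeasurableSpace.comap (D r) inferInstance) ⊔
    (⨆ r ∈ Ioc (0 : ℝ) a, ⨆ s ∈ Icc r a, MeasurableSpace.comap (count T r s) inferInstance)

/-- The σ-algebra of the events that occur after time `a`. -/
def future (T : Ω → Set ℝ) (a : ℝ) : MeasurableSpace Ω :=
  ⨆ r ∈ Ici a, ⨆ s ∈ Ici r, MeasurableSpace.comap (count T r s) inferInstance

/-- The σ-algebra generated by a sequence of turns. -/
def turns (ξ : ℕ → Ω → ZMod 4) : MeasurableSpace Ω :=
  ⨆ n, MeasurableSpace.comap (ξ n) inferInstance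

/-- `D t` is the index `k` of the direction `d_k = (cos (k π / 2), sin (k π / 2))` of a particle
that, at each event of the Poisson process `T` with rate `lam`, turns to one of the two orthogonal
directions with probability `1/2` each. From every time `a > 0` on, the successive turns
`ξ 0, ξ 1, …` are independent and fair, and the three families "what happened up to time `a`",
"the event times after `a`" and "the turns after `a`" are independent.
The law of the initial direction is arbitrary. -/
structure IsDirectionProcess (P : Measure Ω) (lam : ℝ → ℝ) (T : Ω → Set ℝ)
    (D : ℝ → Ω → ZMod 4) : Prop where
  poisson : IsPoissonProcess P lam T
  measurable_direction : ∀ t : ℝ, 0 < t → Measurable (D t)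
  turn : ∀ a : ℝ, 0 < a → ∃ ξ : ℕ → Ω → ZMod 4,
    (∀ n, Measurable (ξ n)) ∧
    (∀ n, P {ω | ξ n ω = 1} = 1 / 2 ∧ P {ω | ξ n ω = -1} = 1 / 2) ∧
    iIndepFun ξ P ∧
    iIndep ![history T D a, future T a, turns ξ] P ∧
    ∀ᵐ ω ∂P, ∀ t : ℝ, a ≤ t → D t ω = D a ω + ∑ n ∈ Finset.range (count T a t ω), ξ n ω

/-- The unit vector `d_k = (cos (k π / 2), sin (k π / 2))`. -/
def direction (k : ZMod 4) : ℝ × ℝ :=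
  (Real.cos (k.val * Real.pi / 2), Real.sin (k.val * Real.pi / 2))

/-- The position `(X t, Y t)` of the particle that starts at the origin and moves with speed `c`
in the direction `D s` at time `s`. -/
def position (c : ℝ) (D : ℝ → Ω → ZMod 4) (t : ℝ) (ω : Ω) : ℝ × ℝ :=
  (c * ∫ s in (0 : ℝ)..t, (direction (D s ω)).1, c * ∫ s in (0 : ℝ)..t, (direction (D s ω)).2)

/-- `p x y t` is a density, with respect to the Lebesgue measure of the plane, of the absolutely
continuous component of the law of the position at time `t` (Lebesgue decomposition). -/
def IsACComponent (P : Measure Ω) (c : ℝ) (D : ℝ → Ω → ZMod 4) (p : ℝ → ℝ → ℝ → ℝ) : Prop :=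
  ∀ t : ℝ, 0 < t → (fun z : ℝ × ℝ => p z.1 z.2 t) =ᵐ[volume]
    fun z => ((P.map (position c D t)).rnDeriv volume z).toReal

/-- Partial derivative in `x`. -/
def dX (f : ℝ → ℝ → ℝ → ℝ) : ℝ → ℝ → ℝ → ℝ := fun x y t => deriv (fun x' => f x' y t) x

/-- Partial derivative in `y`. -/
def dY (f : ℝ → ℝ → ℝ → ℝ) : ℝ → ℝ → ℝ → ℝ := fun x y t => deriv (fun y' => f x y' t) y

/-- Partial derivative in `t`. -/
def dT (f : ℝ → ℝ → ℝ → ℝ) : ℝ → ℝ → ℝ → ℝ := fun x y t => deriv (fun t' => f x y t') t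

/-- The operator `∂²/∂t² + 2 lam ∂/∂t - c² (∂²/∂x² + ∂²/∂y²)`. -/
def telegraphOp (c : ℝ) (lam : ℝ → ℝ) (f : ℝ → ℝ → ℝ → ℝ) : ℝ → ℝ → ℝ → ℝ := fun x y t =>
  dT (dT f) x y t + 2 * lam t * dT f x y t - c ^ 2 * (dX (dX f) x y t + dY (dY f) x y t)

/-- The operator `∂²/∂t² + 2 lam ∂/∂t + lam² + lam'`. -/
def dampingOp (lam : ℝ → ℝ) (f : ℝ → ℝ → ℝ → ℝ) : ℝ → ℝ → ℝ → ℝ := fun x y t =>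
  dT (dT f) x y t + 2 * lam t * dT f x y t + (lam t ^ 2 + deriv lam t) * f x y t

end OrthogonalMotion

end

/-!
The theorem combines a weak form of the equation, valid for the whole law of the position, with the
fact that this law has no singular part away from the four lines `|x ± y| = c t`.

*Weak form.* For a test function `φ` let `m_k(t)` be the mean of `φ (X t, Y t)` on the event that
the direction at time `t` is `d_k`. In a short time interval after `t > 0` there is no event, one
event, or, with a probability of second order, more than one; as the past, the future events and
the turns are independent, this gives the forward equations
`m_k' = c ⟨∂_{d_k} φ⟩_k + λ (m_{k+1} / 2 + m_{k-1} / 2 - m_k)`, where `⟨ψ⟩_k` is the mean of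
`ψ (X t, Y t)` on the same event (`IsDirectionProcess.hasDerivAt_mean`). Nothing about the
behaviour at time `0` enters, so events may accumulate there. Eliminating the individual directions
turns this linear system into the fourth-order identity `IsDirectionProcess.weak_equation` for the
mean of `φ (X t, Y t)` alone.

*Absolute continuity.* In the coordinates `x + y` and `x - y` each velocity is `± c`, and every turn
reverses exactly one of the two. If neither coordinate is `± c t` at time `t`, each has been
reversed before `t`, at different events. The time of an isolated event has an absolutely continuous
law (`IsDirectionProcess.isACOn_eventTime`), so that the first reversal smooths out one coordinate
and the second one the other, conditionally on the first; what happens after an event is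
conditionally independent of the position, so that absolute continuity is not lost. Isolating the
two events by rational times, a countable union gives
`IsDirectionProcess.measure_position_eq_zero`.

*Conclusion.* On the part of `O` off the singular lines, integrals of `p` against test functions are
therefore means of the position. They can be differentiated in time under the integral and
integrated by parts in space, so the difference of the two sides of the equation is orthogonal to
all test functions and, being continuous, vanishes (`IsDirectionProcess.residual_eq_zero`). The
singular lines meet every horizontal line in finitely many points, and continuity extends the
equation to all of `O`.
-/

namespace OrthogonalMotion

open Filter Topology

/-! ### Integrals of right-continuous paths -/

section Sampling

/-- The smallest point of the grid of mesh `1 / (n + 1)` that is at least `s`. -/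
noncomputable def rightGrid (n : ℕ) (s : ℝ) : ℝ := (⌈((n : ℝ) + 1) * s⌉ : ℝ) / ((n : ℝ) + 1)

lemma le_rightGrid (n : ℕ) (s : ℝ) : s ≤ rightGrid n s := by
  unfold rightGrid
  rw [le_div_iff₀ (by positivity)]
  linarith [Int.le_ceil (((n : ℝ) + 1) * s)]

lemma rightGrid_le (n : ℕ) (s : ℝ) : rightGrid n s ≤ s + 1 / ((n : ℝ) + 1) := by
  unfold rightGrid
  have h : (0 : ℝ) < (n : ℝ) + 1 := by positivity
  rw [div_le_iff₀ h, add_mul s, one_div_mul_cancel h.ne']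
  linarith [Int.ceil_lt_add_one (((n : ℝ) + 1) * s)]

lemma tendsto_rightGrid (s : ℝ) : Tendsto (fun n => rightGrid n s) atTop (𝓝[≥] s) := by
  refine tendsto_nhdsWithin_iff.2 ⟨?_, Eventually.of_forall fun n => le_rightGrid n s⟩
  refine tendsto_of_tendsto_of_tendsto_of_le_of_le tendsto_const_nhds ?_
    (fun n => le_rightGrid n s) (fun n => rightGrid_le n s)
  simpa using tendsto_const_nhds.add (tendsto_one_div_add_atTop_nhds_zero_nat (𝕜 := ℝ))

lemma tendsto_min_rightGrid {s b : ℝ} (hs : s < b) :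
    Tendsto (fun n => min (rightGrid n s) b) atTop (𝓝[≥] s) := by
  refine (tendsto_rightGrid s).congr' ?_
  have h : ∀ᶠ n in atTop, rightGrid n s < b :=
    ((tendsto_rightGrid s).mono_right nhdsWithin_le_nhds).eventually (gt_mem_nhds hs)
  filter_upwards [h] with n hn using (min_eq_left hn.le).symm

lemma min_rightGrid_mem {a b s : ℝ} (n : ℕ) (hs : s ∈ Ioc a b) :
    min (rightGrid n s) b ∈ Ioc a b :=
  ⟨lt_min (hs.1.trans_le (le_rightGrid n s)) (hs.1.trans_le hs.2), min_le_right _ _⟩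

lemma measurable_comp_ceil (n : ℕ) : Measurable fun s : ℝ => ⌈((n : ℝ) + 1) * s⌉ :=
  Int.measurable_ceil.comp (measurable_const.mul measurable_id)

lemma measurable_comp_min_rightGrid (f : ℝ → ℝ) (b : ℝ) (n : ℕ) :
    Measurable fun s => f (min (rightGrid n s) b) :=
  (measurable_from_top (f := fun j : ℤ => f (min ((j : ℝ) / ((n : ℝ) + 1)) b))).comp
    (measurable_comp_ceil n)

lemma ae_Ioo_of_Ioc {a b : ℝ} {q : ℝ → Prop} (h : ∀ s ∈ Ioo a b, q s) :
    ∀ᵐ s ∂volume.restrict (Ioc a b), q s := by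
  rw [← Measure.restrict_congr_set (Ioo_ae_eq_Ioc (a := a) (b := b))]
  exact (ae_restrict_iff' measurableSet_Ioo).2 (Eventually.of_forall h)

variable {a b C : ℝ}

lemma integrableOn_of_rightContinuous {f : ℝ → ℝ} (hC : ∀ s, |f s| ≤ C)
    (hf : ∀ s ∈ Ioo a b, ContinuousWithinAt f (Ici s) s) : IntegrableOn f (Ioc a b) := by
  have hlim : ∀ᵐ s ∂volume.restrict (Ioc a b),
      Tendsto (fun n => f (min (rightGrid n s) b)) atTop (𝓝 (f s)) :=
    ae_Ioo_of_Ioc fun s hs => (hf s hs).tendsto.comp (tendsto_min_rightGrid hs.2)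
  have hm : AEStronglyMeasurable f (volume.restrict (Ioc a b)) :=
    aestronglyMeasurable_of_tendsto_ae atTop
      (fun n => (measurable_comp_min_rightGrid f b n).aestronglyMeasurable) hlim
  exact Integrable.of_bound hm C (Eventually.of_forall fun s => by simpa using hC s)

/-- The integral of a right-continuous function is the limit of its Riemann sums over the right
endpoints of a grid. -/
lemma tendsto_integral_sampling {f : ℝ → ℝ} (hC : ∀ s, |f s| ≤ C)
    (hf : ∀ s ∈ Ioo a b, ContinuousWithinAt f (Ici s) s) :
    Tendsto (fun n => ∫ s in Ioc a b, f (min (rightGrid n s) b)) atTop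
      (𝓝 (∫ s in Ioc a b, f s)) := by
  refine tendsto_integral_of_dominated_convergence (fun _ => C)
    (fun n => (measurable_comp_min_rightGrid f b n).aestronglyMeasurable) (by simp)
    (fun n => Eventually.of_forall fun s => by simpa using hC _) ?_
  exact ae_Ioo_of_Ioc fun s hs => (hf s hs).tendsto.comp (tendsto_min_rightGrid hs.2)

/-- The time integral of a bounded process with right-continuous paths is a function of the values
of the process. -/
lemma exists_measurable_eq_integral {Ω : Type*} [MeasurableSpace Ω] (hab : a ≤ b)
    {f : ℝ → Ω → ℝ} (hC : ∀ s ω, |f s ω| ≤ C) (hm : ∀ s ∈ Ioc a b, Measurable (f s)) :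
    ∃ Z : Ω → ℝ, Measurable Z ∧ ∀ ω,
      (∀ s ∈ Ioo a b, ContinuousWithinAt (fun s => f s ω) (Ici s) s) →
        ∫ s in a..b, f s ω = Z ω := by
  classical
  let G : ℕ → ℤ → Ω → ℝ := fun n j ω =>
    if a < min ((j : ℝ) / ((n : ℝ) + 1)) b then f (min ((j : ℝ) / ((n : ℝ) + 1)) b) ω else 0
  have hG : ∀ n j, Measurable (G n j) := by
    intro n j
    by_cases h : a < min ((j : ℝ) / ((n : ℝ) + 1)) b
    · simp only [G, if_pos h]
      exact hm _ ⟨h, min_le_right _ _⟩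
    · simp only [G, if_neg h]
      exact measurable_const
  let Zn : ℕ → Ω → ℝ := fun n ω => ∫ s in Ioc a b, G n ⌈((n : ℝ) + 1) * s⌉ ω
  have hZn : ∀ n, Measurable (Zn n) := by
    intro n
    have h1 : Measurable fun x : Ω × ℤ => G n x.2 x.1 :=
      measurable_from_prod_countable_left fun j => hG n j
    have h2 : Measurable fun x : Ω × ℝ => G n ⌈((n : ℝ) + 1) * x.2⌉ x.1 :=
      h1.comp (measurable_fst.prodMk ((measurable_comp_ceil n).comp measurable_snd))
    exact (StronglyMeasurable.integral_prod_right' (ν := volume.restrict (Ioc a b))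
      h2.stronglyMeasurable).measurable
  refine ⟨fun ω => limsup (fun n => Zn n ω) atTop, Measurable.limsup hZn, fun ω hω => ?_⟩
  have h := tendsto_integral_sampling (f := fun s => f s ω) (fun s => hC s ω) hω
  rw [intervalIntegral.integral_of_le hab, ← h.limsup_eq]
  congr 1
  ext n
  refine setIntegral_congr_fun measurableSet_Ioc fun s hs => ?_
  have := (min_rightGrid_mem n hs).1
  simp only [rightGrid] at this
  simp only [G, if_pos this, rightGrid]

end Sampling

/-! ### Directions -/

lemma zmod_four_cases (k : ZMod 4) : k = 0 ∨ k = 1 ∨ k = 2 ∨ k = 3 := by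
  revert k
  decide

lemma direction_zero : direction 0 = (1, 0) := by
  simp [direction]

lemma direction_one : direction 1 = (0, 1) := by
  have : (1 : ZMod 4).val = 1 := rfl
  simp [direction, this]

lemma direction_two : direction 2 = (-1, 0) := by
  have : (2 : ZMod 4).val = 2 := rfl
  simp [direction, this]

lemma direction_three : direction 3 = (0, -1) := by
  have : (3 : ZMod 4).val = 3 := rfl
  have h : (3 * Real.pi / 2) = Real.pi + Real.pi / 2 := by ring
  simp [direction, this, h, Real.cos_add, Real.sin_add]

lemma abs_direction_fst_le (k : ZMod 4) : |(direction k).1| ≤ 1 := Real.abs_cos_le_one _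

lemma abs_direction_snd_le (k : ZMod 4) : |(direction k).2| ≤ 1 := Real.abs_sin_le_one _

/-! ### Regular paths -/

/-- The properties shared by almost all paths: the events are locally finite in `(0, ∞)`, the
direction is constant between events, and it turns by a right angle when there is exactly one
event. -/
structure IsRegularPath (T : Set ℝ) (D : ℝ → ZMod 4) : Prop where
  finite : ∀ a b : ℝ, 0 < a → (T ∩ Icc a b).Finite
  stay : ∀ a b : ℝ, 0 < a → a ≤ b → T ∩ Ioc a b = ∅ → D b = D a
  turn : ∀ a b : ℝ, 0 < a → a ≤ b → (T ∩ Ioc a b).ncard = 1 → D b = D a + 1 ∨ D b = D a - 1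

lemma ncard_Ioc_add {T : Set ℝ} (hT : ∀ a b : ℝ, 0 < a → (T ∩ Icc a b).Finite) {a b c : ℝ}
    (ha : 0 < a) (hab : a ≤ b) (hbc : b ≤ c) :
    (T ∩ Ioc a c).ncard = (T ∩ Ioc a b).ncard + (T ∩ Ioc b c).ncard := by
  rw [← Ioc_union_Ioc_eq_Ioc hab hbc, inter_union_distrib_left]
  refine ncard_union_eq ?_
    ((hT a b ha).subset (inter_subset_inter_right _ Ioc_subset_Icc_self))
    ((hT b c (ha.trans_le hab)).subset (inter_subset_inter_right _ Ioc_subset_Icc_self))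
  exact Disjoint.mono inter_subset_right inter_subset_right
    (Set.disjoint_left.2 fun x hx hy => not_lt_of_ge hx.2 hy.1)

/-- There is no event in a right neighbourhood of a positive time. -/
lemma exists_no_event_right {T : Set ℝ} (hT : ∀ a b : ℝ, 0 < a → (T ∩ Icc a b).Finite) {s : ℝ}
    (hs : 0 < s) : ∃ δ > 0, T ∩ Ioc s (s + δ) = ∅ := by
  have hfin : (T ∩ Ioc s (s + 1)).Finite :=
    (hT s (s + 1) hs).subset (inter_subset_inter_right _ Ioc_subset_Icc_self)
  have hmem : (T ∩ Ioc s (s + 1))ᶜ ∈ 𝓝 s :=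
    hfin.isClosed.isOpen_compl.mem_nhds fun h => lt_irrefl _ h.2.1
  obtain ⟨ε, hε, hball⟩ := Metric.mem_nhds_iff.1 hmem
  refine ⟨min (ε / 2) 1, by positivity, eq_empty_of_forall_notMem fun x hx => ?_⟩
  have h1 : x ≤ s + ε / 2 := hx.2.2.trans (by gcongr; exact min_le_left _ _)
  have h2 : x ≤ s + 1 := hx.2.2.trans (by gcongr; exact min_le_right _ _)
  refine hball (a := x) ?_ ⟨hx.1, hx.2.1, h2⟩
  rw [Metric.mem_ball, Real.dist_eq, abs_of_pos (sub_pos.2 hx.2.1)]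
  linarith

lemma continuousWithinAt_of_eventually_const {β : Type*} [TopologicalSpace β] {f : ℝ → β}
    {s δ : ℝ} (hδ : 0 < δ) (h : ∀ x, s ≤ x → x ≤ s + δ → f x = f s) :
    ContinuousWithinAt f (Ici s) s := by
  refine (continuousWithinAt_const (b := f s)).congr_of_eventuallyEq ?_ rfl
  have : Iio (s + δ) ∈ 𝓝[≥] s := mem_nhdsWithin_of_mem_nhds (Iio_mem_nhds (by linarith))
  filter_upwards [this, self_mem_nhdsWithin] with x hx hx' using h x hx' (le_of_lt hx)

lemma IsRegularPath.rightContinuous {T : Set ℝ} {D : ℝ → ZMod 4} (h : IsRegularPath T D)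
    (w : ZMod 4 → ℝ) {s : ℝ} (hs : 0 < s) :
    ContinuousWithinAt (fun t => w (D t)) (Ici s) s := by
  obtain ⟨δ, hδ, hE⟩ := exists_no_event_right h.finite hs
  refine continuousWithinAt_of_eventually_const hδ fun x hx hx' => ?_
  rw [h.stay s x hs hx]
  exact subset_empty_iff.1 (hE ▸ inter_subset_inter_right _ (Ioc_subset_Ioc_right hx'))

lemma IsRegularPath.intervalIntegrable {T : Set ℝ} {D : ℝ → ZMod 4} (h : IsRegularPath T D)
    {w : ZMod 4 → ℝ} (hw : ∀ k, |w k| ≤ 1) {a b : ℝ} (ha : 0 ≤ a) (hab : a ≤ b) :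
    IntervalIntegrable (fun t => w (D t)) volume a b := by
  rw [intervalIntegrable_iff_integrableOn_Ioc_of_le hab]
  exact integrableOn_of_rightContinuous (C := 1) (fun s => hw _)
    fun s hs => h.rightContinuous w (ha.trans_lt hs.1)

/-- The displacement of the particle between the times `a` and `b`. -/
noncomputable def displacement (c : ℝ) (D : ℝ → ZMod 4) (a b : ℝ) : ℝ × ℝ :=
  (c * ∫ s in a..b, (direction (D s)).1, c * ∫ s in a..b, (direction (D s)).2)

lemma IsRegularPath.displacement_add {T : Set ℝ} {D : ℝ → ZMod 4} (h : IsRegularPath T D)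
    (c : ℝ) {a b d : ℝ} (ha : 0 ≤ a) (hab : a ≤ b) (hbd : b ≤ d) :
    displacement c D a d = displacement c D a b + displacement c D b d := by
  have h1 := intervalIntegral.integral_add_adjacent_intervals
    (h.intervalIntegrable abs_direction_fst_le ha hab)
    (h.intervalIntegrable abs_direction_fst_le (ha.trans hab) hbd)
  have h2 := intervalIntegral.integral_add_adjacent_intervals
    (h.intervalIntegrable abs_direction_snd_le ha hab)
    (h.intervalIntegrable abs_direction_snd_le (ha.trans hab) hbd)
  simp only [displacement, Prod.mk_add_mk, ← h1, ← h2, mul_add]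

/-- While the direction is constant the particle moves along a segment. -/
lemma displacement_const (c : ℝ) {D : ℝ → ZMod 4} {a b : ℝ} {k : ZMod 4} (hab : a ≤ b)
    (h : ∀ s ∈ Ioo a b, D s = k) : displacement c D a b = (c * (b - a)) • direction k := by
  have key : ∀ w : ZMod 4 → ℝ, ∫ s in a..b, w (D s) = (b - a) * w k := by
    intro w
    rw [intervalIntegral.integral_of_le hab, integral_Ioc_eq_integral_Ioo,
      setIntegral_congr_fun (g := fun _ => w k) measurableSet_Ioo fun s hs => by simp [h s hs]]
    simp [hab]
  simp only [displacement, key fun k => (direction k).1, key fun k => (direction k).2]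
  ext <;> simp <;> ring

lemma norm_displacement_le {c : ℝ} (hc : 0 < c) (D : ℝ → ZMod 4) {a b : ℝ} (hab : a ≤ b) :
    ‖displacement c D a b‖ ≤ c * (b - a) := by
  have key : ∀ w : ZMod 4 → ℝ, (∀ k, |w k| ≤ 1) → ‖c * ∫ s in a..b, w (D s)‖ ≤ c * (b - a) := by
    intro w hw
    rw [norm_mul, Real.norm_of_nonneg hc.le]
    gcongr
    have := intervalIntegral.norm_integral_le_of_norm_le_const (a := a) (b := b)
      (f := fun s => w (D s)) (C := 1) fun s _ => hw _
    rwa [one_mul, abs_of_nonneg (sub_nonneg.2 hab)] at this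
  exact norm_prod_le_iff.2 ⟨key _ abs_direction_fst_le, key _ abs_direction_snd_le⟩

section Filtration

variable {Ω : Type*} {T : Ω → Set ℝ} {D : ℝ → Ω → ZMod 4}

lemma measurable_direction_history {r a : ℝ} (hr : r ∈ Ioc 0 a) :
    Measurable[history T D a] (D r) :=
  Measurable.of_comap_le ((le_iSup₂ (f := fun r (_ : r ∈ Ioc 0 a) =>
    MeasurableSpace.comap (D r) inferInstance) r hr).trans le_sup_left)

lemma measurable_count_history {r s a : ℝ} (hr : r ∈ Ioc 0 a) (hs : s ∈ Icc r a) :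
    Measurable[history T D a] (count T r s) :=
  Measurable.of_comap_le (((le_iSup₂ (f := fun s (_ : s ∈ Icc r a) =>
    MeasurableSpace.comap (count T r s) inferInstance) s hs).trans
    (le_iSup₂ (f := fun r (_ : r ∈ Ioc 0 a) => ⨆ s ∈ Icc r a,
      MeasurableSpace.comap (count T r s) inferInstance) r hr)).trans le_sup_right)

lemma measurable_count_future {r s a : ℝ} (hr : a ≤ r) (hs : r ≤ s) :
    Measurable[future T a] (count T r s) :=
  Measurable.of_comap_le ((le_iSup₂ (f := fun s (_ : s ∈ Ici r) =>
    MeasurableSpace.comap (count T r s) inferInstance) s hs).trans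
    (le_iSup₂ (f := fun r (_ : r ∈ Ici a) => ⨆ s ∈ Ici r,
      MeasurableSpace.comap (count T r s) inferInstance) r hr))

lemma measurable_turns (ξ : ℕ → Ω → ZMod 4) (n : ℕ) : Measurable[turns ξ] (ξ n) :=
  Measurable.of_comap_le (le_iSup (fun n => MeasurableSpace.comap (ξ n) inferInstance) n)

lemma history_mono {a b : ℝ} (hab : a ≤ b) : history T D a ≤ history T D b := by
  refine sup_le_sup ?_ ?_
  · exact iSup₂_le fun r hr => le_iSup₂ (f := fun r (_ : r ∈ Ioc 0 b) =>
      MeasurableSpace.comap (D r) inferInstance) r ⟨hr.1, hr.2.trans hab⟩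
  · exact iSup₂_le fun r hr => iSup₂_le fun s hs =>
      (le_iSup₂ (f := fun s (_ : s ∈ Icc r b) =>
        MeasurableSpace.comap (count T r s) inferInstance) s ⟨hs.1, hs.2.trans hab⟩).trans
      (le_iSup₂ (f := fun r (_ : r ∈ Ioc 0 b) => ⨆ s ∈ Icc r b,
        MeasurableSpace.comap (count T r s) inferInstance) r ⟨hr.1, hr.2.trans hab⟩)

lemma position_eq_displacement (c t : ℝ) (ω : Ω) :
    position c D t ω = displacement c (fun s => D s ω) 0 t := rfl

end Filtration

section

variable {Ω : Type*} [MeasurableSpace Ω] {P : Measure Ω} {lam : ℝ → ℝ}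
  {T : Ω → Set ℝ} {D : ℝ → Ω → ZMod 4}

lemma ae_turn_eq [IsProbabilityMeasure P] {ξ : ℕ → Ω → ZMod 4} (hξm : ∀ n, Measurable (ξ n))
    (hξ : ∀ n, P {ω | ξ n ω = 1} = 1 / 2 ∧ P {ω | ξ n ω = -1} = 1 / 2) :
    ∀ᵐ ω ∂P, ∀ n, ξ n ω = 1 ∨ ξ n ω = -1 := by
  refine ae_all_iff.2 fun n => ?_
  have h1 : MeasurableSet {ω | ξ n ω = 1} := hξm n (measurableSet_singleton 1)
  have h2 : MeasurableSet {ω | ξ n ω = -1} := hξm n (measurableSet_singleton (-1))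
  have hd : Disjoint {ω | ξ n ω = 1} {ω | ξ n ω = -1} := by
    refine Set.disjoint_left.2 fun ω h h' => ?_
    have : (1 : ZMod 4) = -1 := Eq.trans (Eq.symm h) h'
    exact absurd this (by decide)
  have hP : P ({ω | ξ n ω = 1} ∪ {ω | ξ n ω = -1}) = 1 := by
    rw [measure_union hd h2, (hξ n).1, (hξ n).2, ENNReal.add_halves]
  exact (prob_compl_eq_zero_iff (h1.union h2)).2 hP

lemma IsDirectionProcess.ae_regular [IsProbabilityMeasure P]
    (hD : IsDirectionProcess P lam T D) :
    ∀ᵐ ω ∂P, IsRegularPath (T ω) fun t => D t ω := by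
  -- From the time `1 / (n + 1)` on, the path is determined by the turns `ξ n`.
  have hpos : ∀ n : ℕ, (0 : ℝ) < 1 / ((n : ℝ) + 1) := fun n => by positivity
  choose ξ hξm hξ _ _ hpath using fun n : ℕ => hD.turn _ (hpos n)
  filter_upwards [hD.poisson.locallyFinite, ae_all_iff.2 hpath,
    ae_all_iff.2 fun n => ae_turn_eq (hξm n) (hξ n)] with ω hfin hω hturn
  refine ⟨hfin, ?_, ?_⟩ <;> intro a b ha hab hcount <;>
    obtain ⟨n, hn⟩ := exists_nat_one_div_lt ha <;>
    have h1 := hω n a hn.le <;> have h2 := hω n b (hn.le.trans hab) <;>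
    have h3 := ncard_Ioc_add hfin (hpos n) hn.le hab
  · rw [hcount, ncard_empty, add_zero] at h3
    simp only [h1, h2, count, h3]
  · rw [hcount] at h3
    have h4 : D b ω = D a ω + ξ n (count T (1 / ((n : ℝ) + 1)) a ω) ω := by
      rw [h1, h2, count, count, h3, Finset.sum_range_succ, add_assoc]
    rcases hturn n (count T (1 / ((n : ℝ) + 1)) a ω) with h | h
    · left
      rw [h4, h]
    · right
      rw [h4, h, sub_eq_add_neg]

lemma IsDirectionProcess.history_le (hD : IsDirectionProcess P lam T D) (a : ℝ) :
    history T D a ≤ (inferInstance : MeasurableSpace Ω) := by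
  refine sup_le (iSup₂_le fun r hr => (hD.measurable_direction r hr.1).comap_le)
    (iSup₂_le fun r hr => iSup₂_le fun s _ => (hD.poisson.measurable_count r s hr.1).comap_le)

lemma IsDirectionProcess.future_le (hD : IsDirectionProcess P lam T D) {a : ℝ} (ha : 0 < a) :
    future T a ≤ (inferInstance : MeasurableSpace Ω) :=
  iSup₂_le fun r hr => iSup₂_le fun s _ =>
    (hD.poisson.measurable_count r s (ha.trans_le hr)).comap_le

lemma turns_le {ξ : ℕ → Ω → ZMod 4} (hξ : ∀ n, Measurable (ξ n)) :
    turns ξ ≤ (inferInstance : MeasurableSpace Ω) :=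
  iSup_le fun n => (hξ n).comap_le

/-- The position at time `t` is, up to a null set, a function of the history up to time `t`. -/
lemma IsDirectionProcess.exists_position [IsProbabilityMeasure P]
    (hD : IsDirectionProcess P lam T D) (c : ℝ) {t : ℝ} (ht : 0 ≤ t) :
    ∃ Z : Ω → ℝ × ℝ, Measurable[history T D t] Z ∧ position c D t =ᵐ[P] Z := by
  have key : ∀ w : ZMod 4 → ℝ, (∀ k, |w k| ≤ 1) → ∃ Z : Ω → ℝ,
      Measurable[history T D t] Z ∧ ∀ᵐ ω ∂P, ∫ s in (0 : ℝ)..t, w (D s ω) = Z ω := by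
    intro w hw
    obtain ⟨Z, hZ, h⟩ := @exists_measurable_eq_integral 0 t 1 Ω (history T D t) ht
      (fun s ω => w (D s ω)) (fun s ω => hw _)
      (fun s hs => measurable_from_top.comp (measurable_direction_history hs))
    refine ⟨Z, hZ, ?_⟩
    filter_upwards [hD.ae_regular] with ω hω
    exact h ω fun s hs => hω.rightContinuous w hs.1
  obtain ⟨Z₁, hm₁, h₁⟩ := key _ abs_direction_fst_le
  obtain ⟨Z₂, hm₂, h₂⟩ := key _ abs_direction_snd_le
  refine ⟨fun ω => (c * Z₁ ω, c * Z₂ ω), (hm₁.const_mul c).prodMk (hm₂.const_mul c), ?_⟩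
  filter_upwards [h₁, h₂] with ω h₁ h₂
  simp only [position, h₁, h₂]

lemma IsDirectionProcess.aemeasurable_position [IsProbabilityMeasure P]
    (hD : IsDirectionProcess P lam T D) (c : ℝ) {t : ℝ} (ht : 0 ≤ t) :
    AEMeasurable (position c D t) P := by
  obtain ⟨Z, hZ, h⟩ := hD.exists_position c ht
  exact ⟨Z, hZ.mono (hD.history_le t) le_rfl, h⟩

end

/-! ### Independence and Poisson estimates -/

/-- A random variable that is a.s. equal to an `m₁`-measurable one is uncorrelated with the events
of an independent σ-algebra `m₂`. -/
lemma setIntegral_of_indep {Ω : Type*} {m₁ m₂ m₀ : MeasurableSpace Ω} {P : Measure Ω}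
    [IsProbabilityMeasure P] (hm₁ : m₁ ≤ m₀) (hm₂ : m₂ ≤ m₀) (h : Indep m₁ m₂ P)
    {W W' : Ω → ℝ} (hW' : Measurable[m₁] W') (hWW' : W =ᵐ[P] W') {H : Set Ω}
    (hH : MeasurableSet[m₂] H) : ∫ ω in H, W ω ∂P = P.real H * ∫ ω, W ω ∂P := by
  have hH0 : MeasurableSet H := hm₂ _ hH
  have hW0 : Measurable W' := hW'.mono hm₁ le_rfl
  have hY : Measurable[m₂] (H.indicator fun _ => (1 : ℝ)) := by
    refine Measurable.indicator ?_ hH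
    exact measurable_const
  have hind : IndepFun W' (H.indicator fun _ => (1 : ℝ)) P :=
    (IndepFun_iff_Indep _ _ _).2 (indep_of_indep_of_le h hW'.comap_le hY.comap_le)
  have h1 := hind.integral_fun_mul_eq_mul_integral hW0.aestronglyMeasurable
    (measurable_const.indicator hH0).aestronglyMeasurable
  rw [integral_congr_ae (ae_restrict_of_ae hWW'), integral_congr_ae hWW', mul_comm,
    ← integral_indicator hH0]
  have h2 : ∫ ω, H.indicator (fun _ => (1 : ℝ)) ω ∂P = P.real H := by
    rw [integral_indicator hH0]
    simp
  rw [← h2, ← h1]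
  congr 1
  ext ω
  by_cases hω : ω ∈ H <;> simp [hω]

lemma IsPoissonProcess.measureReal_count {Ω : Type*} [MeasurableSpace Ω] {P : Measure Ω}
    {lam : ℝ → ℝ} {T : Ω → Set ℝ} (hT : IsPoissonProcess P lam T) {a b : ℝ}
    (ha : 0 < a) (hab : a ≤ b) (hΛ : 0 ≤ ∫ s in a..b, lam s) (n : ℕ) :
    P.real {ω | count T a b ω = n} =
      Real.exp (-∫ s in a..b, lam s) * (∫ s in a..b, lam s) ^ n / n.factorial := by
  have h : P.real {ω | count T a b ω = n} = (P.map (count T a b)).real {n} :=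
    (map_measureReal_apply (hT.measurable_count a b ha) (measurableSet_singleton n)).symm
  rw [h, hT.law_count a b ha hab, poissonMeasure_real_singleton, Real.coe_toNNReal _ hΛ]

section

variable {Ω : Type*} [MeasurableSpace Ω] {P : Measure Ω} [IsProbabilityMeasure P] {lam : ℝ → ℝ}
  {T : Ω → Set ℝ} {D : ℝ → Ω → ZMod 4}

/-- The history up to time `a` is independent of the events and turns after time `a`; the latter
determine the path after time `a`, up to the direction at time `a`. -/
lemma IsDirectionProcess.exists_turns (hD : IsDirectionProcess P lam T D) {a : ℝ} (ha : 0 < a) :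
    ∃ ξ : ℕ → Ω → ZMod 4, (∀ n, Measurable (ξ n)) ∧
      (∀ n, P.real {ω | ξ n ω = 1} = 1 / 2 ∧ P.real {ω | ξ n ω = -1} = 1 / 2) ∧
      (∀ᵐ ω ∂P, ∀ n, ξ n ω = 1 ∨ ξ n ω = -1) ∧
      Indep (history T D a) (future T a ⊔ turns ξ) P ∧ Indep (future T a) (turns ξ) P ∧
      ∀ᵐ ω ∂P, ∀ t : ℝ, a ≤ t →
        D t ω = D a ω + ∑ n ∈ Finset.range (count T a t ω), ξ n ω := by
  obtain ⟨ξ, hξm, hξ, -, hind, hpath⟩ := hD.turn a ha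
  have hle : ∀ i, ![history T D a, future T a, turns ξ] i ≤
      (inferInstance : MeasurableSpace Ω) := by
    intro i
    fin_cases i
    exacts [hD.history_le a, hD.future_le ha, turns_le hξm]
  refine ⟨ξ, hξm, fun n => ?_, ae_turn_eq hξm hξ, ?_, ?_, hpath⟩
  · simp [measureReal_def, (hξ n).1, (hξ n).2]
  · have := indep_iSup_of_disjoint hle hind (S := {0}) (T := {1, 2}) (by simp)
    simpa [iSup_or, iSup_sup_eq] using this
  · exact hind.indep (i := 1) (j := 2) (by decide)

lemma IsPoissonProcess.measureReal_count_pos_le (hT : IsPoissonProcess P lam T) {a b : ℝ}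
    (ha : 0 < a) (hab : a ≤ b) (hΛ : 0 ≤ ∫ s in a..b, lam s) :
    P.real {ω | 1 ≤ count T a b ω} ≤ ∫ s in a..b, lam s := by
  have hm := hT.measurable_count a b ha
  have h0 := hT.measureReal_count ha hab hΛ 0
  have hc : {ω | 1 ≤ count T a b ω} = {ω | count T a b ω = 0}ᶜ := by
    ext ω
    simp [Nat.one_le_iff_ne_zero]
  have m0 : MeasurableSet {ω | count T a b ω = 0} := hm (measurableSet_singleton 0)
  rw [hc, probReal_compl_eq_one_sub m0, h0]
  have := Real.add_one_le_exp (-∫ s in a..b, lam s)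
  simp
  linarith

lemma IsPoissonProcess.measureReal_two_le_count_le (hT : IsPoissonProcess P lam T) {a b : ℝ}
    (ha : 0 < a) (hab : a ≤ b) (hΛ : 0 ≤ ∫ s in a..b, lam s) :
    P.real {ω | 2 ≤ count T a b ω} ≤ (∫ s in a..b, lam s) ^ 2 := by
  have hm := hT.measurable_count a b ha
  have h0 := hT.measureReal_count ha hab hΛ 0
  have h1 := hT.measureReal_count ha hab hΛ 1
  have hc : {ω | 2 ≤ count T a b ω} =
      ({ω | count T a b ω = 0} ∪ {ω | count T a b ω = 1})ᶜ := by
    ext ω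
    simp only [mem_ofPred_eq, mem_compl_iff, mem_union]
    omega
  have m0 : MeasurableSet {ω | count T a b ω = 0} := hm (measurableSet_singleton 0)
  have m1 : MeasurableSet {ω | count T a b ω = 1} := hm (measurableSet_singleton 1)
  have hd : Disjoint {ω | count T a b ω = 0} {ω | count T a b ω = 1} := by
    refine Set.disjoint_left.2 fun ω h h' => ?_
    simp only [mem_ofPred_eq] at h h'
    omega
  rw [hc, probReal_compl_eq_one_sub (m0.union m1), measureReal_union hd m1, h0, h1]
  have := Real.add_one_le_exp (-∫ s in a..b, lam s)
  simp
  nlinarith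

end

/-! ### Test functions -/

/-- Smooth compactly supported functions on the plane. -/
structure IsTest (φ : ℝ × ℝ → ℝ) : Prop where
  contDiff : ContDiff ℝ (⊤ : ℕ∞) φ
  compact : HasCompactSupport φ

/-- The derivative of a function on the plane in the direction `v`. -/
noncomputable def dirDeriv (v : ℝ × ℝ) (φ : ℝ × ℝ → ℝ) : ℝ × ℝ → ℝ := fun z => fderiv ℝ φ z v

lemma IsTest.isTest_dirDeriv {φ : ℝ × ℝ → ℝ} (h : IsTest φ) (v : ℝ × ℝ) : IsTest (dirDeriv v φ) :=
  ⟨(h.contDiff.fderiv_right (m := (⊤ : ℕ∞)) (by norm_cast)).clm_apply contDiff_const,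
    h.compact.fderiv_apply ℝ v⟩

lemma IsTest.differentiable {φ : ℝ × ℝ → ℝ} (h : IsTest φ) : Differentiable ℝ φ :=
  h.contDiff.differentiable (by simp)

lemma exists_lipschitz_of_compactSupport {E F : Type*} [NormedAddCommGroup E] [NormedSpace ℝ E]
    [NormedAddCommGroup F] [NormedSpace ℝ F] {g : E → F} (hg : ContDiff ℝ 1 g)
    (hc : HasCompactSupport g) : ∃ C : ℝ, 0 ≤ C ∧ ∀ x y, ‖g y - g x‖ ≤ C * ‖y - x‖ := by
  obtain ⟨C, hC⟩ := (hc.fderiv ℝ).exists_bound_of_continuous (hg.continuous_fderiv (by simp))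
  exact ⟨C, (norm_nonneg _).trans (hC 0), fun x y =>
    Convex.norm_image_sub_le_of_norm_fderiv_le (𝕜 := ℝ) (s := univ) (x := x) (y := y)
      (fun x _ => hg.differentiable (by simp) x) (fun x _ => hC x) convex_univ trivial trivial⟩

/-- First-order Taylor bounds for a test function, with a single constant. -/
lemma IsTest.exists_bound {φ : ℝ × ℝ → ℝ} (h : IsTest φ) :
    ∃ C : ℝ, 0 ≤ C ∧ (∀ z, |φ z| ≤ C) ∧ (∀ z v, |dirDeriv v φ z| ≤ C * ‖v‖) ∧
      (∀ z v, |φ (z + v) - φ z| ≤ C * ‖v‖) ∧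
      (∀ z v, |φ (z + v) - φ z - dirDeriv v φ z| ≤ C * ‖v‖ ^ 2) := by
  have hd : ContDiff ℝ 1 (fderiv ℝ φ) := h.contDiff.fderiv_right (m := 1) (by norm_cast)
  obtain ⟨C₀, h₀⟩ := h.compact.exists_bound_of_continuous h.contDiff.continuous
  obtain ⟨C₁, h₁⟩ := (h.compact.fderiv ℝ).exists_bound_of_continuous hd.continuous
  obtain ⟨L, hL, hφ⟩ := exists_lipschitz_of_compactSupport
    (h.contDiff.of_le (m := 1) (by norm_cast)) h.compact
  obtain ⟨C₂, hC₂, hlip⟩ := exists_lipschitz_of_compactSupport hd (h.compact.fderiv ℝ)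
  have hC₀ : 0 ≤ C₀ := (norm_nonneg _).trans (h₀ 0)
  have hC₁ : 0 ≤ C₁ := (norm_nonneg _).trans (h₁ 0)
  have e₁ : ∀ z v, |dirDeriv v φ z| ≤ C₁ * ‖v‖ := fun z v =>
    ((fderiv ℝ φ z).le_opNorm v).trans (mul_le_mul_of_nonneg_right (h₁ z) (norm_nonneg v))
  have e₂ : ∀ z v, |φ (z + v) - φ z| ≤ L * ‖v‖ := by
    intro z v
    have := hφ z (z + v)
    rwa [add_sub_cancel_left] at this
  have e₃ : ∀ z v, |φ (z + v) - φ z - dirDeriv v φ z| ≤ C₂ * ‖v‖ ^ 2 := by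
    intro z v
    have hball : ∀ x ∈ Metric.closedBall z ‖v‖, ‖fderiv ℝ φ x - fderiv ℝ φ z‖ ≤ C₂ * ‖v‖ :=
      fun x hx => (hlip z x).trans
        (mul_le_mul_of_nonneg_left (by simpa [dist_eq_norm] using hx) hC₂)
    have := Convex.norm_image_sub_le_of_norm_fderiv_le' (𝕜 := ℝ) (f := φ)
      (s := Metric.closedBall z ‖v‖) (x := z) (y := z + v) (fun x _ => h.differentiable x) hball
      (convex_closedBall _ _) (by simp) (by simp)
    rwa [add_sub_cancel_left, mul_assoc, ← pow_two] at this
  have l₁ : C₁ ≤ C₀ + C₁ + L + C₂ := by linarith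
  have l₂ : C₂ ≤ C₀ + C₁ + L + C₂ := by linarith
  have l₃ : L ≤ C₀ + C₁ + L + C₂ := by linarith
  exact ⟨C₀ + C₁ + L + C₂, by positivity, fun z => (h₀ z).trans (by linarith),
    fun z v => (e₁ z v).trans (mul_le_mul_of_nonneg_right l₁ (norm_nonneg v)),
    fun z v => (e₂ z v).trans (mul_le_mul_of_nonneg_right l₃ (norm_nonneg v)),
    fun z v => (e₃ z v).trans (mul_le_mul_of_nonneg_right l₂ (by positivity))⟩

/-! ### The weak forward equations -/

section

variable {Ω : Type*} [MeasurableSpace Ω]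

open Classical in
/-- The value of the test function `φ` at the position at time `t`, on the event that the direction
at that time is `k`. -/
noncomputable def observable (c : ℝ) (D : ℝ → Ω → ZMod 4) (k : ZMod 4) (φ : ℝ × ℝ → ℝ) (t : ℝ)
    (ω : Ω) : ℝ :=
  if D t ω = k then φ (position c D t ω) else 0

/-- The expectation of `φ (X t, Y t)` on the event that the direction at time `t` is `k`. -/
noncomputable def mean (P : Measure Ω) (c : ℝ) (D : ℝ → Ω → ZMod 4) (k : ZMod 4)
    (φ : ℝ × ℝ → ℝ) (t : ℝ) : ℝ :=
  ∫ ω, observable c D k φ t ω ∂P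

lemma abs_observable_le {Ω : Type*} {c : ℝ} {D : ℝ → Ω → ZMod 4} {k : ZMod 4} {φ : ℝ × ℝ → ℝ}
    {C : ℝ} (hC : ∀ z, |φ z| ≤ C) (t : ℝ) (ω : Ω) : |observable c D k φ t ω| ≤ C := by
  unfold observable
  split_ifs
  · exact hC _
  · simpa using (abs_nonneg _).trans (hC 0)

variable {P : Measure Ω} [IsProbabilityMeasure P] {lam : ℝ → ℝ}
  {T : Ω → Set ℝ} {D : ℝ → Ω → ZMod 4}

lemma IsDirectionProcess.exists_observable (hD : IsDirectionProcess P lam T D) (c : ℝ)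
    (k : ZMod 4) {φ : ℝ × ℝ → ℝ} (hφ : Measurable φ) {t : ℝ} (ht : 0 < t) :
    ∃ W : Ω → ℝ, Measurable[history T D t] W ∧ observable c D k φ t =ᵐ[P] W := by
  classical
  obtain ⟨Z, hZ, h⟩ := hD.exists_position c ht.le
  have hmD : Measurable[history T D t] (D t) := measurable_direction_history ⟨ht, le_rfl⟩
  refine ⟨fun ω => if D t ω = k then φ (Z ω) else 0,
    ?_, ?_⟩
  · refine Measurable.ite (hmD (measurableSet_singleton k)) (hφ.comp hZ) ?_
    exact measurable_const
  filter_upwards [h] with ω hω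
  simp only [observable, hω]

lemma IsDirectionProcess.integrable_observable (hD : IsDirectionProcess P lam T D) (c : ℝ)
    (k : ZMod 4) {φ : ℝ × ℝ → ℝ} (hφ : Measurable φ) {C : ℝ} (hC : ∀ z, |φ z| ≤ C) {t : ℝ}
    (ht : 0 < t) : Integrable (observable c D k φ t) P := by
  obtain ⟨W, hW, h⟩ := hD.exists_observable c k hφ ht
  exact Integrable.of_bound ⟨W, (hW.mono (hD.history_le t) le_rfl).stronglyMeasurable, h⟩ C
    (Eventually.of_forall fun ω => abs_observable_le hC t ω)

lemma abs_mean_le {c : ℝ} {k : ZMod 4} {φ : ℝ × ℝ → ℝ} {C : ℝ} (hC : ∀ z, |φ z| ≤ C) (t : ℝ) :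
    |mean P c D k φ t| ≤ C := by
  have := norm_integral_le_of_norm_le_const (μ := P) (f := observable c D k φ t) (C := C)
    (Eventually.of_forall fun ω => abs_observable_le hC t ω)
  simpa [mean] using this

end

lemma norm_direction_le (k : ZMod 4) : ‖direction k‖ ≤ 1 :=
  norm_prod_le_iff.2 ⟨abs_direction_fst_le k, abs_direction_snd_le k⟩

lemma dirDeriv_smul (a : ℝ) (v : ℝ × ℝ) (φ : ℝ × ℝ → ℝ) (z : ℝ × ℝ) :
    dirDeriv (a • v) φ z = a * dirDeriv v φ z := by
  simp [dirDeriv]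

section

variable {Ω : Type*} [MeasurableSpace Ω] {P : Measure Ω} [IsProbabilityMeasure P] {lam : ℝ → ℝ}
  {T : Ω → Set ℝ} {D : ℝ → Ω → ZMod 4}

/-- The part of the increment of `observable` on `[t, t + h]` that is due to a single turn. -/
noncomputable def jumpTerm (c : ℝ) (T : Ω → Set ℝ) (D : ℝ → Ω → ZMod 4) (ξ : Ω → ZMod 4)
    (k : ZMod 4) (φ : ℝ × ℝ → ℝ) (t h : ℝ) (ω : Ω) : ℝ :=
  {ω | count T t (t + h) ω = 1 ∧ ξ ω = 1}.indicator (observable c D (k - 1) φ t) ω +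
    {ω | count T t (t + h) ω = 1 ∧ ξ ω = -1}.indicator (observable c D (k + 1) φ t) ω -
    {ω | count T t (t + h) ω = 1}.indicator (observable c D k φ t) ω

/-- Pathwise expansion over a short time interval, according to whether there is no event, one
event, or more than one event in it. -/
lemma abs_observable_increment_le {Ω : Type*} {T : Ω → Set ℝ} {D : ℝ → Ω → ZMod 4} {c : ℝ}
    (hc : 0 < c) {φ : ℝ × ℝ → ℝ} {C : ℝ} (hC : 0 ≤ C)
    (h₀ : ∀ z, |φ z| ≤ C) (h₁ : ∀ z v, |dirDeriv v φ z| ≤ C * ‖v‖)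
    (h₂ : ∀ z v, |φ (z + v) - φ z| ≤ C * ‖v‖)
    (h₃ : ∀ z v, |φ (z + v) - φ z - dirDeriv v φ z| ≤ C * ‖v‖ ^ 2)
    (k : ZMod 4) {t h : ℝ} (ht : 0 < t) (hh : 0 ≤ h) {ω : Ω} {ξ : Ω → ZMod 4}
    (hreg : IsRegularPath (T ω) fun s => D s ω) (hξ : ξ ω = 1 ∨ ξ ω = -1)
    (hone : count T t (t + h) ω = 1 → D (t + h) ω = D t ω + ξ ω) :
    |observable c D k φ (t + h) ω - observable c D k φ t ω -
        h * c * observable c D k (dirDeriv (direction k) φ) t ω - jumpTerm c T D ξ k φ t h ω| ≤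
      C * (2 + 2 * c + c ^ 2) * (h ^ 2 + h * {ω | 1 ≤ count T t (t + h) ω}.indicator 1 ω +
        {ω | 2 ≤ count T t (t + h) ω}.indicator 1 ω) := by
  have hth : t ≤ t + h := by linarith
  set v := displacement c (fun s => D s ω) t (t + h) with hv
  have hpos : position c D (t + h) ω = position c D t ω + v :=
    hreg.displacement_add c le_rfl ht.le hth
  have hvn : ‖v‖ ≤ c * h := by
    have := norm_displacement_le hc (fun s => D s ω) hth
    rwa [add_sub_cancel_left] at this
  have hY : |h * c * observable c D k (dirDeriv (direction k) φ) t ω| ≤ C * (c * h) := by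
    have hb : |observable c D k (dirDeriv (direction k) φ) t ω| ≤ C :=
      abs_observable_le (fun z => (h₁ z _).trans
        (mul_le_of_le_one_right hC (norm_direction_le k))) t ω
    rw [abs_mul, abs_of_nonneg (by positivity : 0 ≤ h * c)]
    calc h * c * |observable c D k (dirDeriv (direction k) φ) t ω| ≤ h * c * C := by gcongr
      _ = C * (c * h) := by ring
  have hCc : 0 ≤ C * c := by positivity
  rcases Nat.lt_trichotomy (count T t (t + h) ω) 1 with hN | hN | hN
  · have hN0 : count T t (t + h) ω = 0 := by omega
    have hE : T ω ∩ Ioc t (t + h) = ∅ :=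
      ((ncard_eq_zero ((hreg.finite t (t + h) ht).subset
        (inter_subset_inter_right _ Ioc_subset_Icc_self))).1 hN0)
    have hD : ∀ s ∈ Icc t (t + h), D s ω = D t ω := fun s hs =>
      hreg.stay t s ht hs.1 (subset_empty_iff.1
        (hE ▸ inter_subset_inter_right _ (Ioc_subset_Ioc_right hs.2)))
    have hvd : v = (c * h) • direction (D t ω) := by
      rw [hv, displacement_const c hth (k := D t ω) fun s hs => hD s ⟨hs.1.le, hs.2.le⟩,
        add_sub_cancel_left]
    have hD' := hD (t + h) ⟨hth, le_rfl⟩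
    have hj : jumpTerm c T D ξ k φ t h ω = 0 := by simp [jumpTerm, hN0]
    have hr : h ^ 2 + h * {ω | 1 ≤ count T t (t + h) ω}.indicator 1 ω +
        {ω | 2 ≤ count T t (t + h) ω}.indicator 1 ω = h ^ 2 := by
      simp [hN0]
    rw [hj, hr, sub_zero]
    by_cases hk : D t ω = k
    · simp only [observable, hD', hk, if_true, hpos]
      have := h₃ (position c D t ω) v
      rw [hvd, hk, dirDeriv_smul, ← hk, ← hvd, hk, mul_comm c h] at this
      refine this.trans ?_
      have : ‖v‖ ^ 2 ≤ (c * h) ^ 2 := by gcongr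
      nlinarith [mul_nonneg hC (sq_nonneg h), mul_nonneg hCc (sq_nonneg h)]
    · simp only [observable, hD', hk, if_false, mul_zero, sub_zero, abs_zero]
      positivity
  · have hr : h ^ 2 + h * {ω | 1 ≤ count T t (t + h) ω}.indicator 1 ω +
        {ω | 2 ≤ count T t (t + h) ω}.indicator 1 ω = h ^ 2 + h := by
      simp [hN]
    have hD' := hone hN
    have hmove : ∀ j : ZMod 4, (D (t + h) ω = k ↔ D t ω = j) →
        |observable c D k φ (t + h) ω - observable c D j φ t ω| ≤ C * (c * h) := by
      intro j hj
      simp only [observable, hj]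
      split_ifs
      · rw [hpos]
        exact (h₂ _ _).trans (by gcongr)
      · simp only [sub_self, abs_zero]
        positivity
    have hkey : ∃ j : ZMod 4, (D (t + h) ω = k ↔ D t ω = j) ∧
        jumpTerm c T D ξ k φ t h ω = observable c D j φ t ω - observable c D k φ t ω := by
      rcases hξ with hξ | hξ
      · refine ⟨k - 1, by rw [hD', hξ, eq_sub_iff_add_eq], ?_⟩
        have : (1 : ZMod 4) ≠ -1 := by decide
        simp [jumpTerm, hN, hξ, this]
      · refine ⟨k + 1, by rw [hD', hξ, ← sub_eq_add_neg, sub_eq_iff_eq_add], ?_⟩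
        have : (-1 : ZMod 4) ≠ 1 := by decide
        simp [jumpTerm, hN, hξ, this]
    obtain ⟨j, hj, hjump⟩ := hkey
    rw [hr, hjump]
    have h4 := abs_le.1 (hmove j hj)
    have h5 := abs_le.1 hY
    have h6 : 0 ≤ C * (c * h) := by positivity
    have h7 : 0 ≤ C * h := by positivity
    have h8 : 0 ≤ C * (2 + 2 * c + c ^ 2) * h ^ 2 := by positivity
    have h9 : 0 ≤ C * c ^ 2 * h := by positivity
    rw [abs_le]
    constructor <;> nlinarith
  · have hr : h ^ 2 + h * {ω | 1 ≤ count T t (t + h) ω}.indicator 1 ω +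
        {ω | 2 ≤ count T t (t + h) ω}.indicator 1 ω = h ^ 2 + h + 1 := by
      have : 2 ≤ count T t (t + h) ω := hN
      simp [hN.le, this]
    have hj : jumpTerm c T D ξ k φ t h ω = 0 := by simp [jumpTerm, hN.ne']
    rw [hr, hj]
    have h4 := abs_le.1 (abs_observable_le (c := c) (D := D) (k := k) h₀ (t + h) ω)
    have h5 := abs_le.1 (abs_observable_le (c := c) (D := D) (k := k) h₀ t ω)
    have h6 := abs_le.1 hY
    have h7 : 0 ≤ C * h := by positivity
    have h8 : 0 ≤ C * (2 + 2 * c + c ^ 2) * h ^ 2 := by positivity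
    have h9 : 0 ≤ C * c ^ 2 * h := by positivity
    have h10 : 0 ≤ C * c ^ 2 := by positivity
    have h11 : 0 ≤ C * (c * h) := by positivity
    rw [abs_le]
    constructor <;> nlinarith

lemma IsDirectionProcess.integral_jumpTerm (hD : IsDirectionProcess P lam T D) (c : ℝ)
    {φ : ℝ × ℝ → ℝ} (hφ : Measurable φ) {C : ℝ} (hC : ∀ z, |φ z| ≤ C) (k : ZMod 4) {t h : ℝ}
    (ht : 0 < t) (hh : 0 ≤ h) {ξ : ℕ → Ω → ZMod 4} (hξm : ∀ n, Measurable (ξ n))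
    (hξ : ∀ n, P.real {ω | ξ n ω = 1} = 1 / 2 ∧ P.real {ω | ξ n ω = -1} = 1 / 2)
    (hind : Indep (history T D t) (future T t ⊔ turns ξ) P)
    (hind' : Indep (future T t) (turns ξ) P) :
    Integrable (jumpTerm c T D (ξ 0) k φ t h) P ∧
      ∫ ω, jumpTerm c T D (ξ 0) k φ t h ω ∂P = P.real {ω | count T t (t + h) ω = 1} *
        (mean P c D (k + 1) φ t / 2 + mean P c D (k - 1) φ t / 2 - mean P c D k φ t) := by
  have hth : t ≤ t + h := by linarith
  have hNf : MeasurableSet[future T t] {ω | count T t (t + h) ω = 1} :=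
    (measurable_count_future (T := T) le_rfl hth) (measurableSet_singleton 1)
  have hξt : ∀ e : ZMod 4, MeasurableSet[turns ξ] {ω | ξ 0 ω = e} := fun e =>
    (measurable_turns ξ 0) (measurableSet_singleton e)
  have hsub : ∀ e : ZMod 4, MeasurableSet[future T t ⊔ turns ξ]
      {ω | count T t (t + h) ω = 1 ∧ ξ 0 ω = e} := fun e => by
    refine MeasurableSet.inter ?_ ?_
    · exact (le_sup_left : future T t ≤ _) _ hNf
    · exact (le_sup_right : turns ξ ≤ _) _ (hξt e)
  have hle : future T t ⊔ turns ξ ≤ (inferInstance : MeasurableSpace Ω) :=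
    sup_le (hD.future_le ht) (turns_le hξm)
  have hprob : ∀ e : ZMod 4, P.real {ω | count T t (t + h) ω = 1 ∧ ξ 0 ω = e} =
      P.real {ω | count T t (t + h) ω = 1} * P.real {ω | ξ 0 ω = e} := by
    intro e
    have := (Indep_iff _ _ _).1 hind' _ _ hNf (hξt e)
    simp only [measureReal_def, ← ENNReal.toReal_mul, ← this]
    rfl
  have hset : ∀ (j : ZMod 4) {H : Set Ω}, MeasurableSet[future T t ⊔ turns ξ] H →
      Integrable (H.indicator (observable c D j φ t)) P ∧
        ∫ ω, H.indicator (observable c D j φ t) ω ∂P = P.real H * mean P c D j φ t := by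
    intro j H hH
    obtain ⟨W, hW, hWW⟩ := hD.exists_observable c j hφ ht
    rw [integral_indicator (hle _ hH)]
    exact ⟨(hD.integrable_observable c j hφ hC ht).indicator (hle _ hH),
      setIntegral_of_indep (hD.history_le t) hle hind hW hWW hH⟩
  obtain ⟨i₁, e₁⟩ := hset (k - 1) (hsub 1)
  obtain ⟨i₂, e₂⟩ := hset (k + 1) (hsub (-1))
  obtain ⟨i₃, e₃⟩ := hset k ((le_sup_left : future T t ≤ _) _ hNf)
  refine ⟨(i₁.add i₂).sub i₃, ?_⟩
  have : ∫ ω, jumpTerm c T D (ξ 0) k φ t h ω ∂P = _ := integral_sub (i₁.add i₂) i₃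
  rw [this, integral_add i₁ i₂, e₁, e₂, e₃, hprob, hprob, (hξ 0).1, (hξ 0).2]
  ring

/-- The generator of the process, on the scale of a short time interval. -/
lemma IsDirectionProcess.abs_mean_increment_le (hD : IsDirectionProcess P lam T D) {c : ℝ}
    (hc : 0 < c) {φ : ℝ × ℝ → ℝ} (hφ : IsTest φ) (k : ZMod 4) :
    ∃ K : ℝ, 0 ≤ K ∧ ∀ t h : ℝ, 0 < t → 0 ≤ h → 0 ≤ ∫ s in t..t + h, lam s →
      |mean P c D k φ (t + h) - mean P c D k φ t -
          h * c * mean P c D k (dirDeriv (direction k) φ) t - (∫ s in t..t + h, lam s) *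
          (mean P c D (k + 1) φ t / 2 + mean P c D (k - 1) φ t / 2 - mean P c D k φ t)| ≤
        K * (h ^ 2 + h * (∫ s in t..t + h, lam s) + (∫ s in t..t + h, lam s) ^ 2) := by
  obtain ⟨C, hC, h₀, h₁, h₂, h₃⟩ := hφ.exists_bound
  have hφm : Measurable φ := hφ.contDiff.continuous.measurable
  have hdm : Measurable (dirDeriv (direction k) φ) :=
    (hφ.isTest_dirDeriv _).contDiff.continuous.measurable
  have hdC : ∀ z, |dirDeriv (direction k) φ z| ≤ C := fun z =>
    (h₁ z _).trans (mul_le_of_le_one_right hC (norm_direction_le k))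
  refine ⟨C * (2 + 2 * c + c ^ 2) + 2 * C, by positivity, fun t h ht hh hΛ => ?_⟩
  set Λ := ∫ s in t..t + h, lam s with hΛdef
  have hth : t ≤ t + h := by linarith
  obtain ⟨ξ, hξm, hξ, hξae, hind, hind', hpath⟩ := hD.exists_turns ht
  obtain ⟨ij, ej⟩ := hD.integral_jumpTerm c hφm h₀ k ht hh hξm hξ hind hind'
  have i₁ := hD.integrable_observable c k hφm h₀ (t := t + h) (by linarith)
  have i₂ := hD.integrable_observable c k hφm h₀ ht
  have i₃ := (hD.integrable_observable c k hdm hdC ht).const_mul (h * c)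
  have hm := hD.poisson.measurable_count t (t + h) ht
  have m₁ : MeasurableSet {ω | 1 ≤ count T t (t + h) ω} := hm measurableSet_Ici
  have m₂ : MeasurableSet {ω | 2 ≤ count T t (t + h) ω} := hm measurableSet_Ici
  have j₁ : Integrable ({ω | 1 ≤ count T t (t + h) ω}.indicator (1 : Ω → ℝ)) P :=
    (integrable_const (1 : ℝ)).indicator m₁
  have j₂ : Integrable ({ω | 2 ≤ count T t (t + h) ω}.indicator (1 : Ω → ℝ)) P :=
    (integrable_const (1 : ℝ)).indicator m₂
  have j₄ : Integrable (fun ω => h ^ 2 +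
      h * {ω | 1 ≤ count T t (t + h) ω}.indicator (1 : Ω → ℝ) ω) P :=
    (integrable_const (h ^ 2)).add (j₁.const_mul h)
  have j₃ : Integrable (fun ω => h ^ 2 +
      h * {ω | 1 ≤ count T t (t + h) ω}.indicator (1 : Ω → ℝ) ω +
      {ω | 2 ≤ count T t (t + h) ω}.indicator (1 : Ω → ℝ) ω) P := j₄.add j₂
  have i₄ : Integrable (fun ω => observable c D k φ (t + h) ω - observable c D k φ t ω) P :=
    i₁.sub i₂
  have i₅ : Integrable (fun ω => observable c D k φ (t + h) ω - observable c D k φ t ω -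
      h * c * observable c D k (dirDeriv (direction k) φ) t ω) P := i₄.sub i₃
  have hE : |∫ ω, (observable c D k φ (t + h) ω - observable c D k φ t ω -
        h * c * observable c D k (dirDeriv (direction k) φ) t ω -
        jumpTerm c T D (ξ 0) k φ t h ω) ∂P| ≤
      ∫ ω, C * (2 + 2 * c + c ^ 2) * (h ^ 2 +
        h * {ω | 1 ≤ count T t (t + h) ω}.indicator (1 : Ω → ℝ) ω +
        {ω | 2 ≤ count T t (t + h) ω}.indicator (1 : Ω → ℝ) ω) ∂P := by
    rw [← Real.norm_eq_abs]
    refine norm_integral_le_of_norm_le (j₃.const_mul _) ?_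
    filter_upwards [hD.ae_regular, hξae, hpath] with ω hreg hξω hω
    refine abs_observable_increment_le hc hC h₀ h₁ h₂ h₃ k ht hh hreg (hξω 0) fun hN => ?_
    rw [hω (t + h) hth, hN]
    simp
  rw [integral_sub i₅ ij, integral_sub i₄ i₃, integral_sub i₁ i₂,
    integral_const_mul, ej, integral_const_mul, integral_add j₄ j₂,
    integral_add (integrable_const _) (j₁.const_mul h), integral_const_mul,
    integral_indicator_one m₁, integral_indicator_one m₂] at hE
  have b₁ := hD.poisson.measureReal_count_pos_le ht hth hΛ
  have b₂ := hD.poisson.measureReal_two_le_count_le ht hth hΛ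
  have hp := hD.poisson.measureReal_count ht hth hΛ 1
  rw [← hΛdef] at b₁ b₂ hp
  -- The probability of exactly one event differs from `Λ` by at most `Λ ^ 2`.
  have hp' : |P.real {ω | count T t (t + h) ω = 1} - Λ| ≤ Λ ^ 2 := by
    rw [hp, Nat.factorial_one, pow_one, Nat.cast_one, div_one, abs_le]
    have l₁ := Real.add_one_le_exp (-Λ)
    have l₂ : Real.exp (-Λ) ≤ 1 := Real.exp_le_one_iff.2 (by linarith)
    constructor <;> nlinarith
  have hB : |mean P c D (k + 1) φ t / 2 + mean P c D (k - 1) φ t / 2 - mean P c D k φ t| ≤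
      2 * C := by
    have a₁ := abs_le.1 (abs_mean_le (P := P) (c := c) (D := D) (k := k + 1) h₀ t)
    have a₂ := abs_le.1 (abs_mean_le (P := P) (c := c) (D := D) (k := k - 1) h₀ t)
    have a₃ := abs_le.1 (abs_mean_le (P := P) (c := c) (D := D) (k := k) h₀ t)
    rw [abs_le]
    constructor <;> linarith [a₁.1, a₁.2, a₂.1, a₂.2, a₃.1, a₃.2]
  change |mean P c D k φ (t + h) - mean P c D k φ t -
    h * c * mean P c D k (dirDeriv (direction k) φ) t - _| ≤ _ at hE
  simp only [integral_const, probReal_univ, one_smul] at hE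
  set B := mean P c D (k + 1) φ t / 2 + mean P c D (k - 1) φ t / 2 - mean P c D k φ t
  set p := P.real {ω | count T t (t + h) ω = 1}
  have hpB : |(p - Λ) * B| ≤ Λ ^ 2 * (2 * C) := by
    rw [abs_mul]
    exact mul_le_mul hp' hB (abs_nonneg _) (sq_nonneg _)
  have hE' : |mean P c D k φ (t + h) - mean P c D k φ t -
      h * c * mean P c D k (dirDeriv (direction k) φ) t - p * B| ≤
      C * (2 + 2 * c + c ^ 2) * (h ^ 2 + h * Λ + Λ ^ 2) := by
    refine hE.trans ?_
    gcongr
  have hrem : 0 ≤ 2 * C * (h ^ 2 + h * Λ) := by positivity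
  have := abs_le.1 hpB
  have := abs_le.1 hE'
  rw [abs_le]
  constructor <;> nlinarith

end

/-! ### From increments to derivatives -/

section

variable {lam f A B : ℝ → ℝ} {K : ℝ}

lemma intervalIntegrable_of_pos (hlam : ContinuousOn lam (Ioi 0)) {a b : ℝ} (ha : 0 < a)
    (hb : 0 < b) : IntervalIntegrable lam volume a b :=
  (hlam.mono fun _ hx => (lt_min ha hb).trans_le hx.1).intervalIntegrable

lemma hasDerivAt_integral_of_pos (hlam : ContinuousOn lam (Ioi 0)) {t : ℝ} (ht : 0 < t) :
    HasDerivAt (fun s => ∫ u in (1 : ℝ)..s, lam u) (lam t) t :=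
  intervalIntegral.integral_hasDerivAt_right (intervalIntegrable_of_pos hlam one_pos ht)
    (hlam.stronglyMeasurableAtFilter isOpen_Ioi t ht) (hlam.continuousAt (Ioi_mem_nhds ht))

lemma integral_eq_sub_of_pos (hlam : ContinuousOn lam (Ioi 0)) {s t : ℝ} (hs : 0 < s)
    (ht : 0 < t) :
    ∫ u in s..t, lam u = (∫ u in (1 : ℝ)..t, lam u) - ∫ u in (1 : ℝ)..s, lam u :=
  (intervalIntegral.integral_interval_sub_left (intervalIntegrable_of_pos hlam one_pos ht)
    (intervalIntegrable_of_pos hlam one_pos hs)).symm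

lemma integral_nonneg_of_pos (hlam_nonneg : ∀ t, 0 < t → 0 ≤ lam t) {s t : ℝ} (hs : 0 < s)
    (hst : s ≤ t) : 0 ≤ ∫ u in s..t, lam u :=
  intervalIntegral.integral_nonneg hst fun u hu => hlam_nonneg u (hs.trans_le hu.1)

/-- A function whose forward increments are of first order in the length and in the integrated rate
is continuous. -/
lemma continuousOn_of_increment (hlam : ContinuousOn lam (Ioi 0))
    (hlam_nonneg : ∀ t, 0 < t → 0 ≤ lam t) {M : ℝ} (hA : ∀ t, |A t| ≤ M) (hB : ∀ t, |B t| ≤ M)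
    (hf : ∀ t h : ℝ, 0 < t → 0 ≤ h → |f (t + h) - f t - h * A t - (∫ s in t..t + h, lam s) * B t| ≤
      K * (h ^ 2 + h * (∫ s in t..t + h, lam s) + (∫ s in t..t + h, lam s) ^ 2)) :
    ContinuousOn f (Ioi 0) := by
  set g : ℝ → ℝ := fun s => ∫ u in (1 : ℝ)..s, lam u with hg
  have hM : 0 ≤ M := (abs_nonneg _).trans (hA 0)
  -- The modulus of continuity of `f` is controlled by that of the integrated rate.
  have hinc : ∀ s t : ℝ, 0 < s → s ≤ t → |f t - f s| ≤ M * |t - s| + M * |g t - g s| +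
      K * (|t - s| ^ 2 + |t - s| * |g t - g s| + |g t - g s| ^ 2) := by
    intro s t hs hst
    have h1 := hf s (t - s) hs (sub_nonneg.2 hst)
    rw [add_sub_cancel, integral_eq_sub_of_pos hlam hs (hs.trans_le hst)] at h1
    have h2 : 0 ≤ g t - g s := by
      simp only [hg]
      rw [← integral_eq_sub_of_pos hlam hs (hs.trans_le hst)]
      exact integral_nonneg_of_pos hlam_nonneg hs hst
    change |f t - f s - (t - s) * A s - (g t - g s) * B s| ≤
      K * ((t - s) ^ 2 + (t - s) * (g t - g s) + (g t - g s) ^ 2) at h1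
    rw [abs_of_nonneg (sub_nonneg.2 hst), abs_of_nonneg h2]
    have h3 := abs_le.1 h1
    have h4 := abs_le.1 (hA s)
    have h5 := abs_le.1 (hB s)
    have h6 := sub_nonneg.2 hst
    rw [abs_le]
    constructor <;>
      nlinarith [mul_le_mul_of_nonneg_left h4.1 h6, mul_le_mul_of_nonneg_left h4.2 h6,
        mul_le_mul_of_nonneg_left h5.1 h2, mul_le_mul_of_nonneg_left h5.2 h2]
  refine continuousOn_of_forall_continuousAt fun t ht => ?_
  have hgt : ContinuousAt g t := (hasDerivAt_integral_of_pos hlam ht).continuousAt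
  refine tendsto_iff_dist_tendsto_zero.2 ?_
  have hlim : Tendsto (fun s => M * |s - t| + M * |g s - g t| +
      K * (|s - t| ^ 2 + |s - t| * |g s - g t| + |g s - g t| ^ 2)) (𝓝 t) (𝓝 0) := by
    have : ContinuousAt (fun s => M * |s - t| + M * |g s - g t| +
      K * (|s - t| ^ 2 + |s - t| * |g s - g t| + |g s - g t| ^ 2)) t := by fun_prop
    simpa [ContinuousAt] using this
  refine squeeze_zero' (Eventually.of_forall fun s => dist_nonneg) ?_ hlim
  filter_upwards [Ioi_mem_nhds ht] with s hs
  rw [Real.dist_eq]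
  rcases le_total s t with hst | hst
  · rw [abs_sub_comm (f s), abs_sub_comm s, abs_sub_comm (g s)]
    exact hinc s t hs hst
  · exact hinc t s ht hst

/-- A one-sided first-order expansion of the increments gives a two-sided derivative, since a
continuous function with a continuous right derivative is differentiable. -/
lemma hasDerivAt_of_increment (hlam : ContinuousOn lam (Ioi 0))
    (hA : ContinuousOn A (Ioi 0)) (hB : ContinuousOn B (Ioi 0)) (hfc : ContinuousOn f (Ioi 0))
    (hf : ∀ t h : ℝ, 0 < t → 0 ≤ h → |f (t + h) - f t - h * A t - (∫ s in t..t + h, lam s) * B t| ≤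
      K * (h ^ 2 + h * (∫ s in t..t + h, lam s) + (∫ s in t..t + h, lam s) ^ 2))
    {t : ℝ} (ht : 0 < t) : HasDerivAt f (A t + lam t * B t) t := by
  set g : ℝ → ℝ := fun s => ∫ u in (1 : ℝ)..s, lam u with hg
  have hright : ∀ t, 0 < t → HasDerivWithinAt f (A t + lam t * B t) (Ioi t) t := by
    intro t ht
    have hgt : HasDerivWithinAt g (lam t) (Ioi t) t :=
      (hasDerivAt_integral_of_pos hlam ht).hasDerivWithinAt
    have hid : HasDerivWithinAt (fun s : ℝ => s - t) 1 (Ioi t) t :=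
      (hasDerivWithinAt_id t _).sub_const t
    have hgs : HasDerivWithinAt (fun s => g s - g t) (lam t) (Ioi t) t := hgt.sub_const _
    set r : ℝ → ℝ := fun s => f s - f t - (s - t) * A t - (g s - g t) * B t with hr
    have hbound : HasDerivWithinAt (fun s => K * ((s - t) ^ 2 + (s - t) * (g s - g t) +
        (g s - g t) ^ 2)) 0 (Ioi t) t := by
      have := (((hid.pow 2).add (hid.mul hgs)).add (hgs.pow 2)).const_mul K
      simpa using this
    have hr0 : HasDerivWithinAt r 0 (Ioi t) t := by
      rw [hasDerivWithinAt_iff_isLittleO] at hbound ⊢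
      refine (Asymptotics.IsBigO.of_bound 1 ?_).trans_isLittleO hbound
      filter_upwards [self_mem_nhdsWithin] with s hs
      have h1 := hf t (s - t) ht (sub_nonneg.2 (le_of_lt hs))
      rw [add_sub_cancel, integral_eq_sub_of_pos hlam ht (ht.trans hs)] at h1
      change |r s| ≤ K * ((s - t) ^ 2 + (s - t) * (g s - g t) + (g s - g t) ^ 2) at h1
      have hrt : r t = 0 := by simp [hr]
      simp only [hrt, sub_self, smul_zero, sub_zero, one_mul, Real.norm_eq_abs, mul_zero,
        add_zero, ne_eq, OfNat.ofNat_ne_zero, not_false_eq_true, zero_pow]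
      exact h1.trans (le_abs_self _)
    have := ((hr0.add ((hid.mul_const (A t)).add (hgs.mul_const (B t)))).add_const (f t))
    refine (this.congr_deriv (by ring)).congr (fun s _ => ?_) ?_ <;> simp [hr]
  have hder : ContinuousOn (fun s => A s + lam s * B s) (Ioi 0) := hA.add (hlam.mul hB)
  have hEq : ∀ s ∈ Ioi (0 : ℝ), f s = f 1 + ∫ u in (1 : ℝ)..s, (A u + lam u * B u) := by
    intro s hs
    have hsub : uIcc 1 s ⊆ Ioi 0 := fun u hu => (lt_min one_pos hs).trans_le hu.1
    rw [intervalIntegral.integral_eq_sub_of_hasDeriv_right (hfc.mono hsub)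
      (fun u hu => hright u ((lt_min one_pos hs).trans hu.1))
      (intervalIntegrable_of_pos hder one_pos hs)]
    ring
  refine ((hasDerivAt_integral_of_pos hder ht).const_add (f 1)).congr_of_eventuallyEq ?_
  filter_upwards [Ioi_mem_nhds ht] with s hs using hEq s hs

end

section

variable {Ω : Type*} [MeasurableSpace Ω] {P : Measure Ω} [IsProbabilityMeasure P] {lam : ℝ → ℝ}
  {T : Ω → Set ℝ} {D : ℝ → Ω → ZMod 4}

lemma IsDirectionProcess.continuousOn_mean (hD : IsDirectionProcess P lam T D) {c : ℝ}
    (hc : 0 < c) (hlam : ContinuousOn lam (Ioi 0)) (hlam_nonneg : ∀ t, 0 < t → 0 ≤ lam t)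
    {φ : ℝ × ℝ → ℝ} (hφ : IsTest φ) (k : ZMod 4) : ContinuousOn (mean P c D k φ) (Ioi 0) := by
  obtain ⟨K, -, hK⟩ := hD.abs_mean_increment_le hc hφ k
  obtain ⟨C, hC, h₀, h₁, -, -⟩ := hφ.exists_bound
  have hA : ∀ t, |c * mean P c D k (dirDeriv (direction k) φ) t| ≤ (c + 2) * C := by
    intro t
    have := abs_mean_le (P := P) (c := c) (D := D) (k := k) (φ := dirDeriv (direction k) φ)
      (fun z => (h₁ z _).trans (mul_le_of_le_one_right hC (norm_direction_le k))) t
    rw [abs_mul, abs_of_pos hc]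
    nlinarith
  have hB : ∀ t, |mean P c D (k + 1) φ t / 2 + mean P c D (k - 1) φ t / 2 - mean P c D k φ t| ≤
      (c + 2) * C := by
    intro t
    have a₁ := abs_le.1 (abs_mean_le (P := P) (c := c) (D := D) (k := k + 1) h₀ t)
    have a₂ := abs_le.1 (abs_mean_le (P := P) (c := c) (D := D) (k := k - 1) h₀ t)
    have a₃ := abs_le.1 (abs_mean_le (P := P) (c := c) (D := D) (k := k) h₀ t)
    have := mul_nonneg hc.le hC
    rw [abs_le]
    constructor <;> linarith [a₁.1, a₁.2, a₂.1, a₂.2, a₃.1, a₃.2]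
  refine continuousOn_of_increment hlam hlam_nonneg hA hB (K := K) fun t h ht hh => ?_
  rw [← mul_assoc h c]
  exact hK t h ht hh (integral_nonneg_of_pos hlam_nonneg ht (by linarith))

/-- The forward equations of the Markov process (position, direction), in weak form. -/
lemma IsDirectionProcess.hasDerivAt_mean (hD : IsDirectionProcess P lam T D) {c : ℝ}
    (hc : 0 < c) (hlam : ContinuousOn lam (Ioi 0)) (hlam_nonneg : ∀ t, 0 < t → 0 ≤ lam t)
    {φ : ℝ × ℝ → ℝ} (hφ : IsTest φ) (k : ZMod 4) {t : ℝ} (ht : 0 < t) :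
    HasDerivAt (mean P c D k φ) (c * mean P c D k (dirDeriv (direction k) φ) t + lam t *
      (mean P c D (k + 1) φ t / 2 + mean P c D (k - 1) φ t / 2 - mean P c D k φ t)) t := by
  obtain ⟨K, -, hK⟩ := hD.abs_mean_increment_le hc hφ k
  have hcont := fun j => hD.continuousOn_mean hc hlam hlam_nonneg hφ j
  refine hasDerivAt_of_increment (A := fun t => c * mean P c D k (dirDeriv (direction k) φ) t)
    (B := fun t => mean P c D (k + 1) φ t / 2 + mean P c D (k - 1) φ t / 2 - mean P c D k φ t)
    (K := K) hlam
    (continuousOn_const.mul (hD.continuousOn_mean hc hlam hlam_nonneg (hφ.isTest_dirDeriv _) k))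
    ((((hcont (k + 1)).div_const 2).add ((hcont (k - 1)).div_const 2)).sub (hcont k))
    (hcont k) (fun t h ht hh => ?_) ht
  rw [← mul_assoc h c]
  exact hK t h ht hh (integral_nonneg_of_pos hlam_nonneg ht (by linarith))

end

/-! ### The weak form of the fourth-order equation -/

lemma IsTest.dirDeriv_comm {φ : ℝ × ℝ → ℝ} (h : IsTest φ) (v w : ℝ × ℝ) :
    dirDeriv v (dirDeriv w φ) = dirDeriv w (dirDeriv v φ) := by
  have hd : ContDiff ℝ 1 (fderiv ℝ φ) := h.contDiff.fderiv_right (m := 1) (by norm_cast)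
  have key : ∀ a b : ℝ × ℝ, ∀ z, dirDeriv a (dirDeriv b φ) z = fderiv ℝ (fderiv ℝ φ) z a b := by
    intro a b z
    have h1 := (hd.differentiable (by simp) z).hasFDerivAt.clm_apply (hasFDerivAt_const b z)
    change fderiv ℝ (fun z => fderiv ℝ φ z b) z a = _
    rw [h1.fderiv]
    simp
  ext z
  rw [key, key]
  exact h.contDiff.contDiffAt.isSymmSndFDerivAt (by simp; norm_cast) v w

/-- The derivative in the first coordinate. -/
noncomputable abbrev partialX (φ : ℝ × ℝ → ℝ) : ℝ × ℝ → ℝ := dirDeriv (1, 0) φ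

/-- The derivative in the second coordinate. -/
noncomputable abbrev partialY (φ : ℝ × ℝ → ℝ) : ℝ × ℝ → ℝ := dirDeriv (0, 1) φ

lemma IsTest.partialX {φ : ℝ × ℝ → ℝ} (h : IsTest φ) : IsTest (partialX φ) := h.isTest_dirDeriv _

lemma IsTest.partialY {φ : ℝ × ℝ → ℝ} (h : IsTest φ) : IsTest (partialY φ) := h.isTest_dirDeriv _

section

variable {Ω : Type*} [MeasurableSpace Ω] {P : Measure Ω} {lam : ℝ → ℝ} {c : ℝ}
  {T : Ω → Set ℝ} {D : ℝ → Ω → ZMod 4}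

lemma mean_dirDeriv_neg (k : ZMod 4) (φ : ℝ × ℝ → ℝ) (v w : ℝ × ℝ) (h : w = -v) (t : ℝ) :
    mean P c D k (dirDeriv w φ) t = -mean P c D k (dirDeriv v φ) t := by
  subst h
  simp only [mean, ← integral_neg]
  congr 1
  ext ω
  by_cases hk : D t ω = k <;> simp [observable, hk, dirDeriv]

lemma observable_sum {Ω : Type*} {D : ℝ → Ω → ZMod 4} (c : ℝ) (φ : ℝ × ℝ → ℝ) (t : ℝ)
    (ω : Ω) :
    observable c D 0 φ t ω + observable c D 1 φ t ω + observable c D 2 φ t ω +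
      observable c D 3 φ t ω = φ (position c D t ω) := by
  have h01 : (0 : ZMod 4) ≠ 1 := by decide
  have h02 : (0 : ZMod 4) ≠ 2 := by decide
  have h03 : (0 : ZMod 4) ≠ 3 := by decide
  have h12 : (1 : ZMod 4) ≠ 2 := by decide
  have h13 : (1 : ZMod 4) ≠ 3 := by decide
  have h23 : (2 : ZMod 4) ≠ 3 := by decide
  rcases zmod_four_cases (D t ω) with h | h | h | h <;>
    simp [observable, h, h01, h02, h03, h12, h13, h23, h01.symm, h02.symm, h03.symm, h12.symm,
      h13.symm, h23.symm]

variable [IsProbabilityMeasure P]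

lemma IsDirectionProcess.integral_position (hD : IsDirectionProcess P lam T D) (c : ℝ)
    {φ : ℝ × ℝ → ℝ} (hφ : IsTest φ) {t : ℝ} (ht : 0 < t) :
    ∫ ω, φ (position c D t ω) ∂P = mean P c D 0 φ t + mean P c D 1 φ t + mean P c D 2 φ t +
      mean P c D 3 φ t := by
  obtain ⟨C, -, h₀, -, -, -⟩ := hφ.exists_bound
  have hi := fun k => hD.integrable_observable c k hφ.contDiff.continuous.measurable h₀ ht
  have h01 : Integrable (fun ω => observable c D 0 φ t ω + observable c D 1 φ t ω) P :=
    (hi 0).add (hi 1)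
  have h012 : Integrable (fun ω => observable c D 0 φ t ω + observable c D 1 φ t ω +
    observable c D 2 φ t ω) P := h01.add (hi 2)
  simp only [← observable_sum]
  rw [integral_add h012 (hi 3), integral_add h01 (hi 2), integral_add (hi 0) (hi 1)]
  rfl

/-- The expectation of a test function of the position satisfies the weak form of the equation.
With `a`, `b` the differences and `s`, `r` the sums of the means for the directions `0, 2` and
`1, 3`, and subscripts for means of derivatives of the test function, the forward equations become
`a' = c s_x - λ a`, `b' = c r_y - λ b`, `s' = c a_x + λ (r - s)` and `r' = c b_y + λ (s - r)`.
Then `u = s + r` has `u' = c (a_x + b_y)`, the telegraph operator applied to `u` is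
`q = λ u' - c² (r_xx + s_yy)`, which satisfies `q' + λ q = λ' u' - c³ e` with
`e = b_xxy + a_xyy`, and `e' + λ e = c u_xxyy`. -/
lemma IsDirectionProcess.weak_equation (hD : IsDirectionProcess P lam T D) (hc : 0 < c)
    (hlam : ContDiffOn ℝ 2 lam (Ioi 0)) (hlam_nonneg : ∀ t, 0 < t → 0 ≤ lam t)
    {u : (ℝ × ℝ → ℝ) → ℝ → ℝ} (hu : u = fun φ t => ∫ ω, φ (position c D t ω) ∂P)
    {φ : ℝ × ℝ → ℝ} (hφ : IsTest φ) :
    ∃ u₁ u₂ q q₁ q₂ : ℝ → ℝ, ∀ t, 0 < t →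
      HasDerivAt (u φ) (u₁ t) t ∧ HasDerivAt u₁ (u₂ t) t ∧
      q t = u₂ t + 2 * lam t * u₁ t -
        c ^ 2 * (u (partialX (partialX φ)) t + u (partialY (partialY φ)) t) ∧
      HasDerivAt q (q₁ t) t ∧ HasDerivAt q₁ (q₂ t) t ∧
      q₂ t + 2 * lam t * q₁ t + (lam t ^ 2 + deriv lam t) * q t +
          c ^ 4 * u (partialY (partialY (partialX (partialX φ)))) t =
        deriv lam t * u₂ t + (deriv (deriv lam) t + lam t * deriv lam t) * u₁ t := by
  have hlam' : ContDiffOn ℝ 1 (deriv lam) (Ioi 0) :=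
    hlam.deriv_of_isOpen isOpen_Ioi (by norm_num)
  have hdl : ∀ t, 0 < t → HasDerivAt lam (deriv lam t) t := fun t ht =>
    ((hlam.differentiableOn (by simp)).differentiableAt (Ioi_mem_nhds ht)).hasDerivAt
  have hdl' : ∀ t, 0 < t → HasDerivAt (deriv lam) (deriv (deriv lam) t) t := fun t ht =>
    ((hlam'.differentiableOn (by simp)).differentiableAt (Ioi_mem_nhds ht)).hasDerivAt
  set m : ZMod 4 → (ℝ × ℝ → ℝ) → ℝ → ℝ := fun k ψ => mean P c D k ψ with hm
  have hfwd : ∀ (k : ZMod 4) {ψ : ℝ × ℝ → ℝ}, IsTest ψ → ∀ t, 0 < t →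
      HasDerivAt (m k ψ) (c * m k (dirDeriv (direction k) ψ) t + lam t *
        (m (k + 1) ψ t / 2 + m (k - 1) ψ t / 2 - m k ψ t)) t := fun k ψ hψ t ht =>
    hD.hasDerivAt_mean hc hlam.continuousOn hlam_nonneg hψ k ht
  have hneg : ∀ (k : ZMod 4) (ψ : ℝ × ℝ → ℝ) (v w : ℝ × ℝ), w = -v → ∀ t,
      m k (dirDeriv w ψ) t = -m k (dirDeriv v ψ) t := fun k ψ v w h t =>
    mean_dirDeriv_neg k ψ v w h t
  have z1 : (3 : ZMod 4) + 1 = 0 := by decide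
  have z2 : (0 : ZMod 4) - 1 = 3 := by decide
  have z3 : (1 : ZMod 4) + 1 = 2 := by decide
  have z4 : (2 : ZMod 4) + 1 = 3 := by decide
  have z5 : (2 : ZMod 4) - 1 = 1 := by decide
  have z6 : (3 : ZMod 4) - 1 = 2 := by decide
  have f0 : ∀ {ψ : ℝ × ℝ → ℝ}, IsTest ψ → ∀ t, 0 < t → HasDerivAt (m 0 ψ)
      (c * m 0 (partialX ψ) t + lam t * (m 1 ψ t / 2 + m 3 ψ t / 2 - m 0 ψ t)) t := by
    intro ψ hψ t ht
    have := hfwd 0 hψ t ht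
    rwa [direction_zero, zero_add, z2] at this
  have f1 : ∀ {ψ : ℝ × ℝ → ℝ}, IsTest ψ → ∀ t, 0 < t → HasDerivAt (m 1 ψ)
      (c * m 1 (partialY ψ) t + lam t * (m 2 ψ t / 2 + m 0 ψ t / 2 - m 1 ψ t)) t := by
    intro ψ hψ t ht
    have := hfwd 1 hψ t ht
    rwa [direction_one, z3, sub_self] at this
  have f2 : ∀ {ψ : ℝ × ℝ → ℝ}, IsTest ψ → ∀ t, 0 < t → HasDerivAt (m 2 ψ)
      (c * -m 2 (partialX ψ) t + lam t * (m 3 ψ t / 2 + m 1 ψ t / 2 - m 2 ψ t)) t := by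
    intro ψ hψ t ht
    have := hfwd 2 hψ t ht
    rwa [direction_two, z4, z5, hneg 2 ψ (1, 0) (-1, 0) (by simp)] at this
  have f3 : ∀ {ψ : ℝ × ℝ → ℝ}, IsTest ψ → ∀ t, 0 < t → HasDerivAt (m 3 ψ)
      (c * -m 3 (partialY ψ) t + lam t * (m 0 ψ t / 2 + m 2 ψ t / 2 - m 3 ψ t)) t := by
    intro ψ hψ t ht
    have := hfwd 3 hψ t ht
    rwa [direction_three, z1, z6, hneg 3 ψ (0, 1) (0, -1) (by simp)] at this
  clear hfwd hneg
  have hum : ∀ {ψ : ℝ × ℝ → ℝ}, IsTest ψ → ∀ t, 0 < t →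
      u ψ t = m 0 ψ t + m 1 ψ t + m 2 ψ t + m 3 ψ t := by
    intro ψ hψ t ht
    rw [hu]
    exact hD.integral_position c hψ ht
  clear_value m
  set a : (ℝ × ℝ → ℝ) → ℝ → ℝ := fun ψ t => m 0 ψ t - m 2 ψ t with ha
  set b : (ℝ × ℝ → ℝ) → ℝ → ℝ := fun ψ t => m 1 ψ t - m 3 ψ t with hb
  set s : (ℝ × ℝ → ℝ) → ℝ → ℝ := fun ψ t => m 0 ψ t + m 2 ψ t with hs
  set r : (ℝ × ℝ → ℝ) → ℝ → ℝ := fun ψ t => m 1 ψ t + m 3 ψ t with hr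
  have da : ∀ {ψ : ℝ × ℝ → ℝ}, IsTest ψ → ∀ t, 0 < t →
      HasDerivAt (a ψ) (c * s (partialX ψ) t - lam t * a ψ t) t := fun hψ t ht =>
    ((f0 hψ t ht).sub (f2 hψ t ht)).congr_deriv (by simp only [ha, hs]; ring)
  have db : ∀ {ψ : ℝ × ℝ → ℝ}, IsTest ψ → ∀ t, 0 < t →
      HasDerivAt (b ψ) (c * r (partialY ψ) t - lam t * b ψ t) t := fun hψ t ht =>
    ((f1 hψ t ht).sub (f3 hψ t ht)).congr_deriv (by simp only [hb, hr]; ring)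
  have ds : ∀ {ψ : ℝ × ℝ → ℝ}, IsTest ψ → ∀ t, 0 < t →
      HasDerivAt (s ψ) (c * a (partialX ψ) t + lam t * (r ψ t - s ψ t)) t := fun hψ t ht =>
    ((f0 hψ t ht).add (f2 hψ t ht)).congr_deriv (by simp only [ha, hs, hr]; ring)
  have dr : ∀ {ψ : ℝ × ℝ → ℝ}, IsTest ψ → ∀ t, 0 < t →
      HasDerivAt (r ψ) (c * b (partialY ψ) t + lam t * (s ψ t - r ψ t)) t := fun hψ t ht =>
    ((f1 hψ t ht).add (f3 hψ t ht)).congr_deriv (by simp only [hb, hs, hr]; ring)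
  have husr : ∀ {ψ : ℝ × ℝ → ℝ}, IsTest ψ → ∀ t, 0 < t → u ψ t = s ψ t + r ψ t := by
    intro ψ hψ t ht
    rw [hum hψ t ht]
    simp only [hs, hr]
    ring
  clear hum f0 f1 f2 f3
  clear_value a b s r
  have hxx := hφ.partialX.partialX
  have hyy := hφ.partialY.partialY
  have hcomm : partialX (partialX (partialY (partialY φ))) =
      partialY (partialY (partialX (partialX φ))) := by
    have h : ∀ {ψ : ℝ × ℝ → ℝ}, IsTest ψ →
        partialX (partialY (partialY ψ)) = partialY (partialY (partialX ψ)) := fun hψ =>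
      (hψ.partialY.dirDeriv_comm _ _).trans (congrArg partialY (hψ.dirDeriv_comm _ _))
    rw [h hφ, h hφ.partialX]
  set u₁ : ℝ → ℝ := fun t => c * (a (partialX φ) t + b (partialY φ) t) with hu₁
  set u₂ : ℝ → ℝ := fun t =>
    c ^ 2 * (s (partialX (partialX φ)) t + r (partialY (partialY φ)) t) - lam t * u₁ t with hu₂
  set q : ℝ → ℝ := fun t =>
    lam t * u₁ t - c ^ 2 * (r (partialX (partialX φ)) t + s (partialY (partialY φ)) t) with hq
  set e : ℝ → ℝ := fun t =>
    b (partialY (partialX (partialX φ))) t + a (partialX (partialY (partialY φ))) t with he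
  set q₁ : ℝ → ℝ := fun t => deriv lam t * u₁ t - lam t * q t - c ^ 3 * e t with hq₁
  have d₁ : ∀ t, 0 < t → HasDerivAt u₁ (u₂ t) t := fun t ht =>
    (((da hφ.partialX t ht).add (db hφ.partialY t ht)).const_mul c).congr_deriv
      (by simp only [hu₂, hu₁]; ring)
  have dq : ∀ t, 0 < t → HasDerivAt q (q₁ t) t := fun t ht =>
    (((hdl t ht).mul (d₁ t ht)).sub (((dr hxx t ht).add (ds hyy t ht)).const_mul
      (c ^ 2))).congr_deriv (by simp only [hq₁, hq, hu₂, he]; ring)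
  have de : ∀ t, 0 < t → HasDerivAt e
      (c * u (partialY (partialY (partialX (partialX φ)))) t - lam t * e t) t := fun t ht =>
    ((db hxx.partialY t ht).add (da hyy.partialX t ht)).congr_deriv
      (by rw [husr hxx.partialY.partialY t ht, hcomm]; simp only [he]; ring)
  refine ⟨u₁, u₂, q, q₁, fun t => deriv (deriv lam) t * u₁ t + deriv lam t * u₂ t -
    (deriv lam t * q t + lam t * q₁ t) -
    c ^ 3 * (c * u (partialY (partialY (partialX (partialX φ)))) t - lam t * e t),
    fun t ht => ⟨?_, d₁ t ht, ?_, dq t ht, ?_, ?_⟩⟩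
  · refine (((ds hφ t ht).add (dr hφ t ht)).congr_deriv
      (by simp only [hu₁]; ring)).congr_of_eventuallyEq ?_
    filter_upwards [Ioi_mem_nhds ht] with x hx using husr hφ x hx
  · rw [husr hxx t ht, husr hyy t ht]
    simp only [hq, hu₂]
    ring
  · exact (((hdl' t ht).mul (d₁ t ht)).sub ((hdl t ht).mul (dq t ht))).sub
      ((de t ht).const_mul (c ^ 3))
  · simp only [hq₁]
    ring

end

/-! ### Null events and independence -/

/-- If the sections of an event, with one of two independent families fixed, are almost surely null,
then so is the event. -/
lemma measure_eq_zero_of_indep {Ω α β : Type*} [MeasurableSpace α] [MeasurableSpace β]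
    {m₁ m₂ m₀ : MeasurableSpace Ω} {P : Measure Ω} [IsProbabilityMeasure P] (hm₁ : m₁ ≤ m₀)
    (hm₂ : m₂ ≤ m₀) (h : Indep m₁ m₂ P) {F H : Set Ω} (hF : MeasurableSet[m₁] F)
    (hH : MeasurableSet[m₂] H) {Z : Ω → α} {G : Ω → β} (hZ : Measurable[m₁] Z)
    (hG : Measurable[m₂] G) {S : Set (α × β)} (hS : MeasurableSet S)
    (hnull : P (F ∩ {ω | P (H ∩ {ω' | (Z ω, G ω') ∈ S}) ≠ 0}) = 0) :
    P (F ∩ H ∩ {ω | (Z ω, G ω) ∈ S}) = 0 := by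
  have hF0 := hm₁ _ hF
  have hH0 := hm₂ _ hH
  have hZ0 : Measurable Z := hZ.mono hm₁ le_rfl
  have hG0 : Measurable G := hG.mono hm₂ le_rfl
  have hprod : ((P.restrict F).map Z).prod ((P.restrict H).map G) =
      (P.restrict (F ∩ H)).map fun ω => (Z ω, G ω) := by
    refine Measure.prod_eq fun A B hA hB => ?_
    rw [Measure.map_apply (hZ0.prodMk hG0) (hA.prod hB), Measure.map_apply hZ0 hA,
      Measure.map_apply hG0 hB, Measure.restrict_apply (hZ0 hA), Measure.restrict_apply (hG0 hB),
      Measure.restrict_apply ((hZ0.prodMk hG0) (hA.prod hB)),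
      ← (Indep_iff _ _ _).1 h _ _ (MeasurableSet.inter (hZ hA) hF)
        (MeasurableSet.inter (hG hB) hH)]
    congr 1
    ext ω
    simp only [mem_inter_iff, mem_preimage, mem_prod]
    tauto
  have hS0 : (((P.restrict F).map Z).prod ((P.restrict H).map G)) S = 0 := by
    rw [Measure.measure_prod_null hS]
    have hms : MeasurableSet {z | (P.restrict H).map G (Prod.mk z ⁻¹' S) = 0} :=
      measurable_measure_prodMk_left hS (measurableSet_singleton 0)
    refine (ae_map_iff hZ0.aemeasurable hms).2 ?_
    refine (ae_restrict_iff' hF0).2 ?_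
    refine measure_mono_null (fun ω hω => ?_) hnull
    have hω' : ¬(ω ∈ F → (P.restrict H).map G (Prod.mk (Z ω) ⁻¹' S) = 0) := hω
    push Not at hω'
    refine ⟨hω'.1, fun h0 => hω'.2 ?_⟩
    rw [Measure.map_apply hG0 (measurable_prodMk_left hS),
      Measure.restrict_apply (hG0 (measurable_prodMk_left hS)), inter_comm]
    exact h0
  rw [hprod, Measure.map_apply (hZ0.prodMk hG0) hS,
    Measure.restrict_apply ((hZ0.prodMk hG0) hS), inter_comm] at hS0
  exact hS0

/-- The random variable `X`, restricted to the event `E`, has an absolutely continuous law with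
respect to `ν`. -/
def IsACOn {Ω β : Type*} [MeasurableSpace Ω] [MeasurableSpace β] (P : Measure Ω) (ν : Measure β)
    (E : Set Ω) (X : Ω → β) : Prop :=
  ∀ N : Set β, MeasurableSet N → ν N = 0 → P (E ∩ X ⁻¹' N) = 0

section

variable {Ω : Type*} [MeasurableSpace Ω] {P : Measure Ω} [IsProbabilityMeasure P] {lam : ℝ → ℝ}
  {T : Ω → Set ℝ} {D : ℝ → Ω → ZMod 4}

/-- The displacement is a function of the events and of the turns. -/
lemma exists_measurable_displacement {Ω : Type*} [MeasurableSpace Ω] {T : Ω → Set ℝ} {s t : ℝ}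
    (hst : s ≤ t) {ξ : ℕ → Ω → ZMod 4} (hξ : ∀ n, Measurable (ξ n))
    (hcount : ∀ r, s ≤ r → Measurable (count T s r)) (c : ℝ) (k : ZMod 4) :
    ∃ G : Ω → ℝ × ℝ, Measurable G ∧ ∀ ω,
      (∀ w : ZMod 4 → ℝ, ∀ r ∈ Ioo s t, ContinuousWithinAt
        (fun r => w (k + ∑ n ∈ Finset.range (count T s r ω), ξ n ω)) (Ici r) r) →
      displacement c (fun r => k + ∑ n ∈ Finset.range (count T s r ω), ξ n ω) s t = G ω := by
  have hV : ∀ r ∈ Ioc s t,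
      Measurable fun ω => k + ∑ n ∈ Finset.range (count T s r ω), ξ n ω := by
    intro r hr
    have h2 : Measurable fun x : Ω × ℕ => k + ∑ n ∈ Finset.range x.2, ξ n x.1 :=
      measurable_from_prod_countable_left fun j =>
        (Finset.measurable_fun_sum (Finset.range j) fun n _ => hξ n).const_add k
    exact h2.comp (measurable_id.prodMk (hcount r hr.1.le))
  have key : ∀ w : ZMod 4 → ℝ, (∀ k, |w k| ≤ 1) → _ := fun w hw =>
    exists_measurable_eq_integral (C := 1) hst
      (f := fun r ω => w (k + ∑ n ∈ Finset.range (count T s r ω), ξ n ω)) (fun r ω => hw _)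
      fun r hr => measurable_from_top.comp (hV r hr)
  obtain ⟨Z₁, hm₁, h₁⟩ := key _ abs_direction_fst_le
  obtain ⟨Z₂, hm₂, h₂⟩ := key _ abs_direction_snd_le
  refine ⟨fun ω => (c * Z₁ ω, c * Z₂ ω), (hm₁.const_mul c).prodMk (hm₂.const_mul c),
    fun ω hω => ?_⟩
  simp only [displacement]
  rw [h₁ ω (hω fun k => (direction k).1), h₂ ω (hω fun k => (direction k).2)]

/-- Given the direction at time `s`, the displacement after time `s` is independent of the history
up to time `s`. -/
lemma IsDirectionProcess.exists_indep_displacement (hD : IsDirectionProcess P lam T D) (c : ℝ)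
    {s t : ℝ} (hs : 0 < s) (hst : s ≤ t) :
    ∃ (ξ : ℕ → Ω → ZMod 4) (G : ZMod 4 → Ω → ℝ × ℝ),
      future T s ⊔ turns ξ ≤ (inferInstance : MeasurableSpace Ω) ∧
      Indep (future T s ⊔ turns ξ) (history T D s) P ∧
      (∀ k, Measurable[future T s ⊔ turns ξ] (G k)) ∧
      ∀ᵐ ω ∂P, displacement c (fun r => D r ω) s t = G (D s ω) ω := by
  obtain ⟨ξ, hξm, -, -, hind, -, hpath⟩ := hD.exists_turns hs
  choose G hGm hG using @exists_measurable_displacement Ω (future T s ⊔ turns ξ) T s t hst ξ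
    (fun n => (measurable_turns ξ n).mono le_sup_right le_rfl)
    (fun r hr => (measurable_count_future le_rfl hr).mono le_sup_left le_rfl) c
  refine ⟨ξ, G, sup_le (hD.future_le hs) (turns_le hξm), hind.symm, hGm, ?_⟩
  filter_upwards [hD.ae_regular, hpath] with ω hreg hω
  have hVD : ∀ r, s ≤ r → D s ω + ∑ n ∈ Finset.range (count T s r ω), ξ n ω = D r ω :=
    fun r hr => (hω r hr).symm
  have hint : ∀ w : ZMod 4 → ℝ, ∫ r in s..t, w (D r ω) =
      ∫ r in s..t, w (D s ω + ∑ n ∈ Finset.range (count T s r ω), ξ n ω) := by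
    intro w
    refine intervalIntegral.integral_congr fun r hr => ?_
    rw [uIcc_of_le hst] at hr
    simp only [hVD r hr.1]
  rw [← hG (D s ω) ω, displacement, displacement, hint fun k => (direction k).1,
    hint fun k => (direction k).2]
  intro w r hr
  refine (hreg.rightContinuous w (hs.trans hr.1)).congr (fun x hx => ?_) ?_
  · rw [hVD x (hr.1.le.trans hx)]
  · rw [hVD r hr.1.le]

/-- Absolute continuity of an additive function of the position persists: what is added to the
position later is conditionally independent of it. -/
lemma IsDirectionProcess.isACOn_of_le (hD : IsDirectionProcess P lam T D) (c : ℝ) {s t : ℝ}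
    (hs : 0 < s) (hst : s ≤ t) {β : Type*} [NormedAddCommGroup β] [MeasurableSpace β] [BorelSpace β]
    [SecondCountableTopology β] {ν : Measure β} [ν.IsAddRightInvariant] {l : ℝ × ℝ → β}
    (hl : Measurable l) (hadd : ∀ z w, l (z + w) = l z + l w) {E : Set Ω}
    (hE : MeasurableSet[history T D s] E)
    (hac : IsACOn P ν E fun ω => l (position c D s ω)) :
    IsACOn P ν E fun ω => l (position c D t ω) := by
  intro N hN hN0
  obtain ⟨ξ, G, hm, hind, hG, hdisp⟩ := hD.exists_indep_displacement c hs hst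
  obtain ⟨Z, hZ, hpos⟩ := hD.exists_position c hs.le
  have hS : MeasurableSet {x : (ℝ × ℝ) × (ℝ × ℝ) | l x.2 + l x.1 ∈ N} :=
    ((hl.comp measurable_snd).add (hl.comp measurable_fst)) hN
  have hDk : ∀ k, MeasurableSet[history T D s] {ω | D s ω = k} := fun k =>
    (measurable_direction_history (D := D) ⟨hs, le_rfl⟩) (measurableSet_singleton k)
  have hk : ∀ k, P (univ ∩ (E ∩ {ω | D s ω = k}) ∩
      {ω | (G k ω, Z ω) ∈ {x : (ℝ × ℝ) × (ℝ × ℝ) | l x.2 + l x.1 ∈ N}}) = 0 := by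
    intro k
    refine measure_eq_zero_of_indep hm (hD.history_le s) hind MeasurableSet.univ
      (MeasurableSet.inter hE (hDk k)) (hG k) hZ hS ?_
    convert measure_empty (μ := P)
    refine eq_empty_of_forall_notMem fun ω hω => hω.2 ?_
    have h0 := hac ((fun x => x + l (G k ω)) ⁻¹' N) ((measurable_add_const _) hN)
      (by rwa [measure_preimage_add_right])
    have hpos' : P {ω | position c D s ω ≠ Z ω} = 0 := hpos
    refine measure_mono_null (fun ω' hω' => ?_) (measure_union_null h0 hpos')
    by_cases hz : position c D s ω' = Z ω'
    · left
      refine ⟨hω'.1.1, ?_⟩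
      have := hω'.2
      simp only [mem_ofPred_eq] at this
      simp only [mem_preimage, hz, this]
    · exact Or.inr hz
  have hall := measure_iUnion_null hk
  have hpos' : P {ω | position c D s ω ≠ Z ω} = 0 := hpos
  have hdisp' : P {ω | ¬displacement c (fun r => D r ω) s t = G (D s ω) ω} = 0 := hdisp
  have hreg : P {ω | ¬IsRegularPath (T ω) fun r => D r ω} = 0 := hD.ae_regular
  refine measure_mono_null (fun ω hω => ?_)
    (measure_union_null (measure_union_null hall hpos') (measure_union_null hdisp' hreg))
  by_cases h1 : position c D s ω = Z ω
  · by_cases h2 : displacement c (fun r => D r ω) s t = G (D s ω) ω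
    · by_cases h3 : IsRegularPath (T ω) fun r => D r ω
      · refine Or.inl (Or.inl (mem_iUnion.2 ⟨D s ω, ⟨⟨trivial, hω.1, rfl⟩, ?_⟩⟩))
        have h4 : position c D t ω = position c D s ω + displacement c (fun r => D r ω) s t :=
          h3.displacement_add c le_rfl hs.le hst
        have h5 : l (position c D t ω) ∈ N := hω.2
        rw [h4, h1, h2, hadd] at h5
        exact h5
      · exact Or.inr (Or.inr h3)
    · exact Or.inr (Or.inl h2)
  · exact Or.inl (Or.inr h1)

end

/-! ### The time of an isolated event -/

/-- A measure on the line that is bounded by a multiple of the length on intervals is bounded by the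
same multiple of the Lebesgue measure. -/
lemma measure_le_smul_volume {ν : Measure ℝ} {K : NNReal} (hK : K ≠ 0)
    (h : ∀ a b : ℝ, a ≤ b → ν (Ioc a b) ≤ K * ENNReal.ofReal (b - a)) (N : Set ℝ) :
    ν N ≤ K * volume N := by
  have hle : ν.toOuterMeasure ≤ (K : ENNReal) • StieltjesFunction.id.outer := by
    rw [StieltjesFunction.outer, OuterMeasure.smul_ofFunction (by simp), OuterMeasure.le_ofFunction]
    intro s
    have hK' : (K : ENNReal) ≠ 0 := by simpa using hK
    simp only [Pi.smul_apply, smul_eq_mul, StieltjesFunction.length_eq,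
      ENNReal.mul_iInf_of_ne hK' ENNReal.coe_ne_top]
    refine le_iInf fun a => le_iInf fun b => le_iInf fun hs => ?_
    have hs' : s ⊆ Ioc a b := fun x hx => hs ⟨hx, fun hbot => not_isBot x hbot⟩
    refine (measure_mono hs').trans ?_
    rcases le_total a b with hab | hab
    · exact h a b hab
    · simp [Ioc_eq_empty (not_lt.2 hab)]
  have := hle N
  rw [Real.volume_eq_stieltjes_id, StieltjesFunction.measure]
  exact this

section

variable {Ω : Type*} [MeasurableSpace Ω] {P : Measure Ω} [IsProbabilityMeasure P] {lam : ℝ → ℝ}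
  {T : Ω → Set ℝ} {D : ℝ → Ω → ZMod 4}

open Classical in
/-- The event time in `(r, w]` if there is exactly one, and `0` otherwise. -/
noncomputable def eventTime {Ω : Type*} (T : Ω → Set ℝ) (r w : ℝ) (ω : Ω) : ℝ :=
  if count T r w ω = 1 then sInf (T ω ∩ Ioc r w) else 0

lemma inter_Ioc_eq_singleton {Ω : Type*} {T : Ω → Set ℝ} {r w : ℝ} {ω : Ω}
    (h : count T r w ω = 1) : T ω ∩ Ioc r w = {eventTime T r w ω} := by
  obtain ⟨x, hx⟩ := ncard_eq_one.1 h
  rw [eventTime, if_pos h, hx, csInf_singleton]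

lemma count_eq_one_iff {Ω : Type*} {T : Ω → Set ℝ} {r w a b : ℝ} {ω : Ω}
    (h : count T r w ω = 1) (ha : r ≤ a) (hb : b ≤ w) :
    1 ≤ count T a b ω ↔ eventTime T r w ω ∈ Ioc a b := by
  have hx := inter_Ioc_eq_singleton h
  have hsub : T ω ∩ Ioc a b ⊆ {eventTime T r w ω} :=
    hx ▸ inter_subset_inter_right _ (Ioc_subset_Ioc ha hb)
  constructor
  · intro h1
    obtain ⟨y, hy⟩ := nonempty_of_ncard_ne_zero (s := T ω ∩ Ioc a b) (Nat.one_le_iff_ne_zero.1 h1)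
    have := hsub hy
    rw [mem_singleton_iff] at this
    exact this ▸ hy.2
  · intro h1
    have hmem : eventTime T r w ω ∈ T ω ∩ Ioc r w := hx ▸ mem_singleton _
    exact Nat.one_le_iff_ne_zero.2
      (ncard_ne_zero_of_mem ⟨hmem.1, h1⟩ ((finite_singleton _).subset hsub))

lemma measurable_eventTime {Ω : Type*} {T : Ω → Set ℝ} {r w : ℝ} (hrw : r ≤ w) :
    Measurable[future T r] (eventTime T r w) := by
  have hN : MeasurableSet[future T r] {ω | count T r w ω = 1} :=
    (measurable_count_future (T := T) le_rfl hrw) (measurableSet_singleton 1)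
  refine measurable_of_Iic fun x => ?_
  have hN0 : MeasurableSet[future T r] {ω | ¬count T r w ω = 1 ∧ 0 ≤ x} := by
    by_cases hx : 0 ≤ x
    · simp only [hx, and_true]
      exact MeasurableSet.compl hN
    · simp only [hx, and_false]
      exact @MeasurableSet.const _ (future T r) False
  have h1 : MeasurableSet[future T r] {ω | count T r w ω = 1 ∧ eventTime T r w ω ≤ x} := by
    by_cases hx : r ≤ x
    · have hm : MeasurableSet[future T r] {ω | 1 ≤ count T r (min x w) ω} :=
        (measurable_count_future (T := T) le_rfl (le_min hx hrw)) measurableSet_Ici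
      convert MeasurableSet.inter hN hm using 1
      ext ω
      refine and_congr_right fun h => ?_
      have h2 : eventTime T r w ω ∈ T ω ∩ Ioc r w := inter_Ioc_eq_singleton h ▸ mem_singleton _
      rw [mem_ofPred_eq, count_eq_one_iff h le_rfl (min_le_right _ _), mem_Ioc, le_min_iff]
      exact ⟨fun h3 => ⟨h2.2.1, h3, h2.2.2⟩, fun h3 => h3.2.1⟩
    · convert @MeasurableSet.empty _ (future T r) using 1
      refine eq_empty_of_forall_notMem fun ω hω => hx ?_
      have h2 : eventTime T r w ω ∈ T ω ∩ Ioc r w :=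
        inter_Ioc_eq_singleton hω.1 ▸ mem_singleton _
      exact h2.2.1.le.trans hω.2
  convert MeasurableSet.union h1 hN0 using 1
  ext ω
  by_cases h : count T r w ω = 1
  · simp [h]
  · simp [h, eventTime]

/-- On the event that there is exactly one event in `(r, w]`, the law of its time is absolutely
continuous. -/
lemma IsDirectionProcess.isACOn_eventTime (hD : IsDirectionProcess P lam T D)
    (hlam : ContinuousOn lam (Ioi 0)) (hlam_nonneg : ∀ t, 0 < t → 0 ≤ lam t) {r w : ℝ}
    (hr : 0 < r) (hrw : r ≤ w) :
    IsACOn P volume {ω | count T r w ω = 1} (eventTime T r w) := by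
  obtain ⟨L, hL⟩ := isCompact_Icc.exists_bound_of_continuousOn (s := Icc r w) (f := lam)
    (hlam.mono fun x hx => hr.trans_le hx.1)
  have hL0 : 0 ≤ L := (norm_nonneg _).trans (hL r ⟨le_rfl, hrw⟩)
  have hm : Measurable (eventTime T r w) :=
    (measurable_eventTime hrw).mono (hD.future_le hr) le_rfl
  have hN : MeasurableSet {ω | count T r w ω = 1} :=
    (hD.poisson.measurable_count r w hr) (measurableSet_singleton 1)
  set ν := (P.restrict {ω | count T r w ω = 1}).map (eventTime T r w) with hν
  have hbound : ∀ a b : ℝ, a ≤ b →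
      ν (Ioc a b) ≤ ((L + 1).toNNReal : NNReal) * ENNReal.ofReal (b - a) := by
    intro a b hab
    rw [hν, Measure.map_apply hm measurableSet_Ioc, Measure.restrict_apply (hm measurableSet_Ioc)]
    set a' := max a r
    set b' := min b w
    have hsub : eventTime T r w ⁻¹' Ioc a b ∩ {ω | count T r w ω = 1} ⊆
        {ω | a' < b' ∧ 1 ≤ count T a' b' ω} := by
      intro ω hω
      have h1 : count T r w ω = 1 := hω.2
      have h2 : eventTime T r w ω ∈ T ω ∩ Ioc r w := inter_Ioc_eq_singleton h1 ▸ mem_singleton _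
      have h3 : eventTime T r w ω ∈ Ioc a' b' :=
        ⟨max_lt hω.1.1 h2.2.1, le_min hω.1.2 h2.2.2⟩
      exact ⟨h3.1.trans_le h3.2,
        (count_eq_one_iff h1 (le_max_right _ _) (min_le_right _ _)).2 h3⟩
    by_cases hab' : a' < b'
    · have ha' : 0 < a' := hr.trans_le (le_max_right _ _)
      have hΛ := integral_nonneg_of_pos hlam_nonneg ha' hab'.le
      have hle := hD.poisson.measureReal_count_pos_le ha' hab'.le hΛ
      have hint : ∫ s in a'..b', lam s ≤ (L + 1) * (b - a) := by
        have h1 := intervalIntegral.norm_integral_le_of_norm_le_const (a := a') (b := b')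
          (f := lam) (C := L) fun s hs => by
            rw [uIoc_of_le hab'.le] at hs
            exact hL s ⟨(le_max_right _ _).trans hs.1.le, hs.2.trans (min_le_right _ _)⟩
        have h2 : |b' - a'| ≤ b - a := by
          rw [abs_of_pos (sub_pos.2 hab')]
          exact sub_le_sub (min_le_left _ _) (le_max_left _ _)
        calc ∫ s in a'..b', lam s ≤ L * |b' - a'| := (le_abs_self _).trans h1
          _ ≤ L * (b - a) := by gcongr
          _ ≤ (L + 1) * (b - a) := by
            have := sub_nonneg.2 hab
            nlinarith
      have hsub' : eventTime T r w ⁻¹' Ioc a b ∩ {ω | count T r w ω = 1} ⊆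
          {ω | 1 ≤ count T a' b' ω} := fun ω hω => (hsub hω).2
      refine (measure_mono hsub').trans ?_
      rw [← ENNReal.ofReal_toReal (measure_ne_top P _)]
      change ENNReal.ofReal (P.real {ω | 1 ≤ count T a' b' ω}) ≤ _
      rw [← ENNReal.ofReal, ← ENNReal.ofReal_mul (by linarith)]
      exact ENNReal.ofReal_le_ofReal (hle.trans hint)
    · refine (measure_mono hsub).trans ?_
      simp [hab']
  intro N hNm hN0
  have h1 := measure_le_smul_volume (K := (L + 1).toNNReal)
    (by simpa using (by linarith : 0 < L + 1)) hbound N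
  rw [hN0, mul_zero, hν, Measure.map_apply hm hNm, Measure.restrict_apply (hm hNm),
    inter_comm] at h1
  exact nonpos_iff_eq_zero.1 h1

/-- The effect of a single event in `(r, w]` on the position. -/
lemma IsRegularPath.position_of_count_eq_one {Ω : Type*} {T : Ω → Set ℝ}
    {D : ℝ → Ω → ZMod 4} (c : ℝ) {r w : ℝ} (hr : 0 < r) {ω : Ω}
    (hreg : IsRegularPath (T ω) fun s => D s ω) (hN : count T r w ω = 1) :
    position c D w ω = position c D r ω +
      ((c * (eventTime T r w ω - r)) • direction (D r ω) +
        (c * (w - eventTime T r w ω)) • direction (D w ω)) := by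
  set τ := eventTime T r w ω with hτ
  have hsing := inter_Ioc_eq_singleton hN
  have hmem : τ ∈ T ω ∩ Ioc r w := hsing ▸ mem_singleton _
  have hw : r ≤ w := hmem.2.1.le.trans hmem.2.2
  have h1 : ∀ s ∈ Ioo r τ, D s ω = D r ω := fun s hs => by
    refine hreg.stay r s hr hs.1.le (eq_empty_of_forall_notMem fun x hx => ?_)
    have : x ∈ T ω ∩ Ioc r w := ⟨hx.1, hx.2.1, hx.2.2.trans (hs.2.le.trans hmem.2.2)⟩
    rw [hsing, mem_singleton_iff] at this
    exact absurd hx.2.2 (not_le.2 (this ▸ hs.2))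
  have h2 : ∀ s ∈ Ioo τ w, D s ω = D w ω := fun s hs => by
    refine (hreg.stay s w (hr.trans (hmem.2.1.trans hs.1)) hs.2.le
      (eq_empty_of_forall_notMem fun x hx => ?_)).symm
    have : x ∈ T ω ∩ Ioc r w := ⟨hx.1, hmem.2.1.trans (hs.1.trans hx.2.1), hx.2.2⟩
    rw [hsing, mem_singleton_iff] at this
    exact absurd (hs.1.trans hx.2.1) (by rw [this]; exact lt_irrefl _)
  simp only [position_eq_displacement]
  rw [hreg.displacement_add c le_rfl hr.le hw,
    hreg.displacement_add c hr.le hmem.2.1.le hmem.2.2,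
    displacement_const c hmem.2.1.le h1, displacement_const c hmem.2.2 h2]

/-- Reduction of absolute continuity after a single event in `(r, w]` to the event time. -/
lemma IsDirectionProcess.isACOn_of_count_eq_one (hD : IsDirectionProcess P lam T D) (c : ℝ)
    {r w : ℝ} (hr : 0 < r) (hrw : r ≤ w) {β : Type*} [MeasurableSpace β] {ν : Measure β}
    {l : ℝ × ℝ → β} (hl : Measurable l) {F : Set Ω} (hF : MeasurableSet[history T D r] F)
    {k k' : ZMod 4}
    (hnull : ∀ N : Set β, MeasurableSet N → ν N = 0 →
      P (F ∩ {ω | P ({ω' | count T r w ω' = 1} ∩ {ω' | l (position c D r ω +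
        ((c * (eventTime T r w ω' - r)) • direction k +
          (c * (w - eventTime T r w ω')) • direction k')) ∈ N}) ≠ 0}) = 0) :
    IsACOn P ν (F ∩ {ω | D r ω = k ∧ count T r w ω = 1 ∧ D w ω = k'})
      fun ω => l (position c D w ω) := by
  intro N hN hN0
  obtain ⟨Z, hZ, hpos⟩ := hD.exists_position c hr.le
  obtain ⟨ξ, hξm, -, -, hind, -, -⟩ := hD.exists_turns hr
  have hind' : Indep (history T D r) (future T r) P := indep_of_indep_of_le_right hind le_sup_left
  have hpos' : P {ω | position c D r ω ≠ Z ω} = 0 := hpos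
  have hreg : P {ω | ¬IsRegularPath (T ω) fun r => D r ω} = 0 := hD.ae_regular
  set Ψ : (ℝ × ℝ) × ℝ → ℝ × ℝ := fun x =>
    x.1 + ((c * (x.2 - r)) • direction k + (c * (w - x.2)) • direction k') with hΨ
  have hΨm : Measurable Ψ := by
    apply Continuous.measurable
    fun_prop
  have hS : MeasurableSet {x | l (Ψ x) ∈ N} := (hl.comp hΨm) hN
  have hNf : MeasurableSet[future T r] {ω | count T r w ω = 1} :=
    (measurable_count_future (T := T) le_rfl hrw) (measurableSet_singleton 1)
  have h0 := measure_eq_zero_of_indep (hD.history_le r) (hD.future_le hr) hind' hF hNf hZ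
    (measurable_eventTime hrw) hS (by
      refine measure_mono_null (fun ω hω => ?_) (measure_union_null (hnull N hN hN0) hpos')
      by_cases hz : position c D r ω = Z ω
      · left
        refine ⟨hω.1, ?_⟩
        have h1 := hω.2
        simp only [mem_ofPred_eq] at h1 ⊢
        rw [hz]
        exact h1
      · exact Or.inr hz)
  refine measure_mono_null (fun ω hω => ?_)
    (measure_union_null h0 (measure_union_null hpos' hreg))
  by_cases h1 : position c D r ω = Z ω
  · by_cases h2 : IsRegularPath (T ω) fun r => D r ω
    · left
      obtain ⟨⟨hF', hk, hc1, hk'⟩, hmem⟩ := hω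
      refine ⟨⟨hF', hc1⟩, ?_⟩
      have h3 := IsRegularPath.position_of_count_eq_one (T := T) c hr h2 hc1
      rw [hk, hk', h1] at h3
      have h4 : l (position c D w ω) ∈ N := hmem
      rw [h3] at h4
      exact h4
    · exact Or.inr (Or.inr h2)
  · exact Or.inr (Or.inl h1)

end

/-! ### Absolute continuity away from the singular lines -/

/-- The coordinates `x + y` (for `σ = 1`) and `x - y` (for `σ = -1`). In each of them the motion has
speed `c`, and every turn reverses exactly one of the two velocities. -/
noncomputable def diag (σ : ℝ) (z : ℝ × ℝ) : ℝ := z.1 + σ * z.2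

lemma measurable_diag (σ : ℝ) : Measurable (diag σ) := by
  unfold diag
  fun_prop

lemma diag_add (σ : ℝ) (z w : ℝ × ℝ) : diag σ (z + w) = diag σ z + diag σ w := by
  simp [diag]
  ring

lemma diag_smul (σ a : ℝ) (z : ℝ × ℝ) : diag σ (a • z) = a * diag σ z := by
  simp [diag]
  ring

lemma diag_direction {σ : ℝ} (hσ : σ = 1 ∨ σ = -1) (k : ZMod 4) :
    diag σ (direction k) = 1 ∨ diag σ (direction k) = -1 := by
  rcases zmod_four_cases k with rfl | rfl | rfl | rfl <;> rcases hσ with rfl | rfl <;>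
    simp [diag, direction_zero, direction_one, direction_two, direction_three]

/-- A right-angle turn changes the first coordinate of the velocity and reverses only one of the two
diagonal velocities. -/
lemma turn_changes_one_diag {σ : ℝ} (hσ : σ = 1 ∨ σ = -1) {k k' : ZMod 4}
    (h : k' = k + 1 ∨ k' = k - 1) :
    (direction k).1 ≠ (direction k').1 ∧
      (diag σ (direction k) ≠ diag σ (direction k') →
        diag (-σ) (direction k) = diag (-σ) (direction k')) := by
  have z1 : (3 : ZMod 4) + 1 = 0 := by decide
  have z2 : (0 : ZMod 4) - 1 = 3 := by decide
  have z3 : (1 : ZMod 4) + 1 = 2 := by decide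
  have z4 : (2 : ZMod 4) + 1 = 3 := by decide
  have z5 : (2 : ZMod 4) - 1 = 1 := by decide
  have z6 : (3 : ZMod 4) - 1 = 2 := by decide
  have z7 : direction (-1) = (0, -1) := direction_three
  have z8 : direction 4 = (1, 0) := direction_zero
  rcases zmod_four_cases k with rfl | rfl | rfl | rfl <;> rcases h with rfl | rfl <;>
    rcases hσ with rfl | rfl <;>
    norm_num [diag, direction_zero, direction_one, direction_two, direction_three, z1, z2, z3, z4,
      z5, z6, z7, z8]

lemma volume_preimage_affine {N : Set ℝ} (hN : volume N = 0) (A : ℝ) {B : ℝ} (hB : B ≠ 0) :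
    volume ((fun x => A + x * B) ⁻¹' N) = 0 := by
  have : (fun x => A + x * B) ⁻¹' N = (fun x => x * B) ⁻¹' ((fun x => A + x) ⁻¹' N) := rfl
  rw [this, Real.volume_preimage_mul_right hB, measure_preimage_add, hN, mul_zero]

/-- The inverse of the change of coordinates `z ↦ (diag σ z, (z.1 - σ * z.2) / (2 * γ))`. -/
noncomputable def diagEquiv {σ γ : ℝ} (hσ : σ = 1 ∨ σ = -1) (hγ : γ ≠ 0) :
    (ℝ × ℝ) ≃ₗ[ℝ] (ℝ × ℝ) where
  toFun x := (x.1 / 2 + x.2 * γ, σ * (x.1 / 2 - x.2 * γ))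
  invFun z := (z.1 + σ * z.2, (z.1 - σ * z.2) / (2 * γ))
  map_add' x y := by
    ext <;> simp <;> ring
  map_smul' a x := by
    ext <;> simp <;> ring
  left_inv x := by
    rcases hσ with rfl | rfl <;> ext <;> simp <;> field_simp <;> ring
  right_inv z := by
    rcases hσ with rfl | rfl <;> ext <;> simp <;> field_simp <;> ring

section

variable {Ω : Type*} [MeasurableSpace Ω] {P : Measure Ω} [IsProbabilityMeasure P] {lam : ℝ → ℝ}
  {T : Ω → Set ℝ} {D : ℝ → Ω → ZMod 4}

/-- A single event that reverses one of the diagonal velocities makes the law of the corresponding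
coordinate absolutely continuous. -/
lemma IsDirectionProcess.isACOn_diag (hD : IsDirectionProcess P lam T D) {c : ℝ} (hc : 0 < c)
    (hlam : ContinuousOn lam (Ioi 0)) (hlam_nonneg : ∀ t, 0 < t → 0 ≤ lam t) {r w : ℝ}
    (hr : 0 < r) (hrw : r ≤ w) (σ : ℝ) {k k' : ZMod 4}
    (hk : diag σ (direction k) ≠ diag σ (direction k')) :
    IsACOn P volume (univ ∩ {ω | D r ω = k ∧ count T r w ω = 1 ∧ D w ω = k'})
      fun ω => diag σ (position c D w ω) := by
  refine hD.isACOn_of_count_eq_one c hr hrw (measurable_diag σ) MeasurableSet.univ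
    fun N hN hN0 => ?_
  convert measure_empty (μ := P)
  refine eq_empty_of_forall_notMem fun ω hω => hω.2 ?_
  have hB : c * (diag σ (direction k) - diag σ (direction k')) ≠ 0 :=
    mul_ne_zero hc.ne' (sub_ne_zero.2 hk)
  set A := diag σ (position c D r ω) - c * r * diag σ (direction k) +
    c * w * diag σ (direction k') with hA
  have h0 : P ({ω | count T r w ω = 1} ∩ eventTime T r w ⁻¹' ((fun x : ℝ =>
      A + x * (c * (diag σ (direction k) - diag σ (direction k')))) ⁻¹' N)) = 0 :=
    hD.isACOn_eventTime hlam hlam_nonneg hr hrw _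
    ((measurable_const.add (measurable_id.mul_const _) : Measurable fun x : ℝ =>
      A + x * (c * (diag σ (direction k) - diag σ (direction k')))) hN)
    (volume_preimage_affine hN0 A hB)
  refine measure_mono_null ?_ h0
  refine fun ω' hω' => ⟨hω'.1, ?_⟩
  have h1 : diag σ (position c D r ω + ((c * (eventTime T r w ω' - r)) • direction k +
    (c * (w - eventTime T r w ω')) • direction k')) ∈ N := hω'.2
  rw [diag_add, diag_add, diag_smul, diag_smul] at h1
  have h2 : A + eventTime T r w ω' * (c * (diag σ (direction k) - diag σ (direction k'))) ∈ N := by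
    convert h1 using 1
    rw [hA]
    ring
  exact h2

/-- If one diagonal coordinate has an absolutely continuous law, a single event that reverses the
other diagonal velocity makes the law of the position absolutely continuous. -/
lemma IsDirectionProcess.isACOn_position (hD : IsDirectionProcess P lam T D) {c : ℝ} (hc : 0 < c)
    (hlam : ContinuousOn lam (Ioi 0)) (hlam_nonneg : ∀ t, 0 < t → 0 ≤ lam t) {r w : ℝ}
    (hr : 0 < r) (hrw : r ≤ w) {σ : ℝ} (hσ : σ = 1 ∨ σ = -1) {k k' : ZMod 4}
    (hk : diag σ (direction k) = diag σ (direction k'))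
    (hk' : (direction k).1 ≠ (direction k').1) {F : Set Ω} (hF : MeasurableSet[history T D r] F)
    (hac : IsACOn P volume F fun ω => diag σ (position c D r ω)) :
    IsACOn P volume (F ∩ {ω | D r ω = k ∧ count T r w ω = 1 ∧ D w ω = k'})
      fun ω => id (position c D w ω) := by
  refine hD.isACOn_of_count_eq_one c hr hrw measurable_id hF fun N hN hN0 => ?_
  set γ := c * ((direction k).1 - (direction k').1) with hγdef
  have hγ : γ ≠ 0 := mul_ne_zero hc.ne' (sub_ne_zero.2 hk')
  set ψ := diagEquiv hσ hγ with hψ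
  have hψm : Measurable ψ := by
    have : Continuous fun x : ℝ × ℝ => (x.1 / 2 + x.2 * γ, σ * (x.1 / 2 - x.2 * γ)) := by
      fun_prop
    exact this.measurable
  have hψN : (volume.prod volume : Measure (ℝ × ℝ)) (ψ ⁻¹' N) = 0 := by
    have := Measure.addHaar_preimage_linearMap (volume : Measure (ℝ × ℝ))
      (f := (ψ : (ℝ × ℝ) →ₗ[ℝ] ℝ × ℝ)) ψ.isUnit_det'.ne_zero N
    rw [hN0, mul_zero] at this
    exact this
  -- For almost every value of `diag σ`, the line in the other direction meets `N` in a null set.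
  set A : Set ℝ := {α | volume (Prod.mk α ⁻¹' (ψ ⁻¹' N)) ≠ 0} with hA
  have hAm : MeasurableSet A :=
    ((measurable_measure_prodMk_left (hψm hN)) (measurableSet_singleton 0)).compl
  have hA0 : volume A = 0 := (Measure.measure_prod_null (hψm hN)).1 hψN
  set κ : ℝ × ℝ := (-(c * r)) • direction k + (c * w) • direction k' with hκ
  have h0 : P (F ∩ (fun ω => diag σ (position c D r ω)) ⁻¹' ((fun x => x + diag σ κ) ⁻¹' A)) = 0 :=
    hac ((fun x => x + diag σ κ) ⁻¹' A) ((measurable_add_const _) hAm)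
    (by rwa [measure_preimage_add_right])
  refine measure_mono_null ?_ h0
  refine fun ω hω => ⟨hω.1, fun hsec => ?_⟩
  refine hω.2 ?_
  set y := position c D r ω + κ with hy
  have hsec' : volume (Prod.mk (diag σ y) ⁻¹' (ψ ⁻¹' N)) = 0 := by
    rw [hy, diag_add]
    exact hsec
  set β₀ := (y.1 - diag σ y / 2) / γ with hβ₀
  have h1 : P ({ω | count T r w ω = 1} ∩ eventTime T r w ⁻¹'
      ((fun x => β₀ + x * 1) ⁻¹' (Prod.mk (diag σ y) ⁻¹' (ψ ⁻¹' N)))) = 0 :=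
    hD.isACOn_eventTime hlam hlam_nonneg hr hrw
    ((fun x => β₀ + x * 1) ⁻¹' (Prod.mk (diag σ y) ⁻¹' (ψ ⁻¹' N)))
    ((measurable_const.add (measurable_id.mul_const _) : Measurable fun x : ℝ => β₀ + x * 1)
      (measurable_prodMk_left (hψm hN)))
    (volume_preimage_affine hsec' β₀ one_ne_zero)
  refine measure_mono_null ?_ h1
  refine fun ω' hω' => ⟨hω'.1, ?_⟩
  have h2 : position c D r ω + ((c * (eventTime T r w ω' - r)) • direction k +
    (c * (w - eventTime T r w ω')) • direction k') ∈ N := hω'.2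
  have h3 : ψ (diag σ y, β₀ + eventTime T r w ω' * 1) ∈ N := by
    convert h2 using 1
    have hβγ : β₀ * γ = y.1 - diag σ y / 2 := div_mul_cancel₀ _ hγ
    have hy1 : y.1 = (position c D r ω).1 - c * r * (direction k).1 +
        c * w * (direction k').1 := by
      simp [hy, hκ]
      ring
    have hy2 : y.2 = (position c D r ω).2 - c * r * (direction k).2 +
        c * w * (direction k').2 := by
      simp [hy, hκ]
      ring
    have hd : diag σ y = y.1 + σ * y.2 := rfl
    have hk2 : (direction k).1 + σ * (direction k).2 =
      (direction k').1 + σ * (direction k').2 := hk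
    have hσ2 : σ * σ = 1 := by rcases hσ with rfl | rfl <;> norm_num
    have e1 : (ψ (diag σ y, β₀ + eventTime T r w ω' * 1)).1 =
      diag σ y / 2 + (β₀ + eventTime T r w ω' * 1) * γ := rfl
    have e2 : (ψ (diag σ y, β₀ + eventTime T r w ω' * 1)).2 =
      σ * (diag σ y / 2 - (β₀ + eventTime T r w ω' * 1) * γ) := rfl
    ext
    · rw [e1, mul_one, add_mul, hβγ, hγdef]
      simp only [Prod.fst_add, Prod.smul_fst, smul_eq_mul]
      rw [hy1]
      ring
    · rw [e2, mul_one, add_mul, hβγ, hγdef, hd]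
      simp only [Prod.snd_add, Prod.smul_snd, smul_eq_mul]
      have hk3 : σ * ((direction k).1 - (direction k').1) =
          -((direction k).2 - (direction k').2) := by
        linear_combination σ * hk2 - ((direction k).2 - (direction k').2) * hσ2
      have : σ * ((y.1 + σ * y.2) / 2 - (y.1 - (y.1 + σ * y.2) / 2 +
          eventTime T r w ω' * (c * ((direction k).1 - (direction k').1)))) =
          y.2 + eventTime T r w ω' * c * ((direction k).2 - (direction k').2) := by
        linear_combination y.2 * hσ2 - eventTime T r w ω' * c * hk3
      rw [this, hy2]
      ring
  exact h3

lemma measurableSet_single_event {Ω : Type*} {T : Ω → Set ℝ} {D : ℝ → Ω → ZMod 4} {r w : ℝ}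
    {k k' : ZMod 4} (hr : 0 < r) (hrw : r ≤ w) :
    MeasurableSet[history T D w] {ω | D r ω = k ∧ count T r w ω = 1 ∧ D w ω = k'} := by
  have h1 : MeasurableSet[history T D w] {ω | D r ω = k} :=
    (measurable_direction_history (D := D) ⟨hr, hrw⟩) (measurableSet_singleton k)
  have h2 : MeasurableSet[history T D w] {ω | count T r w ω = 1} :=
    (measurable_count_history (D := D) ⟨hr, hrw⟩ ⟨hrw, le_rfl⟩) (measurableSet_singleton 1)
  have h3 : MeasurableSet[history T D w] {ω | D w ω = k'} :=
    (measurable_direction_history (D := D) ⟨hr.trans_le hrw, le_rfl⟩) (measurableSet_singleton k')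
  exact MeasurableSet.inter h1 (MeasurableSet.inter h2 h3)

/-- On the event that there are two isolated events that reverse the two diagonal velocities, the
law of the position is absolutely continuous. -/
lemma IsDirectionProcess.isACOn_two_events (hD : IsDirectionProcess P lam T D) {c : ℝ}
    (hc : 0 < c) (hlam : ContinuousOn lam (Ioi 0)) (hlam_nonneg : ∀ t, 0 < t → 0 ≤ lam t)
    {r₁ w₁ r₂ w₂ t : ℝ} (h₁ : 0 < r₁) (h₂ : r₁ ≤ w₁) (h₃ : w₁ ≤ r₂) (h₄ : r₂ ≤ w₂) (h₅ : w₂ ≤ t)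
    {σ : ℝ} (hσ : σ = 1 ∨ σ = -1) {k₁ k₁' k₂ k₂' : ZMod 4}
    (hk₁ : diag σ (direction k₁) ≠ diag σ (direction k₁'))
    (hk₂ : diag σ (direction k₂) = diag σ (direction k₂'))
    (hk₂' : (direction k₂).1 ≠ (direction k₂').1) :
    IsACOn P volume ({ω | D r₁ ω = k₁ ∧ count T r₁ w₁ ω = 1 ∧ D w₁ ω = k₁'} ∩
      {ω | D r₂ ω = k₂ ∧ count T r₂ w₂ ω = 1 ∧ D w₂ ω = k₂'}) fun ω => position c D t ω := by
  have hE := measurableSet_single_event (T := T) (D := D) (k := k₁) (k' := k₁') h₁ h₂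
  have hac := hD.isACOn_diag hc hlam hlam_nonneg h₁ h₂ σ hk₁
  rw [univ_inter] at hac
  have hw₁ := h₁.trans_le h₂
  have hr₂ := hw₁.trans_le h₃
  have hac2 := hD.isACOn_of_le c hw₁ h₃ (measurable_diag σ) (diag_add σ) hE hac
  have hE2 := history_mono h₃ _ hE
  have hac3 := hD.isACOn_position hc hlam hlam_nonneg hr₂ h₄ hσ hk₂ hk₂' hE2 hac2
  exact hD.isACOn_of_le c (hr₂.trans_le h₄) h₅ measurable_id (fun _ _ => rfl)
    (MeasurableSet.inter (history_mono h₄ _ hE2) (measurableSet_single_event hr₂ h₄)) hac3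

/-! ### Paths away from the singular lines -/

lemma exists_isolated {T : Set ℝ} (hT : ∀ a b : ℝ, 0 < a → (T ∩ Icc a b).Finite) {s : ℝ}
    (hs : 0 < s) : ∃ δ > 0, δ < s ∧ ∀ x ∈ T, s - δ < x → x < s + δ → x = s := by
  have hfin : ((T ∩ Icc (s / 2) (s + 1)) \ {s}).Finite := (hT _ _ (by positivity)).sdiff
  obtain ⟨ε, hε, hball⟩ := Metric.mem_nhds_iff.1
    (hfin.isClosed.isOpen_compl.mem_nhds fun h => h.2 rfl)
  refine ⟨min ε (min (s / 2) 1), by positivity,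
    (min_le_right _ _).trans_lt ((min_le_left _ _).trans_lt (by linarith)), fun x hx h1 h2 => ?_⟩
  by_contra hne
  have e1 := min_le_left ε (min (s / 2) 1)
  have e2 := (min_le_right ε (min (s / 2) 1)).trans (min_le_left _ _)
  have e3 := (min_le_right ε (min (s / 2) 1)).trans (min_le_right _ _)
  refine hball (a := x) ?_ ⟨⟨hx, by linarith, by linarith⟩, hne⟩
  rw [Metric.mem_ball, Real.dist_eq, abs_lt]
  constructor <;> linarith

/-- If a diagonal coordinate is not on its extreme positions at time `t`, its velocity has been
reversed before. -/
lemma IsRegularPath.exists_flip {T : Set ℝ} {D : ℝ → ZMod 4} (h : IsRegularPath T D) {c : ℝ}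
    {σ : ℝ} (hσ : σ = 1 ∨ σ = -1) {t : ℝ} (ht : 0 < t)
    (hne : |diag σ (displacement c D 0 t)| ≠ |c * t|) :
    ∃ τ ∈ T, τ ∈ Ioo 0 t ∧ ∀ r w, 0 < r → r < τ → τ ≤ w → T ∩ Ioc r w = {τ} →
      diag σ (direction (D r)) ≠ diag σ (direction (D w)) := by
  by_contra! hcon
  set v : ℝ → ℝ := fun s => diag σ (direction (D s)) with hv
  have hloc : ∀ s ∈ Ioo 0 t, ∃ δ > 0, ∀ x, s - δ < x → x < s + δ → v x = v s := by
    intro s hs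
    obtain ⟨δ, hδ, hδs, hiso⟩ := exists_isolated h.finite hs.1
    have hright : ∀ x, s ≤ x → x < s + δ → D x = D s := fun x hx hx' =>
      h.stay s x hs.1 hx (eq_empty_of_forall_notMem fun y hy =>
        hy.2.1.ne' (hiso y hy.1 (by linarith [hy.2.1]) (hy.2.2.trans_lt hx')))
    by_cases hsT : s ∈ T
    · obtain ⟨r, w, hr, hrs, hsw, hrw, heq⟩ := hcon s hsT hs
      have hws : D w = D s := h.stay s w hs.1 hsw (eq_empty_of_forall_notMem fun y hy => by
        have : y ∈ T ∩ Ioc r w := ⟨hy.1, hrs.trans hy.2.1, hy.2.2⟩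
        rw [hrw, mem_singleton_iff] at this
        exact hy.2.1.ne' this)
      refine ⟨min δ (s - r), lt_min hδ (sub_pos.2 hrs), fun x hx hx' => ?_⟩
      rcases le_or_gt s x with hsx | hxs
      · simp only [hv, hright x hsx (hx'.trans_le (by gcongr; exact min_le_left _ _))]
      · have hrx : r < x := by linarith [min_le_right δ (s - r)]
        have : D x = D r := h.stay r x hr hrx.le (eq_empty_of_forall_notMem fun y hy => by
          have hy' : y ∈ T ∩ Ioc r w := ⟨hy.1, hy.2.1, hy.2.2.trans (hxs.le.trans hsw)⟩
          rw [hrw, mem_singleton_iff] at hy'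
          exact absurd hy.2.2 (not_le.2 (hy' ▸ hxs)))
        simp only [hv, this, heq, hws]
    · refine ⟨δ, hδ, fun x hx hx' => ?_⟩
      rcases le_or_gt s x with hsx | hxs
      · simp only [hv, hright x hsx hx']
      · have : D s = D x := h.stay x s (by linarith) hxs.le
          (eq_empty_of_forall_notMem fun y hy => hsT
            (hiso y hy.1 (hx.trans hy.2.1) (by linarith [hy.2.2]) ▸ hy.1))
        simp only [hv, this]
  have hcont : ContinuousOn v (Ioo 0 t) := by
    refine continuousOn_of_forall_continuousAt fun s hs => ?_
    obtain ⟨δ, hδ, hδ'⟩ := hloc s hs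
    refine (continuousAt_const (y := v s)).congr ?_
    filter_upwards [Ioo_mem_nhds (by linarith : s - δ < s) (by linarith : s < s + δ)] with x hx
    exact (hδ' x hx.1 hx.2).symm
  have hconst : ∀ s ∈ Ioo 0 t, v s = v (t / 2) := by
    intro s hs
    refine isPreconnected_Ioo.constant_of_mapsTo (T := {1, -1})
      (Set.toFinite ({1, -1} : Set ℝ)).isDiscrete hcont
      (fun x _ => diag_direction hσ (D x)) hs ⟨by linarith, by linarith⟩
  have hint : diag σ (displacement c D 0 t) = c * t * v (t / 2) := by
    have i1 := h.intervalIntegrable abs_direction_fst_le le_rfl ht.le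
    have i2 := h.intervalIntegrable abs_direction_snd_le le_rfl ht.le
    have : ∫ s in (0 : ℝ)..t, v s = t * v (t / 2) := by
      rw [intervalIntegral.integral_of_le ht.le, integral_Ioc_eq_integral_Ioo,
        setIntegral_congr_fun measurableSet_Ioo hconst]
      simp [ht.le]
    have hsum : ∫ s in (0 : ℝ)..t, v s = (∫ s in (0 : ℝ)..t, (direction (D s)).1) +
        σ * ∫ s in (0 : ℝ)..t, (direction (D s)).2 := by
      rw [← intervalIntegral.integral_const_mul, ← intervalIntegral.integral_add i1
        (i2.const_mul σ)]
      rfl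
    simp only [diag, displacement]
    rw [mul_assoc, ← this, hsum]
    ring
  refine hne ?_
  rw [hint, abs_mul]
  rcases diag_direction hσ (D (t / 2)) with h1 | h1 <;> simp [hv, h1]

end

/-- An event has rational times around it with no other event in between; rational end points make
the later union over all configurations countable. -/
lemma exists_rat_isolating {T : Set ℝ} (hT : ∀ a b : ℝ, 0 < a → (T ∩ Icc a b).Finite)
    {α τ β : ℝ} (hα : 0 ≤ α) (hτ : τ ∈ T) (h₁ : α < τ) (h₂ : τ < β) :
    ∃ r w : ℚ, α < r ∧ (r : ℝ) < τ ∧ τ < w ∧ (w : ℝ) < β ∧ T ∩ Ioc (r : ℝ) w = {τ} := by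
  obtain ⟨δ, hδ, -, hiso⟩ := exists_isolated hT (hα.trans_lt h₁)
  obtain ⟨r, hr₁, hr₂⟩ := exists_rat_btwn (max_lt h₁ (by linarith : τ - δ < τ))
  obtain ⟨w, hw₁, hw₂⟩ := exists_rat_btwn (lt_min h₂ (by linarith : τ < τ + δ))
  refine ⟨r, w, (le_max_left _ _).trans_lt hr₁, hr₂, hw₁, hw₂.trans_le (min_le_left _ _),
    Subset.antisymm (fun x hx => ?_) ?_⟩
  · exact hiso x hx.1 ((le_max_right _ _).trans_lt (hr₁.trans hx.2.1))
      (hx.2.2.trans_lt (hw₂.trans_le (min_le_right _ _)))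
  · rintro x rfl
    exact ⟨hτ, hr₂, hw₁.le⟩

/-- The data of two consecutive rational intervals, of a diagonal coordinate, and of directions at
the ends of the intervals such that the coordinate is reversed in the first interval and the other
one in the second interval. -/
structure IsDoubleFlip (t : ℝ) (r₁ w₁ r₂ w₂ : ℚ) (σ : ℝ) (k₁ k₁' k₂ k₂' : ZMod 4) : Prop where
  pos : (0 : ℝ) < r₁
  le₁ : (r₁ : ℝ) ≤ w₁
  le₂ : (w₁ : ℝ) ≤ r₂
  le₃ : (r₂ : ℝ) ≤ w₂
  le₄ : (w₂ : ℝ) ≤ t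
  sign : σ = 1 ∨ σ = -1
  flip : diag σ (direction k₁) ≠ diag σ (direction k₁')
  keep : diag σ (direction k₂) = diag σ (direction k₂')
  turn : (direction k₂).1 ≠ (direction k₂').1

lemma IsRegularPath.exists_doubleFlip_of_lt {T : Set ℝ} {D : ℝ → ZMod 4} (h : IsRegularPath T D)
    {σ : ℝ} (hσ : σ = 1 ∨ σ = -1) {t τ₁ τ₂ : ℝ} (hτ₁ : τ₁ ∈ T) (hτ₂ : τ₂ ∈ T) (h₁ : 0 < τ₁)
    (h₁₂ : τ₁ < τ₂) (h₂ : τ₂ < t)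
    (hf₁ : ∀ r w, 0 < r → r < τ₁ → τ₁ ≤ w → T ∩ Ioc r w = {τ₁} →
      diag σ (direction (D r)) ≠ diag σ (direction (D w)))
    (hf₂ : ∀ r w, 0 < r → r < τ₂ → τ₂ ≤ w → T ∩ Ioc r w = {τ₂} →
      diag (-σ) (direction (D r)) ≠ diag (-σ) (direction (D w))) :
    ∃ r₁ w₁ r₂ w₂ : ℚ, IsDoubleFlip t r₁ w₁ r₂ w₂ σ (D r₁) (D w₁) (D r₂) (D w₂) ∧
      (T ∩ Ioc (r₁ : ℝ) w₁).ncard = 1 ∧ (T ∩ Ioc (r₂ : ℝ) w₂).ncard = 1 := by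
  obtain ⟨r₁, w₁, a₁, a₂, a₃, a₄, a₅⟩ := exists_rat_isolating h.finite le_rfl hτ₁ h₁ h₁₂
  have hw₁ : (0 : ℝ) < w₁ := h₁.trans a₃
  obtain ⟨r₂, w₂, b₁, b₂, b₃, b₄, b₅⟩ := exists_rat_isolating h.finite hw₁.le hτ₂ a₄ h₂
  have hr₂ : (0 : ℝ) < r₂ := hw₁.trans b₁
  have hσ' : -σ = 1 ∨ -σ = -1 := by
    rcases hσ with rfl | rfl <;> simp
  have hturn := h.turn r₂ w₂ hr₂ (b₂.trans b₃).le (by rw [b₅, ncard_singleton])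
  have hflip := turn_changes_one_diag hσ' hturn
  rw [neg_neg] at hflip
  exact ⟨r₁, w₁, r₂, w₂, ⟨a₁, (a₂.trans a₃).le, b₁.le, (b₂.trans b₃).le, b₄.le, hσ,
    hf₁ r₁ w₁ a₁ a₂ a₃.le a₅, hflip.2 (hf₂ r₂ w₂ hr₂ b₂ b₃.le b₅), hflip.1⟩,
    by rw [a₅, ncard_singleton], by rw [b₅, ncard_singleton]⟩

/-- A path that ends in the regular region has two isolated turns that reverse the two diagonal
velocities, one each. -/
lemma IsRegularPath.exists_doubleFlip {T : Set ℝ} {D : ℝ → ZMod 4} (h : IsRegularPath T D) {c : ℝ}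
    {t : ℝ} (ht : 0 < t) (h₁ : |diag 1 (displacement c D 0 t)| ≠ |c * t|)
    (h₂ : |diag (-1) (displacement c D 0 t)| ≠ |c * t|) :
    ∃ (σ : ℝ) (r₁ w₁ r₂ w₂ : ℚ), IsDoubleFlip t r₁ w₁ r₂ w₂ σ (D r₁) (D w₁) (D r₂) (D w₂) ∧
      (T ∩ Ioc (r₁ : ℝ) w₁).ncard = 1 ∧ (T ∩ Ioc (r₂ : ℝ) w₂).ncard = 1 := by
  obtain ⟨τ₁, hτ₁, m₁, f₁⟩ := h.exists_flip (Or.inl rfl) ht h₁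
  obtain ⟨τ₂, hτ₂, m₂, f₂⟩ := h.exists_flip (Or.inr rfl) ht h₂
  rcases lt_trichotomy τ₁ τ₂ with hlt | rfl | hlt
  · exact ⟨1, h.exists_doubleFlip_of_lt (Or.inl rfl) hτ₁ hτ₂ m₁.1 hlt m₂.2 f₁ f₂⟩
  · -- A single turn does not reverse both diagonal velocities.
    obtain ⟨r, w, a₁, a₂, a₃, a₄, a₅⟩ := exists_rat_isolating h.finite le_rfl hτ₁ m₁.1 m₁.2
    have hturn := h.turn r w a₁ (a₂.trans a₃).le (by rw [a₅, ncard_singleton])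
    exact absurd ((turn_changes_one_diag (Or.inl rfl) hturn).2 (f₁ r w a₁ a₂ a₃.le a₅))
      (f₂ r w a₁ a₂ a₃.le a₅)
  · refine ⟨-1, h.exists_doubleFlip_of_lt (Or.inr rfl) hτ₂ hτ₁ m₂.1 hlt m₁.2 f₂ ?_⟩
    rwa [neg_neg]

section

variable {Ω : Type*} [MeasurableSpace Ω] {P : Measure Ω} [IsProbabilityMeasure P] {lam : ℝ → ℝ}
  {T : Ω → Set ℝ} {D : ℝ → Ω → ZMod 4}

/-- The points of the plane where neither diagonal coordinate is extreme at time `t`. -/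
def regularRegion (c t : ℝ) : Set (ℝ × ℝ) :=
  {z | |diag 1 z| ≠ |c * t| ∧ |diag (-1) z| ≠ |c * t|}

/-- The law of the position at time `t` is absolutely continuous on `regularRegion c t`. -/
lemma IsDirectionProcess.measure_position_eq_zero (hD : IsDirectionProcess P lam T D) {c : ℝ}
    (hc : 0 < c) (hlam : ContinuousOn lam (Ioi 0)) (hlam_nonneg : ∀ t, 0 < t → 0 ≤ lam t) {t : ℝ}
    (ht : 0 < t) {N : Set (ℝ × ℝ)} (hN : MeasurableSet N) (hN0 : volume N = 0) :
    P {ω | position c D t ω ∈ N ∩ regularRegion c t} = 0 := by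
  have hreg : P {ω | ¬IsRegularPath (T ω) fun s => D s ω} = 0 := hD.ae_regular
  have hnull : ∀ (s : Bool) (r₁ w₁ r₂ w₂ : ℚ) (k₁ k₁' k₂ k₂' : ZMod 4),
      P {ω | IsDoubleFlip t r₁ w₁ r₂ w₂ (if s then 1 else -1) k₁ k₁' k₂ k₂' ∧
        ω ∈ ({ω | D r₁ ω = k₁ ∧ count T r₁ w₁ ω = 1 ∧ D w₁ ω = k₁'} ∩
          {ω | D r₂ ω = k₂ ∧ count T r₂ w₂ ω = 1 ∧ D w₂ ω = k₂'}) ∩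
          (fun ω => position c D t ω) ⁻¹' N} = 0 := by
    intro s r₁ w₁ r₂ w₂ k₁ k₁' k₂ k₂'
    by_cases hd : IsDoubleFlip t r₁ w₁ r₂ w₂ (if s then 1 else -1) k₁ k₁' k₂ k₂'
    · refine measure_mono_null ?_ (hD.isACOn_two_events hc hlam hlam_nonneg hd.pos hd.le₁ hd.le₂
        hd.le₃ hd.le₄ hd.sign hd.flip hd.keep hd.turn N hN hN0)
      exact fun ω hω => hω.2
    · simp [hd]
  have hall := measure_iUnion_null fun s => measure_iUnion_null fun r₁ => measure_iUnion_null
    fun w₁ => measure_iUnion_null fun r₂ => measure_iUnion_null fun w₂ => measure_iUnion_null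
    fun k₁ => measure_iUnion_null fun k₁' => measure_iUnion_null fun k₂ => measure_iUnion_null
    fun k₂' => hnull s r₁ w₁ r₂ w₂ k₁ k₁' k₂ k₂'
  refine measure_mono_null (fun ω hω => ?_) (measure_union_null hall hreg)
  by_cases hr : IsRegularPath (T ω) fun s => D s ω
  · left
    obtain ⟨hωN, h₁, h₂⟩ := hω
    obtain ⟨σ, r₁, w₁, r₂, w₂, hd, n₁, n₂⟩ := hr.exists_doubleFlip ht h₁ h₂
    simp only [mem_iUnion]
    obtain ⟨s, hs⟩ : ∃ s : Bool, σ = if s then 1 else -1 := by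
      rcases hd.sign with h | h
      · exact ⟨true, by simp [h]⟩
      · exact ⟨false, by simp [h]⟩
    exact ⟨s, r₁, w₁, r₂, w₂, D r₁ ω, D w₁ ω, D r₂ ω, D w₂ ω, hs ▸ hd,
      ⟨⟨rfl, n₁, rfl⟩, rfl, n₂, rfl⟩, hωN⟩
  · exact Or.inr hr

end

/-! ### Functions of class `C^n` of three variables -/

/-- The function `f` of two space variables and time is of class `C^n` on `W`. -/
def IsSmoothOn (n : WithTop ℕ∞) (f : ℝ → ℝ → ℝ → ℝ) (W : Set (ℝ × ℝ × ℝ)) : Prop :=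
  ContDiffOn ℝ n (fun z : ℝ × ℝ × ℝ => f z.1 z.2.1 z.2.2) W

section

variable {n m : WithTop ℕ∞} {f g : ℝ → ℝ → ℝ → ℝ} {W : Set (ℝ × ℝ × ℝ)}

lemma IsSmoothOn.hasDerivAt_line (h : IsSmoothOn n f W) (hW : IsOpen W) (hn : n ≠ 0)
    {γ : ℝ → ℝ × ℝ × ℝ} {v : ℝ × ℝ × ℝ} {s : ℝ} (hγ : HasDerivAt γ v s) (hs : γ s ∈ W) :
    HasDerivAt (fun r => f (γ r).1 (γ r).2.1 (γ r).2.2)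
      (fderiv ℝ (fun z : ℝ × ℝ × ℝ => f z.1 z.2.1 z.2.2) (γ s) v) s :=
  (((h.differentiableOn hn).differentiableAt (hW.mem_nhds hs)).hasFDerivAt).comp_hasDerivAt s hγ

lemma IsSmoothOn.hasDerivAt_dX (h : IsSmoothOn n f W) (hW : IsOpen W) (hn : n ≠ 0) {x y t : ℝ}
    (hz : (x, y, t) ∈ W) : HasDerivAt (fun x' => f x' y t) (dX f x y t) x :=
  (h.hasDerivAt_line hW hn (γ := fun x' => (x', y, t))
    ((hasDerivAt_id x).prodMk (hasDerivAt_const x (y, t))) hz).differentiableAt.hasDerivAt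

lemma IsSmoothOn.hasDerivAt_dY (h : IsSmoothOn n f W) (hW : IsOpen W) (hn : n ≠ 0) {x y t : ℝ}
    (hz : (x, y, t) ∈ W) : HasDerivAt (fun y' => f x y' t) (dY f x y t) y :=
  (h.hasDerivAt_line hW hn (γ := fun y' => (x, y', t)) ((hasDerivAt_const y x).prodMk
    ((hasDerivAt_id y).prodMk (hasDerivAt_const y t))) hz).differentiableAt.hasDerivAt

lemma IsSmoothOn.hasDerivAt_dT (h : IsSmoothOn n f W) (hW : IsOpen W) (hn : n ≠ 0) {x y t : ℝ}
    (hz : (x, y, t) ∈ W) : HasDerivAt (fun t' => f x y t') (dT f x y t) t :=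
  (h.hasDerivAt_line hW hn (γ := fun t' => (x, y, t')) ((hasDerivAt_const t x).prodMk
    ((hasDerivAt_const t y).prodMk (hasDerivAt_id t))) hz).differentiableAt.hasDerivAt

lemma IsSmoothOn.fderiv_apply (h : IsSmoothOn n f W) (hW : IsOpen W) (hmn : m + 1 ≤ n)
    (v : ℝ × ℝ × ℝ) :
    ContDiffOn ℝ m (fun z => fderiv ℝ (fun z : ℝ × ℝ × ℝ => f z.1 z.2.1 z.2.2) z v) W :=
  (ContDiffOn.fderiv_of_isOpen h hW hmn).clm_apply contDiffOn_const

lemma ne_zero_of_add_one_le (hmn : m + 1 ≤ n) : n ≠ 0 := by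
  rintro rfl
  have : m + 1 = 0 := le_antisymm hmn (by positivity)
  simp at this

lemma IsSmoothOn.isSmoothOn_dX (h : IsSmoothOn n f W) (hW : IsOpen W) (hmn : m + 1 ≤ n) :
    IsSmoothOn m (dX f) W :=
  (h.fderiv_apply hW hmn (1, 0, 0)).congr fun z hz =>
    (h.hasDerivAt_line hW (ne_zero_of_add_one_le hmn) (γ := fun x' => (x', z.2.1, z.2.2))
      ((hasDerivAt_id z.1).prodMk (hasDerivAt_const z.1 (z.2.1, z.2.2))) hz).deriv

lemma IsSmoothOn.isSmoothOn_dY (h : IsSmoothOn n f W) (hW : IsOpen W) (hmn : m + 1 ≤ n) :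
    IsSmoothOn m (dY f) W :=
  (h.fderiv_apply hW hmn (0, 1, 0)).congr fun z hz =>
    (h.hasDerivAt_line hW (ne_zero_of_add_one_le hmn) (γ := fun y' => (z.1, y', z.2.2))
      ((hasDerivAt_const z.2.1 z.1).prodMk
        ((hasDerivAt_id z.2.1).prodMk (hasDerivAt_const z.2.1 z.2.2))) hz).deriv

lemma IsSmoothOn.isSmoothOn_dT (h : IsSmoothOn n f W) (hW : IsOpen W) (hmn : m + 1 ≤ n) :
    IsSmoothOn m (dT f) W :=
  (h.fderiv_apply hW hmn (0, 0, 1)).congr fun z hz =>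
    (h.hasDerivAt_line hW (ne_zero_of_add_one_le hmn) (γ := fun t' => (z.1, z.2.1, t'))
      ((hasDerivAt_const z.2.2 z.1).prodMk
        ((hasDerivAt_const z.2.2 z.2.1).prodMk (hasDerivAt_id z.2.2))) hz).deriv

lemma IsSmoothOn.continuousOn_slice (h : IsSmoothOn n f W) (t : ℝ) :
    ContinuousOn (fun z : ℝ × ℝ => f z.1 z.2 t) {z | (z.1, z.2, t) ∈ W} :=
  ContDiffOn.continuousOn h |>.comp (f := fun z : ℝ × ℝ => (z.1, z.2, t))
    (by fun_prop) fun z hz => hz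

end

/-! ### Pairing with test functions -/

/-- The integral of `f (·, ·, t)` against the function `φ`. -/
noncomputable def pairing (f : ℝ → ℝ → ℝ → ℝ) (φ : ℝ × ℝ → ℝ) (t : ℝ) : ℝ :=
  ∫ z : ℝ × ℝ, f z.1 z.2 t * φ z

section

variable {n : WithTop ℕ∞} {f : ℝ → ℝ → ℝ → ℝ} {W : Set (ℝ × ℝ × ℝ)} {φ : ℝ × ℝ → ℝ}

lemma isOpen_slice (hW : IsOpen W) (t : ℝ) : IsOpen {z : ℝ × ℝ | (z.1, z.2, t) ∈ W} :=
  hW.preimage (f := fun z : ℝ × ℝ => (z.1, z.2, t)) (by fun_prop)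

lemma continuous_mul_of_tsupport {g : ℝ × ℝ → ℝ} {U : Set (ℝ × ℝ)} (hU : IsOpen U)
    (hg : ContinuousOn g U) (hφ : Continuous φ) (h : tsupport φ ⊆ U) :
    Continuous fun z => g z * φ z :=
  (hg.mul hφ.continuousOn).continuous_of_tsupport_subset hU
    ((tsupport_mul_subset_right (f := g) (g := φ)).trans h)

lemma IsSmoothOn.continuous_mul (hf : IsSmoothOn n f W) (hW : IsOpen W) (hφ : IsTest φ) {t : ℝ}
    (h : ∀ z ∈ tsupport φ, (z.1, z.2, t) ∈ W) :
    Continuous fun z : ℝ × ℝ => f z.1 z.2 t * φ z :=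
  continuous_mul_of_tsupport (isOpen_slice hW t) (hf.continuousOn_slice t) hφ.contDiff.continuous h

lemma IsSmoothOn.integrable_mul (hf : IsSmoothOn n f W) (hW : IsOpen W) (hφ : IsTest φ) {t : ℝ}
    (h : ∀ z ∈ tsupport φ, (z.1, z.2, t) ∈ W) :
    Integrable fun z : ℝ × ℝ => f z.1 z.2 t * φ z :=
  (hf.continuous_mul hW hφ h).integrable_of_hasCompactSupport hφ.compact.mul_left

lemma tsupport_dirDeriv_subset (v : ℝ × ℝ) (φ : ℝ × ℝ → ℝ) :
    tsupport (dirDeriv v φ) ⊆ tsupport φ :=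
  tsupport_fderiv_apply_subset ℝ v

/-- Integration by parts in the first coordinate. -/
lemma IsSmoothOn.pairing_dX (hf : IsSmoothOn n f W) (hW : IsOpen W) (hn : 1 ≤ n)
    (hφ : IsTest φ) {t : ℝ} (h : ∀ z ∈ tsupport φ, (z.1, z.2, t) ∈ W) :
    pairing (dX f) φ t = -pairing f (partialX φ) t := by
  have hn' : n ≠ 0 := ne_zero_of_add_one_le (m := 0) (by simpa using hn)
  have hdf : IsSmoothOn 0 (dX f) W := hf.isSmoothOn_dX hW (by simpa using hn)
  have h' : ∀ z ∈ tsupport (partialX φ), (z.1, z.2, t) ∈ W := fun z hz =>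
    h z (tsupport_dirDeriv_subset _ _ hz)
  have key := integral_bilinear_hasLineDerivAt_right_eq_neg_left_of_integrable
    (μ := (volume : Measure (ℝ × ℝ))) (f := fun z : ℝ × ℝ => f z.1 z.2 t)
    (f' := fun z : ℝ × ℝ => dX f z.1 z.2 t) (g := φ) (g' := partialX φ) (v := (1, 0))
    (B := ContinuousLinearMap.mul ℝ ℝ) (hdf.integrable_mul hW hφ h)
    (hf.integrable_mul hW hφ.partialX h') (hf.integrable_mul hW hφ h)
    (fun z hz => by
      have := HasDerivAt.comp_const_add z.1 0 (f := fun x' => f x' z.2 t)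
        (f' := dX f z.1 z.2 t) (by simpa using hf.hasDerivAt_dX hW hn' (h z hz))
      simpa [HasLineDerivAt] using this)
    (fun z _ => (hφ.differentiable z).hasFDerivAt.hasLineDerivAt _)
  simp only [ContinuousLinearMap.mul_apply'] at key
  rw [pairing, pairing, key, neg_neg]

/-- Integration by parts in the second coordinate. -/
lemma IsSmoothOn.pairing_dY (hf : IsSmoothOn n f W) (hW : IsOpen W) (hn : 1 ≤ n)
    (hφ : IsTest φ) {t : ℝ} (h : ∀ z ∈ tsupport φ, (z.1, z.2, t) ∈ W) :
    pairing (dY f) φ t = -pairing f (partialY φ) t := by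
  have hn' : n ≠ 0 := ne_zero_of_add_one_le (m := 0) (by simpa using hn)
  have hdf : IsSmoothOn 0 (dY f) W := hf.isSmoothOn_dY hW (by simpa using hn)
  have h' : ∀ z ∈ tsupport (partialY φ), (z.1, z.2, t) ∈ W := fun z hz =>
    h z (tsupport_dirDeriv_subset _ _ hz)
  have key := integral_bilinear_hasLineDerivAt_right_eq_neg_left_of_integrable
    (μ := (volume : Measure (ℝ × ℝ))) (f := fun z : ℝ × ℝ => f z.1 z.2 t)
    (f' := fun z : ℝ × ℝ => dY f z.1 z.2 t) (g := φ) (g' := partialY φ) (v := (0, 1))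
    (B := ContinuousLinearMap.mul ℝ ℝ) (hdf.integrable_mul hW hφ h)
    (hf.integrable_mul hW hφ.partialY h') (hf.integrable_mul hW hφ h)
    (fun z hz => by
      have := HasDerivAt.comp_const_add z.2 0 (f := fun y' => f z.1 y' t)
        (f' := dY f z.1 z.2 t) (by simpa using hf.hasDerivAt_dY hW hn' (h z hz))
      simpa [HasLineDerivAt] using this)
    (fun z _ => (hφ.differentiable z).hasFDerivAt.hasLineDerivAt _)
  simp only [ContinuousLinearMap.mul_apply'] at key
  rw [pairing, pairing, key, neg_neg]

lemma IsSmoothOn.pairing_dX_dX (hf : IsSmoothOn n f W) (hW : IsOpen W) (hn : 2 ≤ n)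
    (hφ : IsTest φ) {t : ℝ} (h : ∀ z ∈ tsupport φ, (z.1, z.2, t) ∈ W) :
    pairing (dX (dX f)) φ t = pairing f (partialX (partialX φ)) t := by
  have h1 : IsSmoothOn 1 (dX f) W := hf.isSmoothOn_dX hW (le_trans (by norm_num) hn)
  rw [h1.pairing_dX hW le_rfl hφ h, hf.pairing_dX hW (le_trans (by norm_num) hn) hφ.partialX
    fun z hz => h z (tsupport_dirDeriv_subset _ _ hz), neg_neg]

lemma IsSmoothOn.pairing_dY_dY (hf : IsSmoothOn n f W) (hW : IsOpen W) (hn : 2 ≤ n)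
    (hφ : IsTest φ) {t : ℝ} (h : ∀ z ∈ tsupport φ, (z.1, z.2, t) ∈ W) :
    pairing (dY (dY f)) φ t = pairing f (partialY (partialY φ)) t := by
  have h1 : IsSmoothOn 1 (dY f) W := hf.isSmoothOn_dY hW (le_trans (by norm_num) hn)
  rw [h1.pairing_dY hW le_rfl hφ h, hf.pairing_dY hW (le_trans (by norm_num) hn) hφ.partialY
    fun z hz => h z (tsupport_dirDeriv_subset _ _ hz), neg_neg]

/-- Differentiation under the integral; the support of the test function makes it legitimate. -/
lemma IsSmoothOn.hasDerivAt_pairing (hf : IsSmoothOn n f W) (hW : IsOpen W) (hn : 1 ≤ n)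
    (hφ : IsTest φ) {I : Set ℝ} (hI : IsOpen I)
    (h : ∀ t ∈ I, ∀ z ∈ tsupport φ, (z.1, z.2, t) ∈ W) {t : ℝ} (ht : t ∈ I) :
    HasDerivAt (pairing f φ) (pairing (dT f) φ t) t := by
  have hn' : n ≠ 0 := ne_zero_of_add_one_le (m := 0) (by simpa using hn)
  have hdf : IsSmoothOn 0 (dT f) W := hf.isSmoothOn_dT hW (by simpa using hn)
  obtain ⟨ε, hε, hεI⟩ := Metric.nhds_basis_closedBall.mem_iff.1 (hI.mem_nhds ht)
  have hcont : ContinuousOn (fun w : (ℝ × ℝ) × ℝ => dT f w.1.1 w.1.2 w.2)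
      (tsupport φ ×ˢ Metric.closedBall t ε) :=
    (ContDiffOn.continuousOn hdf).comp (f := fun w : (ℝ × ℝ) × ℝ => (w.1.1, w.1.2, w.2))
      (by fun_prop) fun w hw => h w.2 (hεI hw.2) w.1 hw.1
  obtain ⟨C, hC⟩ := (hφ.compact.prod (isCompact_closedBall t ε)).exists_bound_of_continuousOn hcont
  refine (hasDerivAt_integral_of_dominated_loc_of_deriv_le (μ := (volume : Measure (ℝ × ℝ)))
    (F := fun s z => f z.1 z.2 s * φ z) (F' := fun s z => dT f z.1 z.2 s * φ z)
    (bound := fun z => C * ‖φ z‖) (Metric.closedBall_mem_nhds t hε) ?_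
    (hf.integrable_mul hW hφ (h t ht)) (hdf.integrable_mul hW hφ (h t ht)).1 ?_ ?_ ?_).2
  · filter_upwards [hI.mem_nhds ht] with s hs using (hf.integrable_mul hW hφ (h s hs)).1
  · refine ae_of_all _ fun z s hs => ?_
    by_cases hz : z ∈ tsupport φ
    · rw [norm_mul]
      exact mul_le_mul_of_nonneg_right (hC (z, s) ⟨hz, hs⟩) (norm_nonneg _)
    · simp [image_eq_zero_of_notMem_tsupport hz]
  · exact (hφ.contDiff.continuous.integrable_of_hasCompactSupport hφ.compact).norm.const_mul C
  · refine ae_of_all _ fun z s hs => ?_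
    by_cases hz : z ∈ tsupport φ
    · exact (hf.hasDerivAt_dT hW hn' (h s (hεI hs) z hz)).mul_const _
    · simpa [image_eq_zero_of_notMem_tsupport hz] using hasDerivAt_const s (0 : ℝ)

end

/-! ### The density as a weak solution -/

lemma isOpen_setOf_regularRegion (c : ℝ) :
    IsOpen {w : ℝ × ℝ × ℝ | (w.1, w.2.1) ∈ regularRegion c w.2.2} := by
  have h : ∀ σ : ℝ, IsOpen {w : ℝ × ℝ × ℝ | |diag σ (w.1, w.2.1)| ≠ |c * w.2.2|} := fun σ =>
    isOpen_ne_fun (by unfold diag; fun_prop) (by fun_prop)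
  exact (h 1).inter (h (-1))

lemma measurableSet_regularRegion (c t : ℝ) : MeasurableSet (regularRegion c t) :=
  (isOpen_slice (isOpen_setOf_regularRegion c) t).measurableSet

section

variable {Ω : Type*} [MeasurableSpace Ω] {P : Measure Ω} [IsProbabilityMeasure P] {lam : ℝ → ℝ}
  {T : Ω → Set ℝ} {D : ℝ → Ω → ZMod 4} {c : ℝ} {p : ℝ → ℝ → ℝ → ℝ}

/-- Functions supported in the region where the law is absolutely continuous do not see the
singular component, so that their mean is their integral against the density `p`. -/
lemma IsDirectionProcess.pairing_eq_integral (hD : IsDirectionProcess P lam T D) (hc : 0 < c)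
    (hlam : ContinuousOn lam (Ioi 0)) (hlam_nonneg : ∀ t, 0 < t → 0 ≤ lam t)
    (hp : IsACComponent P c D p) {φ : ℝ × ℝ → ℝ} (hφ : Measurable φ) {t : ℝ} (ht : 0 < t)
    (h : ∀ z, φ z ≠ 0 → z ∈ regularRegion c t) :
    pairing p φ t = ∫ ω, φ (position c D t ω) ∂P := by
  have hpos := hD.aemeasurable_position c ht.le
  have hR := measurableSet_regularRegion c t
  set μ := P.map (position c D t) with hμ
  have hfin : IsProbabilityMeasure μ := Measure.isProbabilityMeasure_map hpos
  have hac : μ.restrict (regularRegion c t) ≪ volume := by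
    refine Measure.AbsolutelyContinuous.mk fun N hN hN0 => ?_
    rw [Measure.restrict_apply hN, hμ, Measure.map_apply_of_aemeasurable hpos (hN.inter hR)]
    exact hD.measure_position_eq_zero hc hlam hlam_nonneg ht hN hN0
  have hind : (regularRegion c t).indicator φ = φ := indicator_eq_self.2 fun z hz => h z hz
  calc pairing p φ t
      = ∫ z, ((μ.restrict (regularRegion c t)).rnDeriv volume z).toReal * φ z := by
        refine integral_congr_ae ?_
        filter_upwards [hp t ht, Measure.rnDeriv_restrict μ volume hR] with z h1 h2
        by_cases hz : z ∈ regularRegion c t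
        · rw [h1, h2, indicator_of_mem hz]
        · simp [not_imp_comm.1 (h z) hz]
    _ = ∫ z in regularRegion c t, φ z ∂μ := integral_toReal_rnDeriv_mul hac
    _ = ∫ z, φ z ∂μ := by rw [← integral_indicator hR, hind]
    _ = ∫ ω, φ (position c D t ω) ∂P := integral_map hpos hφ.aestronglyMeasurable

end

lemma eqOn_of_hasDerivAt {F G F' G' : ℝ → ℝ} {I : Set ℝ} (hI : IsOpen I) (h : EqOn F G I)
    (hF : ∀ t ∈ I, HasDerivAt F (F' t) t) (hG : ∀ t ∈ I, HasDerivAt G (G' t) t) : EqOn F' G' I :=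
  fun t ht => (hF t ht).unique
    ((hG t ht).congr_of_eventuallyEq (h.eventuallyEq_of_mem (hI.mem_nhds ht)))

/-- The difference of the two sides of the fourth-order equation. -/
noncomputable def residual (c : ℝ) (lam : ℝ → ℝ) (p : ℝ → ℝ → ℝ → ℝ) : ℝ → ℝ → ℝ → ℝ :=
  fun x y t => dampingOp lam (telegraphOp c lam p) x y t + c ^ 4 * dX (dX (dY (dY p))) x y t -
    (deriv lam t * dT (dT p) x y t + (deriv (deriv lam) t + lam t * deriv lam t) * dT p x y t)

section

variable {c : ℝ} {lam : ℝ → ℝ} {p : ℝ → ℝ → ℝ → ℝ} {W : Set (ℝ × ℝ × ℝ)}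

lemma contDiffOn_comp_time {n : WithTop ℕ∞} {a : ℝ → ℝ} (ha : ContDiffOn ℝ n a (Ioi 0))
    (hW0 : ∀ w ∈ W, 0 < w.2.2) : ContDiffOn ℝ n (fun w : ℝ × ℝ × ℝ => a w.2.2) W :=
  ha.comp (g := a) (f := fun w : ℝ × ℝ × ℝ => w.2.2) (by fun_prop) fun w hw => hW0 w hw

lemma IsSmoothOn.isSmoothOn_telegraphOp (hp : IsSmoothOn 4 p W) (hW : IsOpen W)
    (hW0 : ∀ w ∈ W, 0 < w.2.2) (hlam : ContDiffOn ℝ 2 lam (Ioi 0)) :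
    IsSmoothOn 2 (telegraphOp c lam p) W := by
  have ht : IsSmoothOn 3 (dT p) W := hp.isSmoothOn_dT hW (by norm_num)
  have htt : IsSmoothOn 2 (dT (dT p)) W := ht.isSmoothOn_dT hW (by norm_num)
  have hx : IsSmoothOn 3 (dX p) W := hp.isSmoothOn_dX hW (by norm_num)
  have hxx : IsSmoothOn 2 (dX (dX p)) W := hx.isSmoothOn_dX hW (by norm_num)
  have hy : IsSmoothOn 3 (dY p) W := hp.isSmoothOn_dY hW (by norm_num)
  have hyy : IsSmoothOn 2 (dY (dY p)) W := hy.isSmoothOn_dY hW (by norm_num)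
  have ht2 : IsSmoothOn 2 (dT p) W := ContDiffOn.of_le ht (by norm_num)
  exact (ContDiffOn.add htt ((contDiffOn_const.mul (contDiffOn_comp_time hlam hW0)).mul ht2)).sub
    (contDiffOn_const.mul (ContDiffOn.add hxx hyy))

lemma IsSmoothOn.isSmoothOn_residual (hp : IsSmoothOn 4 p W) (hW : IsOpen W)
    (hW0 : ∀ w ∈ W, 0 < w.2.2) (hlam : ContDiffOn ℝ 2 lam (Ioi 0)) :
    IsSmoothOn 0 (residual c lam p) W := by
  have ht : IsSmoothOn 3 (dT p) W := hp.isSmoothOn_dT hW (by norm_num)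
  have htt : IsSmoothOn 0 (dT (dT p)) W := ht.isSmoothOn_dT hW (by norm_num)
  have ht0 : IsSmoothOn 0 (dT p) W := ContDiffOn.of_le ht (by norm_num)
  have hq : IsSmoothOn 2 (telegraphOp c lam p) W := hp.isSmoothOn_telegraphOp hW hW0 hlam
  have hq0 : IsSmoothOn 0 (telegraphOp c lam p) W := ContDiffOn.of_le hq (by norm_num)
  have hqt : IsSmoothOn 1 (dT (telegraphOp c lam p)) W := hq.isSmoothOn_dT hW (by norm_num)
  have hqt0 : IsSmoothOn 0 (dT (telegraphOp c lam p)) W := ContDiffOn.of_le hqt (by norm_num)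
  have hqtt : IsSmoothOn 0 (dT (dT (telegraphOp c lam p))) W :=
    hqt.isSmoothOn_dT hW (by norm_num)
  have hy : IsSmoothOn 3 (dY p) W := hp.isSmoothOn_dY hW (by norm_num)
  have hyy : IsSmoothOn 2 (dY (dY p)) W := hy.isSmoothOn_dY hW (by norm_num)
  have hyyx : IsSmoothOn 1 (dX (dY (dY p))) W := hyy.isSmoothOn_dX hW (by norm_num)
  have hyyxx : IsSmoothOn 0 (dX (dX (dY (dY p)))) W := hyyx.isSmoothOn_dX hW (by norm_num)
  have hl' : ContDiffOn ℝ 1 (deriv lam) (Ioi 0) := hlam.deriv_of_isOpen isOpen_Ioi (by norm_num)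
  have hl'' : ContDiffOn ℝ 0 (deriv (deriv lam)) (Ioi 0) :=
    hl'.deriv_of_isOpen isOpen_Ioi (by norm_num)
  have a0 := contDiffOn_comp_time (hlam.of_le (m := 0) (by norm_num)) hW0
  have a1 := contDiffOn_comp_time (hl'.of_le (m := 0) (by norm_num)) hW0
  have a2 := contDiffOn_comp_time hl'' hW0
  exact (((ContDiffOn.add hqtt ((contDiffOn_const.mul a0).mul hqt0)).add
    (((a0.pow 2).add a1).mul hq0)).add (contDiffOn_const.mul hyyxx)).sub
      ((a1.mul htt).add ((a2.add (a0.mul a1)).mul ht0))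

end

section

variable {Ω : Type*} [MeasurableSpace Ω] {P : Measure Ω} [IsProbabilityMeasure P] {lam : ℝ → ℝ}
  {T : Ω → Set ℝ} {D : ℝ → Ω → ZMod 4} {c : ℝ} {p : ℝ → ℝ → ℝ → ℝ} {W : Set (ℝ × ℝ × ℝ)}

/-- The residual of a density of class `C^4` is orthogonal to test functions: both `p` and the law
of the position define the same functional on the test functions, and time derivatives of that
functional may be computed either way. -/
lemma IsDirectionProcess.pairing_residual (hD : IsDirectionProcess P lam T D) (hc : 0 < c)
    (hlam : ContDiffOn ℝ 2 lam (Ioi 0)) (hlam_nonneg : ∀ t, 0 < t → 0 ≤ lam t)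
    (hp : IsACComponent P c D p) (hW : IsOpen W) (hW0 : ∀ w ∈ W, 0 < w.2.2)
    (hWR : ∀ w ∈ W, (w.1, w.2.1) ∈ regularRegion c w.2.2) (hpW : IsSmoothOn 4 p W)
    {φ : ℝ × ℝ → ℝ} (hφ : IsTest φ) {I : Set ℝ} (hI : IsOpen I) (hI0 : I ⊆ Ioi 0)
    (h : ∀ t ∈ I, ∀ z ∈ tsupport φ, (z.1, z.2, t) ∈ W) {t : ℝ} (ht : t ∈ I) :
    pairing (residual c lam p) φ t = 0 := by
  obtain ⟨u₁, u₂, q, q₁, q₂, hu⟩ := hD.weak_equation hc hlam hlam_nonneg rfl hφ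
  have hpT : IsSmoothOn 3 (dT p) W := hpW.isSmoothOn_dT hW (by norm_num)
  have hpTT : IsSmoothOn 2 (dT (dT p)) W := hpT.isSmoothOn_dT hW (by norm_num)
  have hpX : IsSmoothOn 3 (dX p) W := hpW.isSmoothOn_dX hW (by norm_num)
  have hpXX : IsSmoothOn 2 (dX (dX p)) W := hpX.isSmoothOn_dX hW (by norm_num)
  have hpY : IsSmoothOn 3 (dY p) W := hpW.isSmoothOn_dY hW (by norm_num)
  have hpYY : IsSmoothOn 2 (dY (dY p)) W := hpY.isSmoothOn_dY hW (by norm_num)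
  have hpYYX : IsSmoothOn 1 (dX (dY (dY p))) W := hpYY.isSmoothOn_dX hW (by norm_num)
  have hpYYXX : IsSmoothOn 0 (dX (dX (dY (dY p)))) W := hpYYX.isSmoothOn_dX hW (by norm_num)
  have hq : IsSmoothOn 2 (telegraphOp c lam p) W := hpW.isSmoothOn_telegraphOp hW hW0 hlam
  have hqT : IsSmoothOn 1 (dT (telegraphOp c lam p)) W := hq.isSmoothOn_dT hW (by norm_num)
  have hqTT : IsSmoothOn 0 (dT (dT (telegraphOp c lam p))) W :=
    hqT.isSmoothOn_dT hW (by norm_num)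
  have hmean : ∀ ψ, IsTest ψ → tsupport ψ ⊆ tsupport φ → ∀ s ∈ I,
      pairing p ψ s = ∫ ω, ψ (position c D s ω) ∂P := fun ψ hψ hsub s hs =>
    hD.pairing_eq_integral hc hlam.continuousOn hlam_nonneg hp hψ.contDiff.continuous.measurable
      (hI0 hs) fun z hz => hWR _ (h s hs z (hsub (subset_tsupport ψ hz)))
  have e0 : EqOn (pairing p φ) (fun s => ∫ ω, φ (position c D s ω) ∂P) I :=
    hmean φ hφ le_rfl
  have e1 : EqOn (pairing (dT p) φ) u₁ I := eqOn_of_hasDerivAt hI e0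
    (fun s hs => hpW.hasDerivAt_pairing hW (by norm_num) hφ hI h hs)
    fun s hs => (hu s (hI0 hs)).1
  have e2 : EqOn (pairing (dT (dT p)) φ) u₂ I := eqOn_of_hasDerivAt hI e1
    (fun s hs => hpT.hasDerivAt_pairing hW (by norm_num) hφ hI h hs)
    fun s hs => (hu s (hI0 hs)).2.1
  have hsub : ∀ (v : ℝ × ℝ) (ψ : ℝ × ℝ → ℝ), tsupport (dirDeriv v (dirDeriv v ψ)) ⊆ tsupport ψ :=
    fun v ψ => (tsupport_dirDeriv_subset _ _).trans (tsupport_dirDeriv_subset _ _)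
  have e3 : EqOn (pairing (telegraphOp c lam p) φ) q I := by
    intro s hs
    have i1 := hpTT.integrable_mul hW hφ (h s hs)
    have i2 := hpT.integrable_mul hW hφ (h s hs)
    have i3 := hpXX.integrable_mul hW hφ (h s hs)
    have i4 := hpYY.integrable_mul hW hφ (h s hs)
    have hlin : pairing (telegraphOp c lam p) φ s = pairing (dT (dT p)) φ s +
        2 * lam s * pairing (dT p) φ s -
          c ^ 2 * (pairing (dX (dX p)) φ s + pairing (dY (dY p)) φ s) := by
      simp only [pairing]
      rw [← integral_add i3 i4, ← integral_const_mul, ← integral_const_mul,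
        ← integral_add i1 (i2.const_mul _),
        ← integral_sub (i1.fun_add (i2.const_mul _)) ((i3.fun_add i4).const_mul _)]
      refine integral_congr_ae (ae_of_all _ fun z => ?_)
      simp only [telegraphOp]
      ring
    rw [hlin, e1 hs, e2 hs, (hu s (hI0 hs)).2.2.1,
      hpW.pairing_dX_dX hW (by norm_num) hφ (h s hs),
      hpW.pairing_dY_dY hW (by norm_num) hφ (h s hs),
      hmean _ hφ.partialX.partialX (hsub _ _) s hs, hmean _ hφ.partialY.partialY (hsub _ _) s hs]
  have e4 : EqOn (pairing (dT (telegraphOp c lam p)) φ) q₁ I := eqOn_of_hasDerivAt hI e3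
    (fun s hs => hq.hasDerivAt_pairing hW (by norm_num) hφ hI h hs)
    fun s hs => (hu s (hI0 hs)).2.2.2.1
  have e5 : EqOn (pairing (dT (dT (telegraphOp c lam p))) φ) q₂ I := eqOn_of_hasDerivAt hI e4
    (fun s hs => hqT.hasDerivAt_pairing hW le_rfl hφ hI h hs)
    fun s hs => (hu s (hI0 hs)).2.2.2.2.1
  have e6 : pairing (dX (dX (dY (dY p)))) φ t =
      ∫ ω, partialY (partialY (partialX (partialX φ))) (position c D t ω) ∂P := by
    rw [hpYY.pairing_dX_dX hW le_rfl hφ (h t ht),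
      hpW.pairing_dY_dY hW (by norm_num) hφ.partialX.partialX
        fun z hz => h t ht z (hsub _ _ hz)]
    exact hmean _ hφ.partialX.partialX.partialY.partialY ((hsub _ _).trans (hsub _ _)) t ht
  have i1 := hqTT.integrable_mul hW hφ (h t ht)
  have i2 := hqT.integrable_mul hW hφ (h t ht)
  have i3 := hq.integrable_mul hW hφ (h t ht)
  have i4 := hpYYXX.integrable_mul hW hφ (h t ht)
  have i5 := hpTT.integrable_mul hW hφ (h t ht)
  have i6 := hpT.integrable_mul hW hφ (h t ht)
  have hlin : pairing (residual c lam p) φ t = pairing (dT (dT (telegraphOp c lam p))) φ t +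
      2 * lam t * pairing (dT (telegraphOp c lam p)) φ t +
      (lam t ^ 2 + deriv lam t) * pairing (telegraphOp c lam p) φ t +
      c ^ 4 * pairing (dX (dX (dY (dY p)))) φ t - (deriv lam t * pairing (dT (dT p)) φ t +
      (deriv (deriv lam) t + lam t * deriv lam t) * pairing (dT p) φ t) := by
    have j1 := i1.fun_add (i2.const_mul (2 * lam t))
    have j2 := j1.fun_add (i3.const_mul (lam t ^ 2 + deriv lam t))
    have j3 := j2.fun_add (i4.const_mul (c ^ 4))
    have j4 := (i5.const_mul (deriv lam t)).fun_add
      (i6.const_mul (deriv (deriv lam) t + lam t * deriv lam t))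
    simp only [pairing, ← integral_const_mul]
    rw [← integral_add i1 (i2.const_mul _), ← integral_add j1 (i3.const_mul _),
      ← integral_add j2 (i4.const_mul _), ← integral_add (i5.const_mul _) (i6.const_mul _),
      ← integral_sub j3 j4]
    refine integral_congr_ae (ae_of_all _ fun z => ?_)
    simp only [residual, dampingOp]
    ring
  rw [hlin, e1 ht, e2 ht, e3 ht, e4 ht, e5 ht, e6, sub_eq_zero]
  exact (hu t (hI0 ht)).2.2.2.2.2

/-- The fourth-order equation holds at the points of the regular region. -/
lemma IsDirectionProcess.residual_eq_zero (hD : IsDirectionProcess P lam T D) (hc : 0 < c)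
    (hlam : ContDiffOn ℝ 2 lam (Ioi 0)) (hlam_nonneg : ∀ t, 0 < t → 0 ≤ lam t)
    (hp : IsACComponent P c D p) (hW : IsOpen W) (hW0 : ∀ w ∈ W, 0 < w.2.2)
    (hWR : ∀ w ∈ W, (w.1, w.2.1) ∈ regularRegion c w.2.2) (hpW : IsSmoothOn 4 p W)
    {x y t : ℝ} (hxyt : (x, y, t) ∈ W) : residual c lam p x y t = 0 := by
  have hpre : (fun w : (ℝ × ℝ) × ℝ => (w.1.1, w.1.2, w.2)) ⁻¹' W ∈ 𝓝 ((x, y), t) :=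
    (hW.preimage (by fun_prop)).mem_nhds hxyt
  obtain ⟨U, I, hU, hxy, hI, ht, hUI⟩ := mem_nhds_prod_iff'.1 hpre
  have hbox : ∀ s ∈ I, ∀ z ∈ U, (z.1, z.2, s) ∈ W := fun s hs z hz => hUI (mk_mem_prod hz hs)
  have hcont : ContinuousOn (fun z : ℝ × ℝ => residual c lam p z.1 z.2 t) U :=
    ((hpW.isSmoothOn_residual hW hW0 hlam).continuousOn_slice t).mono fun z hz => hbox t ht z hz
  have hzero : ∀ φ : ℝ × ℝ → ℝ, ContDiff ℝ (⊤ : ℕ∞) φ → HasCompactSupport φ → tsupport φ ⊆ U →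
      ∫ z, φ z • residual c lam p z.1 z.2 t = 0 := by
    intro φ hφ hφc hφU
    have := hD.pairing_residual hc hlam hlam_nonneg hp hW hW0 hWR hpW ⟨hφ, hφc⟩ hI
      (fun s hs => hW0 _ (hbox s hs _ hxy)) (fun s hs z hz => hbox s hs z (hφU hz)) ht
    rw [← this, pairing]
    exact integral_congr_ae (ae_of_all _ fun z => mul_comm _ _)
  have hae := hU.ae_eq_zero_of_integral_contDiff_smul_eq_zero (μ := volume)
    (hcont.locallyIntegrableOn hU.measurableSet) hzero
  have hae' : (fun z : ℝ × ℝ => residual c lam p z.1 z.2 t) =ᵐ[volume.restrict U] fun _ => 0 :=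
    (ae_restrict_iff' hU.measurableSet).2 hae
  have heq := Measure.eqOn_open_of_ae_eq hae' hU hcont continuousOn_const
  exact heq (x := (x, y)) hxy

end

/-- Every horizontal line meets the complement of the regular region in finitely many points. -/
lemma eventually_mem_regularRegion (c x y t : ℝ) :
    ∀ᶠ x' in 𝓝[≠] x, (x', y) ∈ regularRegion c t := by
  have h : ∀ σ : ℝ, ∀ᶠ x' in 𝓝[≠] x, |diag σ (x', y)| ≠ |c * t| := by
    intro σ
    have hfin : ({c * t - σ * y, -(c * t) - σ * y} : Set ℝ).Finite := by simp
    filter_upwards [nhdsNE_le_cofinite x hfin.compl_mem_cofinite] with x' hx' heq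
    refine hx' ?_
    simp only [diag] at heq
    rcases abs_eq_abs.1 heq with h | h
    · left; linarith
    · right; simp only [mem_singleton_iff]; linarith
  exact (h 1).and (h (-1))

end OrthogonalMotion

theorem mainTheorem2 {Ω : Type*} [MeasurableSpace Ω] (P : Measure Ω) [IsProbabilityMeasure P]
    (c : ℝ) (hc : 0 < c)
    (lam : ℝ → ℝ) (hlam : ContDiffOn ℝ 2 lam (Ioi 0)) (hlam_nonneg : ∀ t, 0 < t → 0 ≤ lam t)
    (T : Ω → Set ℝ) (D : ℝ → Ω → ZMod 4)
    (hD : OrthogonalMotion.IsDirectionProcess P lam T D)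
    (p : ℝ → ℝ → ℝ → ℝ) (hp : OrthogonalMotion.IsACComponent P c D p)
    (O : Set (ℝ × ℝ × ℝ)) (hO : IsOpen O) (hO_pos : ∀ x y t, (x, y, t) ∈ O → 0 < t)
    (hp_smooth : ContDiffOn ℝ 4 (fun z : ℝ × ℝ × ℝ => p z.1 z.2.1 z.2.2) O)
    (x y t : ℝ) (hxyt : (x, y, t) ∈ O) :
    OrthogonalMotion.dampingOp lam (OrthogonalMotion.telegraphOp c lam p) x y t
        + c ^ 4 * OrthogonalMotion.dX (OrthogonalMotion.dX
            (OrthogonalMotion.dY (OrthogonalMotion.dY p))) x y t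
      = deriv lam t * OrthogonalMotion.dT (OrthogonalMotion.dT p) x y t
        + (deriv (deriv lam) t + lam t * deriv lam t) * OrthogonalMotion.dT p x y t := by
  have hO0 : ∀ w ∈ O, 0 < w.2.2 := fun w hw => hO_pos w.1 w.2.1 w.2.2 hw
  have hpO : OrthogonalMotion.IsSmoothOn 4 p O := hp_smooth
  set W := O ∩ {w : ℝ × ℝ × ℝ | (w.1, w.2.1) ∈ OrthogonalMotion.regularRegion c w.2.2}
  have hW : IsOpen W := hO.inter (OrthogonalMotion.isOpen_setOf_regularRegion c)
  have hline : Filter.Tendsto (fun x' : ℝ => (x', y, t)) (nhds x) (nhds (x, y, t)) :=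
    Continuous.tendsto (by fun_prop) x
  have hcont : Filter.Tendsto (fun x' => OrthogonalMotion.residual c lam p x' y t)
      (nhdsWithin x {x}ᶜ) (nhds (OrthogonalMotion.residual c lam p x y t)) :=
    (((ContDiffOn.continuousOn (hpO.isSmoothOn_residual hO hO0 hlam)).continuousAt
      (hO.mem_nhds hxyt)).tendsto.comp hline).mono_left nhdsWithin_le_nhds
  -- The equation holds off the singular lines; it extends to `O` by continuity along `x`.
  have hzero : ∀ᶠ x' in nhdsWithin x {x}ᶜ, OrthogonalMotion.residual c lam p x' y t = 0 := by
    filter_upwards [nhdsWithin_le_nhds (hline (hO.mem_nhds hxyt)),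
      OrthogonalMotion.eventually_mem_regularRegion c x y t] with x' h1 h2
    exact hD.residual_eq_zero hc hlam hlam_nonneg hp hW (fun w hw => hO0 w hw.1)
      (fun w hw => hw.2) (ContDiffOn.mono hpO inter_subset_left) ⟨h1, h2⟩
  exact sub_eq_zero.1 (tendsto_nhds_unique_of_eventuallyEq hcont tendsto_const_nhds hzero)
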